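/- Let $L^2(\mathbb R)=L^2(\mathbb R;\mathbb C)$, $p=-i\,\frac{d}{dx}$, $q=x$ (with their maximal domains), $a=\frac1{\sqrt2}(ip+q)$, $a^\dagger=\frac1{\sqrt2}(-ip+q)$, and let $D(p^2+q^2)=D(p^2)\cap D(q^2)$. For $\alpha,\beta>0$ the non-commutative harmonic oscillator is the operator $$Q^{\rm NH}_{\alpha\beta}=\begin{pmatrix}\alpha&0\\0&\beta\end{pmatrix}\otimes\Big(a^\dagger a+\tfrac12\Big)+\tfrac12\begin{pmatrix}0&-1\\1&0\end{pmatrix}\otimes\big(a^2-(a^\dagger)^2\big)$$ in $\mathbb C^2\otimes L^2(\mathbb R)=L^2(\mathbb R)\oplus L^2(\mathbb R)$. Its natural domain is $\mathcal D=D(p^2+q^2)\oplus D(p^2+q^2)$, and the following holds. (1) If $\alpha\beta>1$, then $Q^{\rm NH}_{\alpha\beta}$ is self-adjoint on $\mathcal D$ and its spectrum is purely discrete (every point of the spectrum is isolated in the spectrum and is an eigenvalue of finite multiplicity). The spectrum consists of a sequence of eigenvalues $\lambda_0\le\lambda_1\le\lambda_2\le\cdots$, counted with multiplicity, and for all $n\ge0$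 $$\Big(n+\tfrac12\Big)\min\{\alpha,\beta\}\sqrt{1-\tfrac1{\alpha\beta}}\le\lambda_{2n}\le\lambda_{2n+1}\le\Big(n+\tfrac12\Big)\max\{\alpha,\beta\}\sqrt{1-\tfrac1{\alpha\beta}}.$$ In particular $\inf\sigma(Q^{\rm NH}_{\alpha\beta})\ge\frac{\min\{\alpha,\beta\}}2\sqrt{1-\frac1{\alpha\beta}}$. (2) If $\alpha\beta=1$, then $Q^{\rm NH}_{\alpha\beta}$ is essentially self-adjoint on $\mathcal D$. Its closure is self-adjoint on the domain of all $(f_1,f_2)\in L^2(\mathbb R)\oplus L^2(\mathbb R)$ such that $\sqrt\alpha f_1-i\sqrt\beta f_2\in D\big(\overline{(p+q)^2}\big)$ and $\sqrt\alpha f_1+i\sqrt\beta f_2\in D\big(\overline{(p-q)^2}\big)$, and the spectrum of the closure satisfies $\inf\sigma=0$. (3) If $\alpha\beta<1$, then $Q^{\rm NH}_{\alpha\beta}$ is essentially self-adjoint on $\mathcal D$, and the spectrum of its closure satisfies $\inf\sigma=-\infty$. -/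

import Mathlib

open MeasureTheory
open scoped SchwartzMap ENNReal

noncomputable section

namespace NcHO

/-- The Hilbert space `L²(ℝ; ℂ)`. -/
abbrev L2 : Type := Lp ℂ 2 (volume : Measure ℝ)

/-- The Hilbert space `ℂ² ⊗ L²(ℝ) = L²(ℝ) ⊕ L²(ℝ)`. -/
abbrev H : Type := PiLp 2 (fun _ : Fin 2 => L2)

/-! ### Generalities on unbounded operators -/

/-- The product `S T` of unbounded operators, on its natural domain
`{f ∈ D(T) : T f ∈ D(S)}`. -/
def mul {E : Type*} [AddCommGroup E] [Module ℂ E] (S T : E →ₗ.[ℂ] E) : E →ₗ.[ℂ] E where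
  domain := (S.domain.comap T.toFun).map T.domain.subtype
  toFun := S.toFun ∘ₗ
    (LinearMap.codRestrict S.domain
      (T.toFun ∘ₗ Submodule.inclusion (Submodule.map_subtype_le _ _)) (by
        rintro ⟨x, hx⟩
        obtain ⟨y, hy, rfl⟩ := hx
        exact hy))

theorem mem_mul_domain {E : Type*} [AddCommGroup E] [Module ℂ E] (S T : E →ₗ.[ℂ] E) (f : E) :
    f ∈ (mul S T).domain ↔ ∃ h : f ∈ T.domain, T ⟨f, h⟩ ∈ S.domain := by
  constructor
  · rintro ⟨y, hy, rfl⟩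
    exact ⟨y.2, hy⟩
  · rintro ⟨h, h2⟩
    exact ⟨⟨f, h⟩, h2, rfl⟩

theorem mul_apply {E : Type*} [AddCommGroup E] [Module ℂ E] (S T : E →ₗ.[ℂ] E)
    (f : (mul S T).domain) (h : (f : E) ∈ T.domain) (h2 : T ⟨f, h⟩ ∈ S.domain) :
    mul S T f = S ⟨T ⟨f, h⟩, h2⟩ := rfl

/-- The everywhere defined identity operator. -/
def one {E : Type*} [AddCommGroup E] [Module ℂ E] : E →ₗ.[ℂ] E :=
  LinearMap.id.toPMap ⊤

/-- The resolvent set of an unbounded operator: those `z` for which `T - z : D(T) → E` is a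
bijection with bounded inverse `R`. -/
def resolventSet {E : Type*} [NormedAddCommGroup E] [NormedSpace ℂ E] (T : E →ₗ.[ℂ] E) : Set ℂ :=
  {z | ∃ R : E →L[ℂ] E,
    (∀ f : E, ∃ h : R f ∈ T.domain, T ⟨R f, h⟩ - z • R f = f) ∧
    (∀ f : T.domain, R (T f - z • (f : E)) = f)}

/-- The spectrum of an unbounded operator. -/
def spec {E : Type*} [NormedAddCommGroup E] [NormedSpace ℂ E] (T : E →ₗ.[ℂ] E) : Set ℂ :=
  (resolventSet T)ᶜ

/-- The eigenspace `{f ∈ D(T) : T f = z f}`. -/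
def eigenspace {E : Type*} [AddCommGroup E] [Module ℂ E] (T : E →ₗ.[ℂ] E) (z : ℂ) :
    Submodule ℂ E :=
  (LinearMap.ker (T.toFun - z • T.domain.subtype)).map T.domain.subtype

theorem mem_eigenspace {E : Type*} [AddCommGroup E] [Module ℂ E] (T : E →ₗ.[ℂ] E) (z : ℂ)
    (f : E) : f ∈ eigenspace T z ↔ ∃ h : f ∈ T.domain, T ⟨f, h⟩ = z • f := by
  constructor
  · rintro ⟨y, hy, rfl⟩
    exact ⟨y.2, sub_eq_zero.mp hy⟩
  · rintro ⟨h, h2⟩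
    exact ⟨⟨f, h⟩, sub_eq_zero.mpr h2, rfl⟩

/-- Purely discrete spectrum: every point of the spectrum is isolated in the spectrum and is an
eigenvalue of finite multiplicity. -/
def HasPurelyDiscreteSpectrum {E : Type*} [NormedAddCommGroup E] [NormedSpace ℂ E]
    (T : E →ₗ.[ℂ] E) : Prop :=
  ∀ z ∈ spec T, (∃ ε > 0, ∀ w ∈ spec T, ‖w - z‖ < ε → w = z) ∧
    eigenspace T z ≠ ⊥ ∧ FiniteDimensional ℂ (eigenspace T z)

/-- `lam 0 ≤ lam 1 ≤ …` is the list of all points of the spectrum, all of them eigenvalues,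
each repeated as often as its multiplicity. -/
def IsEigenvalueSequence {E : Type*} [NormedAddCommGroup E] [NormedSpace ℂ E]
    (T : E →ₗ.[ℂ] E) (lam : ℕ → ℝ) : Prop :=
  Monotone lam ∧ spec T = Set.range (fun n => (lam n : ℂ)) ∧
    ∀ x : ℝ, {n : ℕ | lam n = x}.encard = Cardinal.toENat (Module.rank ℂ (eigenspace T (x : ℂ)))

/-- The infimum of the (real) spectrum, as an extended real number. -/
def infSpec {E : Type*} [NormedAddCommGroup E] [NormedSpace ℂ E] (T : E →ₗ.[ℂ] E) : EReal :=
  sInf {y : EReal | ∃ x : ℝ, (x : ℂ) ∈ spec T ∧ y = (x : EReal)}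

/-- Essential self-adjointness: the operator is closable and its closure is self-adjoint. -/
def IsEssentiallySelfAdjoint {E : Type*} [NormedAddCommGroup E] [InnerProductSpace ℂ E]
    [CompleteSpace E] (T : E →ₗ.[ℂ] E) : Prop :=
  T.IsClosable ∧ IsSelfAdjoint T.closure

/-! ### The operators `p`, `q`, `a`, `a†` on `L²(ℝ)` -/

/-- The embedding of `L²(ℝ)` into the tempered distributions. -/
def toDistr : L2 →ₗ[ℂ] 𝓢'(ℝ, ℂ) :=
  (Lp.toTemperedDistributionCLM ℂ (volume : Measure ℝ) 2 : L2 →L[ℂ] 𝓢'(ℝ, ℂ)).toLinearMap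

theorem toDistr_injective : Function.Injective toDistr :=
  LinearMap.ker_eq_bot.mp Lp.ker_toTemperedDistributionCLM_eq_bot

/-- The maximal realization in `L²(ℝ)` of an operator `A` on tempered distributions: its domain
consists of the `f ∈ L²(ℝ)` with `A f ∈ L²(ℝ)`. -/
def realization (A : 𝓢'(ℝ, ℂ) →L[ℂ] 𝓢'(ℝ, ℂ)) : L2 →ₗ.[ℂ] L2 where
  domain := (LinearMap.range toDistr).comap (A.toLinearMap ∘ₗ toDistr)
  toFun := (LinearEquiv.ofInjective toDistr toDistr_injective).symm.toLinearMap ∘ₗ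
    (LinearMap.codRestrict (LinearMap.range toDistr)
      ((A.toLinearMap ∘ₗ toDistr) ∘ₗ Submodule.subtype _) (fun f => f.2))

theorem mem_realization_domain (A : 𝓢'(ℝ, ℂ) →L[ℂ] 𝓢'(ℝ, ℂ)) (f : L2) :
    f ∈ (realization A).domain ↔ ∃ g : L2, toDistr g = A (toDistr f) := Iff.rfl

theorem toDistr_realization (A : 𝓢'(ℝ, ℂ) →L[ℂ] 𝓢'(ℝ, ℂ)) (f : (realization A).domain) :
    toDistr (realization A f) = A (toDistr f) :=
  congrArg Subtype.val
    ((LinearEquiv.ofInjective toDistr toDistr_injective).apply_symm_apply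
      ⟨A (toDistr (f : L2)), f.2⟩)

/-- `p = -i d/dx`, with domain `{f ∈ L²(ℝ) : f' ∈ L²(ℝ)}`. -/
def p : L2 →ₗ.[ℂ] L2 :=
  realization ((-Complex.I) • TemperedDistribution.derivCLM ℂ)

/-- `q = x`, with domain `{f ∈ L²(ℝ) : x f ∈ L²(ℝ)}`. -/
def q : L2 →ₗ.[ℂ] L2 :=
  realization (TemperedDistribution.smulLeftCLM ℂ (fun x : ℝ => (x : ℂ)))

/-- The annihilation operator `a = (d/dx + x) / √2 = (i p + q) / √2`. -/
def a : L2 →ₗ.[ℂ] L2 := ((1 / Real.sqrt 2 : ℝ) : ℂ) • (Complex.I • p + q)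

/-- The creation operator `a† = (-d/dx + x) / √2 = (-i p + q) / √2`. -/
def adag : L2 →ₗ.[ℂ] L2 := ((1 / Real.sqrt 2 : ℝ) : ℂ) • ((-Complex.I) • p + q)

/-- The operator `p² + q²`, with domain `D(p²) ∩ D(q²)`. -/
def pSqAddqSq : L2 →ₗ.[ℂ] L2 := mul p p + mul q q

/-- The closure of the operator `(p + t q)²`. -/
def closedSq (t : ℝ) : L2 →ₗ.[ℂ] L2 :=
  (mul (p + (t : ℂ) • q) (p + (t : ℂ) • q)).closure

/-! ### The non-commutative harmonic oscillator -/

/-- The operator `M ⊗ T` on `ℂ² ⊗ L²(ℝ)`, with domain `ℂ² ⊗ D(T) = D(T) ⊕ D(T)`. -/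
def tensor (M : Matrix (Fin 2) (Fin 2) ℂ) (T : L2 →ₗ.[ℂ] L2) : H →ₗ.[ℂ] H where
  domain :=
    { carrier := {f | ∀ j, f j ∈ T.domain}
      add_mem' := fun hf hg j => T.domain.add_mem (hf j) (hg j)
      zero_mem' := fun _ => T.domain.zero_mem
      smul_mem' := fun c _ hf j => T.domain.smul_mem c (hf j) }
  toFun :=
    { toFun := fun f => WithLp.toLp 2 (fun i => ∑ j, M i j • T ⟨(f : H) j, f.2 j⟩)
      map_add' := fun f g => by
        ext1 i
        simp only [PiLp.add_apply, ← Finset.sum_add_distrib, ← smul_add, ← LinearPMap.map_add]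
        rfl
      map_smul' := fun c f => by
        ext1 i
        simp only [RingHom.id_apply, PiLp.smul_apply, Finset.smul_sum, smul_comm c,
          ← LinearPMap.map_smul]
        rfl }

/-- The non-commutative harmonic oscillator
`diag(α, β) ⊗ (a† a + 1/2) + (1/2) J ⊗ (a² - a†²)` with `J = (0, -1; 1, 0)`, on its natural
domain. -/
def Q (α β : ℝ) : H →ₗ.[ℂ] H :=
  tensor !![(α : ℂ), 0; 0, (β : ℂ)] (mul adag a + (1 / 2 : ℂ) • one) +
    (1 / 2 : ℂ) • tensor !![0, -1; 1, 0] (mul a a - mul adag adag)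

end NcHO

end

/-! Put x = √α, y = √β, B = diag(x, y) and J = (0, -1; 1, 0). By the commutation relation a² - (a†)²
= i (pq + qp), so the operator is B² ⊗ (p² + q²)/2 + iJ ⊗ (pq + qp)/2. Since B⁻¹ J B⁻¹ = (xy)⁻¹ J,
it equals B K B with K = (p² + q²)/2 + (xy)⁻¹ iJ ⊗ (pq + qp)/2. The Hermitian matrix iJ has
eigenvalues ±1 with eigenvectors (1, ±i)/√2, so K splits into two scalar operators (p² + q²)/2 + c
(pq + qp)/2 with c = ±(αβ)^(-1/2). Completing the square, each is ((p + cq)² + (1 - c²) q²)/2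
(`weakQ_iff_twist`, `oscMix_eq`). The sign of 1 - c² is that of αβ - 1, whence the three cases.

If αβ > 1, put ω = √(1 - c²). Ladder operators for p + cq produce generalized Hermite functions,
complete because polynomials times a complex Gaussian are dense (`eq_zero_of_orthogonal_gauss`).
They diagonalize each scalar operator with eigenvalues ω(n + 1/2), and all second order expressions
are bounded relative to the Hamiltonian, so the diagonal domain is D(p²) ∩ D(q²) for both values of
c (`good_and_weak_iff`). Hence K is diagonal with every level doubled. The inverse B⁻¹ K⁻¹ B⁻¹ of
the full operator is compact, symmetric and injective, which yields an eigenbasis. A min-max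
comparison based on min(α, β) ‖f‖² ≤ ‖B f‖² ≤ max(α, β) ‖f‖² bounds the eigenvalues
(`exists_isDiagonal_of_congruent`).

Essential self-adjointness holds for all parameters: the closure is the maximal realization. A pair
in the weak graph is approximated by cutting off Hermite expansions with linearly decreasing
weights. Quadratic expressions move the index by at most 2 with coefficients of size O(n), while the
weights vary by O(1/m) over such a step. The commutator error is therefore bounded, and it vanishes
in the limit by dominated convergence (`cutCompatible_of_shift`, `Q_isEssentiallySelfAdjoint`).

For αβ ≤ 1 the bottom of the spectrum is the bottom of the quadratic form
(`form_bound_of_resolventSet`, `mem_resolventSet_of_form_bound`). Ground states of free frequency ω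
in one sector give the form value ω/2 + (1 - c²)/(2ω) at a fixed norm (`exists_trial`). As ω tends
to 0 this tends to -∞ when c² > 1 and to 0 when c² = 1; in the latter case the form is a sum of
squares. -/

noncomputable section
namespace NcHO

/-! ### Schwartz functions inside `L²(ℝ)` -/

/-- The algebra of linear operators on Schwartz space. -/
abbrev SEnd : Type := Module.End ℂ 𝓢(ℝ, ℂ)

/-- The embedding of Schwartz space into `L²(ℝ)`. -/
def emb : 𝓢(ℝ, ℂ) →ₗ[ℂ] L2 := (SchwartzMap.toLpCLM ℂ ℂ 2 (volume : Measure ℝ)).toLinearMap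

/-- Momentum `-i d/dx` on Schwartz space. -/
def momS : SEnd := ((-Complex.I) • SchwartzMap.derivCLM ℂ ℂ).toLinearMap

/-- Multiplication by `x` on Schwartz space. -/
def posS : SEnd := (SchwartzMap.smulLeftCLM ℂ (fun x : ℝ => (x : ℂ))).toLinearMap

theorem hasTemperateGrowth_ofReal : (fun x : ℝ => (x : ℂ)).HasTemperateGrowth :=
  Complex.ofRealCLM.hasTemperateGrowth

@[simp] theorem momS_apply (φ : 𝓢(ℝ, ℂ)) (x : ℝ) : momS φ x = -Complex.I * deriv φ x := rfl

@[simp] theorem posS_apply (φ : 𝓢(ℝ, ℂ)) (x : ℝ) : posS φ x = x * φ x :=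
  SchwartzMap.smulLeftCLM_apply_apply hasTemperateGrowth_ofReal φ x

/-- The canonical commutation relation. -/
theorem mom_mul_pos : momS * posS = posS * momS - Complex.I • (1 : SEnd) := by
  ext φ x
  have h : HasDerivAt (posS φ) (φ x + x * deriv φ x) x := by
    have h1 : HasDerivAt (fun x : ℝ => (x : ℂ) * φ x) (1 * φ x + x * deriv φ x) x :=
      (Complex.ofRealCLM.hasDerivAt).mul (φ.hasDerivAt x)
    have h2 : (posS φ : ℝ → ℂ) = fun x : ℝ => (x : ℂ) * φ x := funext (posS_apply φ)
    rw [h2]; simpa using h1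
  simp only [Module.End.mul_apply, momS_apply, posS_apply, LinearMap.sub_apply, LinearMap.smul_apply,
    Module.End.one_apply, sub_apply, smul_apply, h.deriv, smul_eq_mul]
  ring

/-- Complex conjugation on Schwartz space. -/
def conjS (φ : 𝓢(ℝ, ℂ)) : 𝓢(ℝ, ℂ) :=
  SchwartzMap.postcompCLM (𝕜 := ℝ) (Complex.conjCLE : ℂ →L[ℝ] ℂ) φ

@[simp] theorem conjS_apply (φ : 𝓢(ℝ, ℂ)) (x : ℝ) : conjS φ x = (starRingEnd ℂ) (φ x) := rfl

theorem conjS_conjS (φ : 𝓢(ℝ, ℂ)) : conjS (conjS φ) = φ := by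
  ext x; simp

theorem conjS_posS (φ : 𝓢(ℝ, ℂ)) : conjS (posS φ) = posS (conjS φ) := by
  ext x; simp

theorem conjS_momS (φ : 𝓢(ℝ, ℂ)) : conjS (momS φ) = - momS (conjS φ) := by
  ext x
  have h : HasDerivAt (conjS φ) ((starRingEnd ℂ) (deriv φ x)) x :=
    (Complex.conjCLE : ℂ →L[ℝ] ℂ).hasFDerivAt.comp_hasDerivAt x (φ.hasDerivAt x)
  simp [h.deriv]

theorem emb_ae (φ : 𝓢(ℝ, ℂ)) : (emb φ : ℝ → ℂ) =ᵐ[volume] φ := φ.coeFn_toLp 2 volume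

theorem inner_emb (φ : 𝓢(ℝ, ℂ)) (f : L2) :
    inner ℂ (emb φ) f = ∫ x, (starRingEnd ℂ) (φ x) * f x := by
  rw [L2.inner_def]
  apply integral_congr_ae
  filter_upwards [emb_ae φ] with x hx
  rw [hx]
  simp [mul_comm]

theorem inner_emb_eq_toDistr (φ : 𝓢(ℝ, ℂ)) (f : L2) :
    inner ℂ (emb φ) f = toDistr f (conjS φ) := by
  rw [inner_emb]
  exact (Lp.toTemperedDistribution_apply f (conjS φ)).symm

/-- The inner product is conjugate linear in its first slot, whereas a distribution pairs
bilinearly. `conjS` mediates between the two, and every test function is a conjugate. -/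
theorem toDistr_eq_iff (f : L2) (F : 𝓢'(ℝ, ℂ)) :
    toDistr f = F ↔ ∀ φ, inner ℂ (emb φ) f = F (conjS φ) := by
  constructor
  · rintro rfl φ
    exact inner_emb_eq_toDistr φ f
  · intro h
    ext φ
    rw [← conjS_conjS φ, ← h, inner_emb_eq_toDistr]

theorem emb_injective : Function.Injective emb :=
  SchwartzMap.injective_toLp 2 volume

theorem denseRange_emb : DenseRange emb :=
  SchwartzMap.denseRange_toLpCLM (by simp)

/-- `g` is the weak image of `f` under the formal adjoint of the operator `A` on Schwartz space. -/
def Weak (A : SEnd) (f g : L2) : Prop := ∀ φ, inner ℂ (emb φ) g = inner ℂ (emb (A φ)) f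

theorem Weak.unique {A : SEnd} {f g g' : L2} (h : Weak A f g) (h' : Weak A f g') : g = g' :=
  denseRange_emb.eq_of_inner_left ℂ fun φ => by
    rw [← inner_conj_symm, h φ, ← h' φ, inner_conj_symm]

theorem Weak.add {A : SEnd} {f g f' g' : L2} (h : Weak A f g) (h' : Weak A f' g') :
    Weak A (f + f') (g + g') := fun φ => by rw [inner_add_right, inner_add_right, h φ, h' φ]

theorem Weak.congr_left {A : SEnd} {f g f' : L2} (h : Weak A f g) (hf : f = f') : Weak A f' g := hf ▸ h

theorem Weak.smul {A : SEnd} {f g : L2} (h : Weak A f g) (z : ℂ) :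
    Weak A (z • f) (z • g) := fun φ => by rw [inner_smul_right, inner_smul_right, h φ]

theorem Weak.op_add {A B : SEnd} {f g h : L2} (hA : Weak A f g) (hB : Weak B f h) :
    Weak (A + B) f (g + h) := fun φ => by
  rw [inner_add_right, hA φ, hB φ, LinearMap.add_apply, map_add, inner_add_left]

theorem Weak.op_smul {A : SEnd} {f g : L2} (hA : Weak A f g) (z : ℂ) :
    Weak (z • A) f ((starRingEnd ℂ) z • g) := fun φ => by
  rw [inner_smul_right, hA φ, LinearMap.smul_apply, map_smul, inner_smul_left]

/-- Weak images are images under formal adjoints, so composition reverses: the left factor `A` acts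
first on the vector side. -/
theorem Weak.mul {A B : SEnd} {f g h : L2} (hA : Weak A f g) (hB : Weak B g h) :
    Weak (A * B) f h := fun φ => by rw [hB φ, hA (B φ)]; rfl

theorem Weak.zero (A : SEnd) : Weak A 0 0 := fun φ => by simp

theorem weak_one (f : L2) : Weak 1 f f := fun _ => rfl

/-- The weak relation is closed, being given by continuous conditions on the pair. This is how
limits of Hermite sums enter maximal domains. -/
theorem Weak.lim {A : SEnd} {f g : L2} {u v : ℕ → L2} (hu : Filter.Tendsto u Filter.atTop (nhds f))
    (hv : Filter.Tendsto v Filter.atTop (nhds g)) (h : ∀ n, Weak A (u n) (v n)) : Weak A f g :=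
  fun φ => tendsto_nhds_unique
    ((Filter.Tendsto.inner (𝕜 := ℂ) tendsto_const_nhds hv).congr fun n => h n φ)
    (Filter.Tendsto.inner tendsto_const_nhds hu)

/-! ### Momentum and position as weak operators -/

theorem realization_graph (A : 𝓢'(ℝ, ℂ) →L[ℂ] 𝓢'(ℝ, ℂ)) (f g : L2) :
    (f, g) ∈ (realization A).graph ↔ toDistr g = A (toDistr f) := by
  rw [LinearPMap.mem_graph_iff]
  constructor
  · rintro ⟨y, hy, rfl⟩
    simp only at hy
    rw [toDistr_realization, hy]
  · intro h
    refine ⟨⟨f, (mem_realization_domain A f).2 ⟨g, h⟩⟩, rfl, toDistr_injective ?_⟩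
    rw [toDistr_realization, h]

/-- The sign from conjugating `-i` cancels the sign from transposing the derivative. -/
theorem p_graph (f g : L2) : (f, g) ∈ p.graph ↔ Weak momS f g := by
  rw [p, realization_graph, toDistr_eq_iff]
  refine forall_congr' fun φ => ?_
  rw [inner_emb_eq_toDistr (momS φ), conjS_momS]
  have : ((-Complex.I) • TemperedDistribution.derivCLM ℂ) (toDistr f) (conjS φ)
      = toDistr f (-momS (conjS φ)) := by
    have h1 : ((-Complex.I) • TemperedDistribution.derivCLM ℂ) (toDistr f) (conjS φ)
      = -Complex.I * toDistr f (-SchwartzMap.derivCLM ℂ ℂ (conjS φ)) := rfl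
    have h2 : -momS (conjS φ) = (-Complex.I) • (-SchwartzMap.derivCLM ℂ ℂ (conjS φ)) := by
      ext x; simp
    rw [h1, h2, map_smul, smul_eq_mul]
  rw [this]

theorem q_graph (f g : L2) : (f, g) ∈ q.graph ↔ Weak posS f g := by
  rw [q, realization_graph, toDistr_eq_iff]
  refine forall_congr' fun φ => ?_
  rw [inner_emb_eq_toDistr (posS φ), conjS_posS]
  rfl

theorem integral_conj_mul_deriv (φ ψ : 𝓢(ℝ, ℂ)) :
    ∫ x, (starRingEnd ℂ) (φ x) * deriv ψ x = - ∫ x, (starRingEnd ℂ) (deriv φ x) * ψ x := by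
  have h := SchwartzMap.integral_mul_deriv_eq_neg_deriv_mul (conjS φ) ψ
  have h' : ∀ x, deriv (conjS φ) x = (starRingEnd ℂ) (deriv φ x) := fun x =>
    ((Complex.conjCLE : ℂ →L[ℝ] ℂ).hasFDerivAt.comp_hasDerivAt x (φ.hasDerivAt x)).deriv
  simpa [h'] using h

theorem inner_emb_emb (φ ψ : 𝓢(ℝ, ℂ)) :
    inner ℂ (emb φ) (emb ψ) = ∫ x, (starRingEnd ℂ) (φ x) * ψ x := by
  rw [inner_emb]
  apply integral_congr_ae
  filter_upwards [emb_ae ψ] with x hx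
  rw [hx]

/-- `B` is a formal adjoint of `A` on Schwartz space. -/
def FormalAdj (A B : SEnd) : Prop :=
  ∀ φ ψ, inner ℂ (emb φ) (emb (A ψ)) = inner ℂ (emb (B φ)) (emb ψ)

theorem FormalAdj.weak {A B : SEnd} (h : FormalAdj A B) (ψ : 𝓢(ℝ, ℂ)) :
    Weak B (emb ψ) (emb (A ψ)) := fun φ => h φ ψ

theorem FormalAdj.symm {A B : SEnd} (h : FormalAdj A B) : FormalAdj B A := fun φ ψ => by
  rw [← inner_conj_symm, ← h, inner_conj_symm]

theorem FormalAdj.add {A B A' B' : SEnd} (h : FormalAdj A B) (h' : FormalAdj A' B') :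
    FormalAdj (A + A') (B + B') := fun φ ψ => by
  simp only [LinearMap.add_apply, map_add, inner_add_left, inner_add_right, h φ ψ, h' φ ψ]

theorem FormalAdj.smul {A B : SEnd} (h : FormalAdj A B) (z : ℂ) :
    FormalAdj (z • A) ((starRingEnd ℂ) z • B) := fun φ ψ => by
  simp only [LinearMap.smul_apply, map_smul, inner_smul_left, inner_smul_right, h φ ψ,
    Complex.conj_conj]

theorem FormalAdj.real_smul {A B : SEnd} (h : FormalAdj A B) (z : ℝ) :
    FormalAdj ((z : ℂ) • A) ((z : ℂ) • B) := by
  simpa using h.smul (z : ℂ)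

theorem FormalAdj.mul {A B A' B' : SEnd} (h : FormalAdj A B) (h' : FormalAdj A' B') :
    FormalAdj (A * A') (B' * B) := fun φ ψ => by
  rw [Module.End.mul_apply, Module.End.mul_apply, h, h']

theorem momS_symm : FormalAdj momS momS := fun φ ψ => by
  rw [inner_emb_emb, inner_emb_emb]
  have h := integral_conj_mul_deriv φ ψ
  calc ∫ x, (starRingEnd ℂ) (φ x) * momS ψ x
      = -Complex.I * ∫ x, (starRingEnd ℂ) (φ x) * deriv ψ x := by
        rw [← integral_const_mul]; congr 1; ext x; simp; ring
    _ = Complex.I * ∫ x, (starRingEnd ℂ) (deriv φ x) * ψ x := by rw [h]; ring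
    _ = _ := by rw [← integral_const_mul]; congr 1; ext x; simp; ring

theorem posS_symm : FormalAdj posS posS := fun φ ψ => by
  rw [inner_emb_emb, inner_emb_emb]
  congr 1; ext x; simp; ring

end NcHO
end

noncomputable section
namespace NcHO

/-! ### Complex Gaussians and density of polynomials times a Gaussian -/

/-- One term of the exponential series of b x² beats the even power x^(2j); all powers reduce to
even ones through t ≤ 1 + t². -/
theorem exists_bound_pow_mul_exp {b : ℝ} (hb : 0 < b) (j : ℕ) :
    ∃ C : ℝ, ∀ x : ℝ, |x| ^ j * Real.exp (-b * x ^ 2) ≤ C := by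
  refine ⟨1 + (j.factorial : ℝ) / b ^ j, fun x => ?_⟩
  have h1 : |x| ^ j ≤ 1 + (x ^ 2) ^ j := by
    rw [← sq_abs, ← pow_mul, mul_comm, pow_mul]
    nlinarith [sq_nonneg (|x| ^ j - 1)]
  have h2 := Real.pow_div_factorial_le_exp (b * x ^ 2) (by positivity) j
  have h3 : (x ^ 2) ^ j ≤ (j.factorial : ℝ) / b ^ j * Real.exp (b * x ^ 2) := by
    rw [mul_pow, div_le_iff₀ (by positivity)] at h2
    rw [div_mul_eq_mul_div, le_div_iff₀ (by positivity)]
    linarith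
  have h4 : Real.exp (-b * x ^ 2) ≤ 1 := by
    rw [Real.exp_le_one_iff]; nlinarith [sq_nonneg x]
  have h5 : Real.exp (b * x ^ 2) * Real.exp (-b * x ^ 2) = 1 := by
    rw [← Real.exp_add]; simp
  calc |x| ^ j * Real.exp (-b * x ^ 2)
      ≤ (1 + (j.factorial : ℝ) / b ^ j * Real.exp (b * x ^ 2)) * Real.exp (-b * x ^ 2) := by
        gcongr; linarith
    _ = Real.exp (-b * x ^ 2) + (j.factorial : ℝ) / b ^ j := by
        rw [add_mul, mul_assoc, h5]; ring
    _ ≤ _ := by linarith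

theorem exists_bound_polynomial_mul_exp {b : ℝ} (hb : 0 < b) (P : Polynomial ℂ) :
    ∃ C : ℝ, ∀ x : ℝ, ‖P.eval (x : ℂ)‖ * Real.exp (-b * x ^ 2) ≤ C := by
  induction P using Polynomial.induction_on' with
  | add P Q hP hQ =>
    obtain ⟨C, hC⟩ := hP
    obtain ⟨D, hD⟩ := hQ
    refine ⟨C + D, fun x => ?_⟩
    rw [Polynomial.eval_add]
    calc _ ≤ (‖P.eval (x : ℂ)‖ + ‖Q.eval (x : ℂ)‖) * Real.exp (-b * x ^ 2) := by
          gcongr; exact norm_add_le _ _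
      _ ≤ _ := by rw [add_mul]; exact add_le_add (hC x) (hD x)
  | monomial n a =>
    obtain ⟨C, hC⟩ := exists_bound_pow_mul_exp hb n
    refine ⟨‖a‖ * C, fun x => ?_⟩
    rw [Polynomial.eval_monomial, norm_mul, norm_pow, Complex.norm_real, mul_assoc]
    gcongr
    exact hC x

theorem hasDerivAt_polynomial_mul_cexp (z : ℂ) (P : Polynomial ℂ) (x : ℝ) :
    HasDerivAt (fun x : ℝ => P.eval (x : ℂ) * Complex.exp (-z * x ^ 2))
      ((P.derivative - Polynomial.C (2 * z) * Polynomial.X * P).eval (x : ℂ)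
        * Complex.exp (-z * x ^ 2)) x := by
  have h1 : HasDerivAt (fun x : ℝ => P.eval (x : ℂ)) (P.derivative.eval (x : ℂ)) x :=
    (P.hasDerivAt (x : ℂ)).comp_ofReal
  have h2 : HasDerivAt (fun x : ℂ => Complex.exp (-z * x ^ 2))
      (Complex.exp (-z * x ^ 2) * (-z * (2 * x))) (x : ℂ) := by
    simpa using ((hasDerivAt_pow 2 (x : ℂ)).const_mul (-z)).cexp
  refine (h1.mul h2.comp_ofReal).congr_deriv ?_
  simp
  ring

theorem exists_iteratedDeriv_cexp (z : ℂ) (n : ℕ) : ∃ P : Polynomial ℂ,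
    iteratedDeriv n (fun x : ℝ => Complex.exp (-z * x ^ 2))
      = fun x : ℝ => P.eval (x : ℂ) * Complex.exp (-z * x ^ 2) := by
  induction n with
  | zero => exact ⟨1, by simp⟩
  | succ n ih =>
    obtain ⟨P, hP⟩ := ih
    refine ⟨P.derivative - Polynomial.C (2 * z) * Polynomial.X * P, ?_⟩
    rw [iteratedDeriv_succ, hP]
    exact funext fun x => (hasDerivAt_polynomial_mul_cexp z P x).deriv

/-- The Gaussian `exp (-z x²)` as a Schwartz function. -/
def gauss (z : ℂ) (hz : 0 < z.re) : 𝓢(ℝ, ℂ) where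
  toFun x := Complex.exp (-z * x ^ 2)
  smooth' := by
    have : ContDiff ℝ (⊤ : ℕ∞) (fun x : ℝ => (x : ℂ)) := Complex.ofRealCLM.contDiff
    fun_prop
  decay' k n := by
    -- Every derivative is a polynomial times the same Gaussian, and the weight |x|^k only enlarges
    -- the polynomial.
    obtain ⟨P, hP⟩ := exists_iteratedDeriv_cexp z n
    obtain ⟨C, hC⟩ := exists_bound_polynomial_mul_exp hz (Polynomial.X ^ k * P)
    refine ⟨C, fun x => ?_⟩
    rw [norm_iteratedFDeriv_eq_norm_iteratedDeriv, hP]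
    rw [norm_mul, norm_cexp_neg_mul_sq, ← mul_assoc]
    simpa using hC x

@[simp] theorem gauss_apply (z : ℂ) (hz : 0 < z.re) (x : ℝ) :
    gauss z hz x = Complex.exp (-z * x ^ 2) := rfl

theorem deriv_gauss (z : ℂ) (hz : 0 < z.re) (x : ℝ) :
    deriv (gauss z hz) x = -(2 * z * x) * gauss z hz x := by
  have h := hasDerivAt_polynomial_mul_cexp z 1 x
  simp only [Polynomial.eval_one, one_mul] at h
  have h' : HasDerivAt (gauss z hz) _ x := h
  rw [h'.deriv]
  simp

theorem posS_pow_apply (n : ℕ) (φ : 𝓢(ℝ, ℂ)) (x : ℝ) : (posS ^ n) φ x = (x : ℂ) ^ n * φ x := by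
  induction n with
  | zero => simp
  | succ n ih => rw [pow_succ', Module.End.mul_apply, posS_apply, ih]; ring

/-- Half of the Gaussian decay absorbs the exponential: completing the square, |tx| - Re z x² ≤
t²/Re z - (Re z/2) x². The remaining half Gaussian is square integrable, and so is `f`. -/
theorem integrable_exp_mul_gauss (z : ℂ) (hz : 0 < z.re) (f : L2) (t : ℝ) :
    Integrable (fun x => Real.exp (|t * x|) * (Real.exp (-z.re * x ^ 2) * ‖f x‖)) := by
  have hz' : 0 < ((z.re / 2 : ℝ) : ℂ).re := by rw [Complex.ofReal_re]; linarith
  have h1 : MemLp (gauss _ hz') 2 volume := (gauss _ hz').memLp 2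
  have h2 := (MemLp.integrable_mul (p := 2) (q := 2) h1 (Lp.memLp f)).norm.const_mul
    (Real.exp (t ^ 2 / z.re))
  refine h2.mono' ?_ (Filter.Eventually.of_forall fun x => ?_)
  · exact (by fun_prop : Continuous fun x : ℝ => Real.exp (|t * x|)).aestronglyMeasurable.mul
      ((by fun_prop : Continuous fun x : ℝ => Real.exp (-z.re * x ^ 2)).aestronglyMeasurable.mul
        (Lp.aestronglyMeasurable f).norm)
  · rw [Real.norm_of_nonneg (by positivity), Pi.mul_apply, norm_mul, gauss_apply,
      norm_cexp_neg_mul_sq, ← mul_assoc, ← mul_assoc, ← Real.exp_add, ← Real.exp_add]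
    refine mul_le_mul_of_nonneg_right (Real.exp_le_exp.2 ?_) (norm_nonneg _)
    rw [Complex.ofReal_re, abs_mul, ← sub_nonneg]
    have : t ^ 2 / z.re + -(z.re / 2) * x ^ 2 - (|t| * |x| + -z.re * x ^ 2)
        = ((|t| - z.re * |x| / 2) ^ 2 + z.re ^ 2 * |x| ^ 2 / 4) / z.re := by
      field_simp
      rw [← sq_abs t, ← sq_abs x]
      ring
    rw [this]
    positivity

/-- A function orthogonal to all polynomials times a Gaussian vanishes. -/
theorem eq_zero_of_orthogonal_gauss (z : ℂ) (hz : 0 < z.re) (f : L2)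
    (h : ∀ n : ℕ, inner ℂ (emb ((posS ^ n) (gauss z hz))) f = 0) : f = 0 := by
  set g : ℝ → ℂ := fun x => (starRingEnd ℂ) (gauss z hz x) * f x with hg
  have hgn : ∀ x, ‖g x‖ = Real.exp (-z.re * x ^ 2) * ‖f x‖ := fun x => by
    rw [hg]; simp only; rw [norm_mul, RCLike.norm_conj, gauss_apply, norm_cexp_neg_mul_sq]
  have hgm : AEStronglyMeasurable g volume := by
    refine AEStronglyMeasurable.mul ?_ (Lp.aestronglyMeasurable f)
    exact (conjS (gauss z hz)).continuous.aestronglyMeasurable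
  have hgi : Integrable g := by
    have := integrable_exp_mul_gauss z hz f 0
    refine this.mono' hgm (Filter.Eventually.of_forall fun x => ?_)
    simp [hgn]
  have hmom : ∀ n : ℕ, ∫ x : ℝ, (x : ℂ) ^ n * g x = 0 := fun n => by
    rw [← h n, inner_emb]
    refine integral_congr_ae (Filter.Eventually.of_forall fun x => ?_)
    simp only
    rw [posS_pow_apply, hg]; simp; ring
  -- In the Taylor expansion of the exponential every term integrates to a multiple of a vanishing
  -- moment; the interchange is dominated by exp |tx| ‖g x‖.
  have hexp : ∀ t : ℝ, ∫ x : ℝ, Complex.exp (t * x * Complex.I) * g x = 0 := fun t => by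
    have key := hasSum_integral_of_dominated_convergence (μ := volume)
      (F := fun (n : ℕ) (x : ℝ) => (t * x * Complex.I) ^ n / n.factorial * g x)
      (f := fun x => Complex.exp (t * x * Complex.I) * g x)
      (fun n x => |t * x| ^ n / n.factorial * ‖g x‖) ?_ ?_ ?_ ?_ ?_
    · refine key.unique ?_
      convert hasSum_zero with n
      have : ∀ x : ℝ, (t * x * Complex.I) ^ n / n.factorial * g x
          = ((t * Complex.I) ^ n / n.factorial) * ((x : ℂ) ^ n * g x) := fun x => by ring
      simp_rw [this]
      rw [integral_const_mul, hmom, mul_zero]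
    · intro n
      exact (by fun_prop : Continuous fun x : ℝ =>
        ((t * x * Complex.I) ^ n / n.factorial : ℂ)).aestronglyMeasurable.mul hgm
    · intro n
      refine Filter.Eventually.of_forall fun x => ?_
      simp
    · exact Filter.Eventually.of_forall fun x => (Real.summable_pow_div_factorial _).mul_right _
    · refine (integrable_exp_mul_gauss z hz f t).congr (Filter.Eventually.of_forall fun x => ?_)
      simp only
      rw [tsum_mul_right, hgn, Real.exp_eq_exp_ℝ, NormedSpace.exp_eq_tsum_div]
    · refine Filter.Eventually.of_forall fun x => HasSum.mul_right _ ?_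
      rw [Complex.exp_eq_exp_ℂ]
      exact NormedSpace.expSeries_div_hasSum_exp _
  have hfour : FourierTransform.fourier g = 0 := by
    ext w
    rw [Real.fourier_real_eq_integral_exp_smul]
    have := hexp (-2 * Real.pi * w)
    rw [Pi.zero_apply, ← this]
    refine integral_congr_ae (Filter.Eventually.of_forall fun x => ?_)
    simp only [smul_eq_mul]
    congr 2
    push_cast
    ring
  -- Every Schwartz function is a Fourier transform, so the multiplication formula moves the
  -- transform onto `g`, where it vanishes.
  have hS : ∀ ψ : 𝓢(ℝ, ℂ), ∫ x, ψ x • g x = 0 := fun ψ => by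
    obtain ⟨χ, rfl⟩ : ∃ χ : 𝓢(ℝ, ℂ), FourierTransform.fourier χ = ψ :=
      ⟨FourierTransformInv.fourierInv ψ, FourierTransform.fourier_fourierInv_eq ψ⟩
    have := VectorFourier.integral_fourierIntegral_smul_eq_flip (μ := volume) (ν := volume)
      (f := χ) (g := g) (e := Real.fourierChar) (L := innerₗ ℝ) Real.continuous_fourierChar
      (by exact continuous_inner) χ.integrable hgi
    have h2 : VectorFourier.fourierIntegral Real.fourierChar volume (innerₗ ℝ).flip g = 0 := by
      rw [flip_innerₗ]; exact hfour
    rw [h2] at this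
    refine Eq.trans ?_ (this.trans (by simp))
    rfl
  have hg0 : ∀ᵐ x, g x = 0 := by
    refine ae_eq_zero_of_integral_contDiff_smul_eq_zero hgi.locallyIntegrable fun u hu hc => ?_
    have hg₁ : HasCompactSupport (Complex.ofRealCLM ∘ u) := hc.comp_left rfl
    have hg₂ : ContDiff ℝ (⊤ : ℕ∞) (Complex.ofRealCLM ∘ u) := by fun_prop
    have := hS (hg₁.toSchwartzMap hg₂)
    simpa using this
  -- The Gaussian has no zeros, so `f` vanishes wherever `g` does.
  refine (Lp.eq_zero_iff_ae_eq_zero).2 ?_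
  filter_upwards [hg0] with x hx
  simpa [hg] using hx

end NcHO
end

noncomputable section
namespace NcHO

/-! ### Ladder operators and Hermite functions -/

/-- The operator `p + c q` on Schwartz space. -/
def kinS (c : ℝ) : SEnd := momS + (c : ℂ) • posS

theorem kinS_symm (c : ℝ) : FormalAdj (kinS c) (kinS c) := momS_symm.add (posS_symm.real_smul c)

/-- The term cq commutes with q, so p + cq obeys the same relation as p. The ladder algebra for
every c rests on this. -/
theorem kin_mul_pos (c : ℝ) : kinS c * posS = posS * kinS c - Complex.I • (1 : SEnd) := by
  simp only [kinS, add_mul, mul_add, smul_mul_assoc, mul_smul_comm, mom_mul_pos]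
  module

/-- Normalization factor of the ladder operators. -/
def ladderConst (ω : ℝ) : ℝ := 1 / Real.sqrt (2 * ω)

theorem ladderConst_sq {ω : ℝ} (hω : 0 < ω) :
    (ladderConst ω : ℂ) * (ladderConst ω : ℂ) = 1 / (2 * ω) := by
  rw [← Complex.ofReal_mul, ladderConst, div_mul_div_comm, Real.mul_self_sqrt (by positivity)]
  simp

/-- The annihilation operator `(i (p + c q) + ω q) / √(2ω)`. -/
def ann (ω c : ℝ) : SEnd :=
  (ladderConst ω : ℂ) • (Complex.I • kinS c + (ω : ℂ) • posS)

/-- The creation operator `(-i (p + c q) + ω q) / √(2ω)`. -/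
def cre (ω c : ℝ) : SEnd :=
  (ladderConst ω : ℂ) • ((-Complex.I) • kinS c + (ω : ℂ) • posS)

/-- The Hamiltonian `(p + c q)² + ω² q²`. -/
def hamS (ω c : ℝ) : SEnd := kinS c * kinS c + ((ω : ℂ) ^ 2) • (posS * posS)

theorem ann_adj (ω c : ℝ) : FormalAdj (ann ω c) (cre ω c) := by
  have h1 := (kinS_symm c).smul Complex.I
  rw [Complex.conj_I] at h1
  exact (h1.add (posS_symm.real_smul ω)).real_smul (ladderConst ω)

/-- The cross terms combine to -iω[p + cq, q] = -ω; in the opposite order the sign flips. -/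
theorem cre_mul_ann {ω : ℝ} (hω : 0 < ω) (c : ℝ) :
    cre ω c * ann ω c = (1 / (2 * ω) : ℂ) • (hamS ω c - (ω : ℂ) • (1 : SEnd)) := by
  rw [cre, ann, smul_mul_smul_comm, ladderConst_sq hω, hamS]
  congr 1
  simp only [smul_mul_assoc, mul_smul_comm, add_mul, mul_add, kin_mul_pos]
  match_scalars <;> first
    | ring1
    | linear_combination -Complex.I_mul_I
    | linear_combination (ω : ℂ) * Complex.I_mul_I

theorem ann_mul_cre {ω : ℝ} (hω : 0 < ω) (c : ℝ) :
    ann ω c * cre ω c = (1 / (2 * ω) : ℂ) • (hamS ω c + (ω : ℂ) • (1 : SEnd)) := by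
  rw [ann, cre, smul_mul_smul_comm, ladderConst_sq hω, hamS]
  congr 1
  simp only [smul_mul_assoc, mul_smul_comm, add_mul, mul_add, kin_mul_pos]
  match_scalars <;> first
    | ring1
    | linear_combination -Complex.I_mul_I
    | linear_combination -(ω : ℂ) * Complex.I_mul_I

theorem ann_mul_cre_eq {ω : ℝ} (hω : 0 < ω) (c : ℝ) :
    ann ω c * cre ω c = cre ω c * ann ω c + 1 := by
  have : (ω : ℂ) ≠ 0 := by exact_mod_cast hω.ne'
  rw [ann_mul_cre hω, cre_mul_ann hω]
  match_scalars
  · ring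
  · field_simp; ring

theorem hamS_eq {ω : ℝ} (hω : 0 < ω) (c : ℝ) :
    hamS ω c = (2 * ω : ℂ) • (cre ω c * ann ω c) + (ω : ℂ) • (1 : SEnd) := by
  have : (ω : ℂ) ≠ 0 := by exact_mod_cast hω.ne'
  rw [cre_mul_ann hω]
  match_scalars
  · field_simp
  · field_simp; ring

theorem posS_eq {ω : ℝ} (hω : 0 < ω) (c : ℝ) :
    posS = (ladderConst ω : ℂ) • (ann ω c + cre ω c) := by
  have : (ω : ℂ) ≠ 0 := by exact_mod_cast hω.ne'
  simp only [cre, ann, smul_add, smul_smul, ladderConst_sq hω, ← mul_assoc]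
  match_scalars
  · field_simp; norm_num
  · ring

theorem kinS_eq {ω : ℝ} (hω : 0 < ω) (c : ℝ) :
    kinS c = (-Complex.I * ω * ladderConst ω : ℂ) • (ann ω c - cre ω c) := by
  have : (ω : ℂ) ≠ 0 := by exact_mod_cast hω.ne'
  have h := ladderConst_sq hω
  rw [eq_div_iff (by simpa using this)] at h
  simp only [cre, ann]
  match_scalars
  · linear_combination -h + 2 * ω * ladderConst ω ^ 2 * Complex.I_mul_I
  · ring

/-- The ground state, normalized in `L²`. -/
def ground {ω : ℝ} (hω : 0 < ω) (c : ℝ) : 𝓢(ℝ, ℂ) :=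
  ((‖emb (gauss ((ω + c * Complex.I) / 2) (by simpa using hω))‖⁻¹ : ℝ) : ℂ) •
    gauss ((ω + c * Complex.I) / 2) (by simpa using hω)

/-- The (generalized) Hermite functions, eigenfunctions of `(p + c q)² + ω² q²`. -/
def herm {ω : ℝ} (hω : 0 < ω) (c : ℝ) : ℕ → 𝓢(ℝ, ℂ)
  | 0 => ground hω c
  | n + 1 => ((1 / Real.sqrt (n + 1) : ℝ) : ℂ) • cre ω c (herm hω c n)

theorem gauss_ne_zero (z : ℂ) (hz : 0 < z.re) : gauss z hz ≠ 0 := fun h => by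
  have := congrArg (fun φ : 𝓢(ℝ, ℂ) => φ 0) h
  simp at this

section
variable {ω : ℝ} (hω : 0 < ω) (c : ℝ)

/-- Up to a factor the operator is d/dx + (ω + ic) x, which annihilates exp(-(ω + ic) x²/2). This
explains the parameter of the Gaussian in `ground`. -/
theorem ann_ground : ann ω c (ground hω c) = 0 := by
  rw [ground, map_smul]
  convert smul_zero _
  ext x
  simp only [ann, kinS, LinearMap.smul_apply, LinearMap.add_apply, smul_apply, add_apply, momS_apply,
    posS_apply, deriv_gauss, smul_eq_mul, zero_apply]
  ring_nf
  simp

theorem norm_emb_ground : ‖emb (ground hω c)‖ = 1 := by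
  rw [ground, map_smul, norm_smul, Complex.norm_real, norm_inv, norm_norm]
  exact inv_mul_cancel₀ (norm_ne_zero_iff.2 ((map_ne_zero_iff _ emb_injective).2
    (gauss_ne_zero _ _)))

theorem cre_herm (n : ℕ) :
    cre ω c (herm hω c n) = ((Real.sqrt (n + 1) : ℝ) : ℂ) • herm hω c (n + 1) := by
  have : Real.sqrt (n + 1) ≠ 0 := (Real.sqrt_pos.2 (by positivity)).ne'
  rw [herm, smul_smul, ← Complex.ofReal_mul, mul_one_div_cancel this, Complex.ofReal_one, one_smul]

theorem number_herm (n : ℕ) : cre ω c (ann ω c (herm hω c n)) = (n : ℂ) • herm hω c n := by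
  induction n with
  | zero => simp [herm, ann_ground]
  | succ n ih =>
    have h := congrArg (fun A : SEnd => A (herm hω c n)) (ann_mul_cre_eq hω c)
    simp only [Module.End.mul_apply, LinearMap.add_apply, ih, Module.End.one_apply] at h
    have h' : ann ω c (cre ω c (herm hω c n)) = ((n + 1 : ℕ) : ℂ) • herm hω c n := by
      rw [h]; push_cast; module
    rw [herm, map_smul, h', map_smul, map_smul, smul_comm]

theorem ann_herm_succ (n : ℕ) :
    ann ω c (herm hω c (n + 1)) = ((Real.sqrt (n + 1) : ℝ) : ℂ) • herm hω c n := by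
  have h := congrArg (fun A : SEnd => A (herm hω c n)) (ann_mul_cre_eq hω c)
  simp only [Module.End.mul_apply, LinearMap.add_apply, number_herm, Module.End.one_apply] at h
  rw [herm, map_smul, h]
  have : Real.sqrt (n + 1) ≠ 0 := (Real.sqrt_pos.2 (by positivity)).ne'
  have h3 : (1 / Real.sqrt (n + 1)) * (n + 1) = Real.sqrt (n + 1) := by
    field_simp
    rw [Real.sq_sqrt (by positivity)]
  rw [show (n : ℂ) • herm hω c n + herm hω c n = ((n + 1 : ℝ) : ℂ) • herm hω c n by
    push_cast; module, smul_smul, ← Complex.ofReal_mul, h3]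

theorem hamS_herm (n : ℕ) :
    hamS ω c (herm hω c n) = ((ω * (2 * n + 1) : ℝ) : ℂ) • herm hω c n := by
  rw [hamS_eq hω, LinearMap.add_apply, LinearMap.smul_apply, LinearMap.smul_apply,
    Module.End.mul_apply, number_herm, Module.End.one_apply]
  push_cast
  module

/-- Norms propagate because `ann` lowers with the same factor √(n + 1) with which `cre` raises.
Orthogonality holds because these are eigenvectors of the symmetric number operator with distinct
eigenvalues. -/
theorem orthonormal_herm : Orthonormal ℂ (fun n => emb (herm hω c n)) := by
  have hadj := ann_adj ω c
  have hN : FormalAdj (cre ω c * ann ω c) (cre ω c * ann ω c) := hadj.symm.mul hadj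
  constructor
  · intro n
    induction n with
    | zero => exact norm_emb_ground hω c
    | succ n ih =>
      have h1 : inner ℂ (emb (herm hω c (n + 1))) (emb (herm hω c (n + 1)))
          = inner ℂ (emb (herm hω c n)) (emb (herm hω c n)) := by
        conv_lhs => arg 3; rw [herm]
        rw [map_smul, inner_smul_right, hadj.symm, ann_herm_succ, map_smul, inner_smul_left,
          Complex.conj_ofReal, ← mul_assoc, ← Complex.ofReal_mul, one_div_mul_cancel
          (Real.sqrt_pos.2 (by positivity)).ne', Complex.ofReal_one, one_mul]
      rw [inner_self_eq_norm_sq_to_K, inner_self_eq_norm_sq_to_K, ih] at h1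
      have h2 : ‖emb (herm hω c (n + 1))‖ ^ 2 = 1 ^ 2 := by exact_mod_cast h1
      exact (sq_eq_sq₀ (norm_nonneg _) zero_le_one).1 h2
  · intro m n hmn
    have h := hN (herm hω c m) (herm hω c n)
    rw [Module.End.mul_apply, Module.End.mul_apply, number_herm, number_herm, map_smul, map_smul,
      inner_smul_left, inner_smul_right, Complex.conj_natCast] at h
    have h2 : ((n : ℂ) - m) * inner ℂ (emb (herm hω c m)) (emb (herm hω c n)) = 0 := by
      linear_combination h
    refine (mul_eq_zero.1 h2).resolve_left (sub_ne_zero.2 ?_)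
    exact_mod_cast hmn.symm

theorem ann_mem_span {φ : 𝓢(ℝ, ℂ)} (h : φ ∈ Submodule.span ℂ (Set.range (herm hω c))) :
    ann ω c φ ∈ Submodule.span ℂ (Set.range (herm hω c)) := by
  induction h using Submodule.span_induction with
  | mem _ h =>
    obtain ⟨n, rfl⟩ := h
    cases n with
    | zero => rw [herm, ann_ground]; exact zero_mem _
    | succ n => rw [ann_herm_succ]; exact Submodule.smul_mem _ _ (Submodule.subset_span ⟨n, rfl⟩)
  | zero => simp
  | add _ _ _ _ h1 h2 => rw [map_add]; exact add_mem h1 h2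
  | smul z _ _ h => rw [map_smul]; exact Submodule.smul_mem _ _ h

theorem cre_mem_span {φ : 𝓢(ℝ, ℂ)} (h : φ ∈ Submodule.span ℂ (Set.range (herm hω c))) :
    cre ω c φ ∈ Submodule.span ℂ (Set.range (herm hω c)) := by
  induction h using Submodule.span_induction with
  | mem _ h =>
    obtain ⟨n, rfl⟩ := h
    rw [cre_herm]; exact Submodule.smul_mem _ _ (Submodule.subset_span ⟨n + 1, rfl⟩)
  | zero => simp
  | add _ _ _ _ h1 h2 => rw [map_add]; exact add_mem h1 h2
  | smul z _ _ h => rw [map_smul]; exact Submodule.smul_mem _ _ h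

/-- Position is a combination of the two ladder operators, so it preserves the span. Completeness
thereby reduces to polynomials times a Gaussian. -/
theorem pos_pow_ground_mem_span (n : ℕ) :
    (posS ^ n) (ground hω c) ∈ Submodule.span ℂ (Set.range (herm hω c)) := by
  induction n with
  | zero => exact Submodule.subset_span ⟨0, rfl⟩
  | succ n ih =>
    rw [pow_succ', Module.End.mul_apply, posS_eq hω c, LinearMap.smul_apply, LinearMap.add_apply,
      ← posS_eq hω c]
    exact Submodule.smul_mem _ _ (add_mem (ann_mem_span hω c ih) (cre_mem_span hω c ih))

theorem span_herm_orthogonal :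
    (Submodule.span ℂ (Set.range (fun n => emb (herm hω c n))))ᗮ = ⊥ := by
  rw [Submodule.eq_bot_iff]
  intro f hf
  have h1 : ∀ φ ∈ Submodule.span ℂ (Set.range (herm hω c)), inner ℂ (emb φ) f = 0 := by
    intro φ hφ
    refine (Submodule.mem_orthogonal _ _).1 hf _ ?_
    have : Set.range (fun n => emb (herm hω c n)) = emb '' Set.range (herm hω c) := by
      rw [← Set.range_comp]; rfl
    rw [this, Submodule.span_image]
    exact Submodule.mem_map_of_mem hφ
  refine eq_zero_of_orthogonal_gauss ((ω + c * Complex.I) / 2) (by simpa using hω) f fun n => ?_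
  have h2 := h1 _ (pos_pow_ground_mem_span hω c n)
  rw [ground, map_smul, map_smul, inner_smul_left, mul_eq_zero] at h2
  refine h2.resolve_left ?_
  rw [Complex.conj_ofReal, Complex.ofReal_eq_zero]
  exact inv_ne_zero (norm_ne_zero_iff.2 ((map_ne_zero_iff _ emb_injective).2 (gauss_ne_zero _ _)))

/-- The Hilbert basis of (generalized) Hermite functions. -/
def hermBasis : HilbertBasis ℕ ℂ L2 :=
  HilbertBasis.mkOfOrthogonalEqBot (orthonormal_herm hω c) (span_herm_orthogonal hω c)

theorem hermBasis_apply (n : ℕ) : hermBasis hω c n = emb (herm hω c n) :=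
  congrFun (HilbertBasis.coe_mkOfOrthogonalEqBot _ _) n

end

end NcHO
end

noncomputable section
namespace NcHO

/-! ### Graphs of sums, multiples, products and tensor products -/

section Graphs
variable {E : Type*} [AddCommGroup E] [Module ℂ E]

theorem add_graph_iff (S T : E →ₗ.[ℂ] E) (f g : E) :
    (f, g) ∈ (S + T).graph ↔ ∃ u v, (f, u) ∈ S.graph ∧ (f, v) ∈ T.graph ∧ g = u + v := by
  constructor
  · rw [LinearPMap.mem_graph_iff]
    rintro ⟨⟨y, hy⟩, rfl, rfl⟩
    exact ⟨_, _, S.mem_graph ⟨y, hy.1⟩, T.mem_graph ⟨y, hy.2⟩, rfl⟩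
  · rintro ⟨u, v, hu, hv, rfl⟩
    rw [LinearPMap.mem_graph_iff'] at hu hv
    obtain ⟨y, hy⟩ := hu
    obtain ⟨⟨z, hz'⟩, hz⟩ := hv
    obtain ⟨rfl, rfl⟩ := Prod.mk_inj.1 hy
    obtain ⟨rfl, rfl⟩ := Prod.mk_inj.1 hz
    exact (S + T).mem_graph ⟨y, y.2, hz'⟩

theorem sub_graph_iff (S T : E →ₗ.[ℂ] E) (f g : E) :
    (f, g) ∈ (S - T).graph ↔ ∃ u v, (f, u) ∈ S.graph ∧ (f, v) ∈ T.graph ∧ g = u - v := by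
  constructor
  · rw [LinearPMap.mem_graph_iff]
    rintro ⟨⟨y, hy⟩, rfl, rfl⟩
    exact ⟨_, _, S.mem_graph ⟨y, hy.1⟩, T.mem_graph ⟨y, hy.2⟩, rfl⟩
  · rintro ⟨u, v, hu, hv, rfl⟩
    rw [LinearPMap.mem_graph_iff'] at hu hv
    obtain ⟨y, hy⟩ := hu
    obtain ⟨⟨z, hz'⟩, hz⟩ := hv
    obtain ⟨rfl, rfl⟩ := Prod.mk_inj.1 hy
    obtain ⟨rfl, rfl⟩ := Prod.mk_inj.1 hz
    exact (S - T).mem_graph ⟨y, y.2, hz'⟩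

theorem smul_graph_iff (z : ℂ) (T : E →ₗ.[ℂ] E) (f g : E) :
    (f, g) ∈ (z • T).graph ↔ ∃ u, (f, u) ∈ T.graph ∧ g = z • u := by
  rw [LinearPMap.mem_graph_iff]
  constructor
  · rintro ⟨y, rfl, rfl⟩
    exact ⟨_, T.mem_graph y, rfl⟩
  · rintro ⟨u, hu, rfl⟩
    rw [LinearPMap.mem_graph_iff] at hu
    obtain ⟨y, hy, rfl⟩ := hu
    exact ⟨y, hy, rfl⟩

theorem mul_graph_iff (S T : E →ₗ.[ℂ] E) (f g : E) :
    (f, g) ∈ (mul S T).graph ↔ ∃ h, (f, h) ∈ T.graph ∧ (h, g) ∈ S.graph := by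
  constructor
  · rw [LinearPMap.mem_graph_iff]
    rintro ⟨⟨y, hy⟩, rfl, rfl⟩
    obtain ⟨h1, h2⟩ := (mem_mul_domain S T y).1 hy
    exact ⟨_, T.mem_graph ⟨y, h1⟩, S.mem_graph ⟨_, h2⟩⟩
  · rintro ⟨h, h1, h2⟩
    rw [LinearPMap.mem_graph_iff'] at h1 h2
    obtain ⟨y, hy⟩ := h1
    obtain ⟨⟨z, hz'⟩, hz⟩ := h2
    obtain ⟨rfl, rfl⟩ := Prod.mk_inj.1 hy
    obtain ⟨rfl, rfl⟩ := Prod.mk_inj.1 hz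
    exact (mul S T).mem_graph ⟨y, (mem_mul_domain S T y).2 ⟨y.2, hz'⟩⟩

theorem one_graph_iff (f g : E) : (f, g) ∈ (one : E →ₗ.[ℂ] E).graph ↔ g = f := by
  rw [LinearPMap.mem_graph_iff]
  constructor
  · rintro ⟨y, rfl, rfl⟩; rfl
  · rintro rfl
    exact ⟨⟨g, trivial⟩, rfl, rfl⟩

end Graphs

theorem tensor_graph_iff (M : Matrix (Fin 2) (Fin 2) ℂ) (T : L2 →ₗ.[ℂ] L2) (f g : H) :
    (f, g) ∈ (tensor M T).graph ↔
      ∃ u : Fin 2 → L2, (∀ j, (f j, u j) ∈ T.graph) ∧ ∀ i, g i = ∑ j, M i j • u j := by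
  rw [LinearPMap.mem_graph_iff]
  constructor
  · rintro ⟨y, rfl, rfl⟩
    exact ⟨fun j => T ⟨(y : H) j, y.2 j⟩, fun j => T.mem_graph ⟨(y : H) j, y.2 j⟩, fun i => rfl⟩
  · rintro ⟨u, hu, hg⟩
    have hd : ∀ j, f j ∈ T.domain := fun j => LinearPMap.mem_domain_of_mem_graph (hu j)
    refine ⟨⟨f, hd⟩, rfl, ?_⟩
    ext1 i
    rw [hg]
    have h : ∀ j, T ⟨f j, hd j⟩ = u j := fun j =>
      T.mem_graph_snd_inj (T.mem_graph ⟨f j, hd j⟩) (hu j) rfl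
    simp only [← h]
    rfl

/-! ### Functions with all second order expressions in `L²` -/

/-- The first and second order expressions in `p`, `q` applied to `f`. -/
structure Second (f f1 f2 f11 f12 f21 f22 : L2) : Prop where
  mom : Weak momS f f1
  pos : Weak posS f f2
  mom_mom : Weak momS f1 f11
  pos_mom : Weak posS f1 f12
  mom_pos : Weak momS f2 f21
  pos_pos : Weak posS f2 f22

/-- All expressions of order two in `p` and `q` are defined on `f`. -/
def Good (f : L2) : Prop := ∃ f1 f2 f11 f12 f21 f22, Second f f1 f2 f11 f12 f21 f22

/-- Both sides are weak images of `f` under operators that agree by the canonical commutation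
relation, and weak images are unique. -/
theorem Second.comm {f f1 f2 f11 f12 f21 f22 : L2} (h : Second f f1 f2 f11 f12 f21 f22) :
    f21 = f12 - Complex.I • f := by
  have h1 : Weak (posS * momS) f f21 := h.pos.mul h.mom_pos
  have h2 : Weak (momS * posS) f f12 := h.mom.mul h.pos_mom
  have h3 : posS * momS = momS * posS + Complex.I • (1 : SEnd) := by
    rw [mom_mul_pos]; module
  have h4 := h2.op_add ((weak_one f).op_smul Complex.I)
  rw [← h3, Complex.conj_I] at h4
  rw [h1.unique h4]
  module

/-- The operator `(p q + q p) / 2` on Schwartz space. -/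
def mixS : SEnd := (1 / 2 : ℂ) • (momS * posS + posS * momS)

theorem mixS_symm : FormalAdj mixS mixS := by
  have := ((momS_symm.mul posS_symm).add (posS_symm.mul momS_symm)).real_smul (1 / 2)
  rw [add_comm (posS * momS)] at this
  simpa [mixS] using this

/-- The operator `(p² + q²) / 2` on Schwartz space. -/
def oscS : SEnd := (1 / 2 : ℂ) • (momS * momS + posS * posS)

theorem oscS_symm : FormalAdj oscS oscS := by
  have := ((momS_symm.mul momS_symm).add (posS_symm.mul posS_symm)).real_smul (1 / 2)
  simpa [oscS] using this

/-- Expanding the square gives q² the coefficient c² + ω², which the constraint makes equal to that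
of p². -/
theorem hamS_eq_osc_mix (ω c : ℝ) (h : ω ^ 2 + c ^ 2 = 1) :
    hamS ω c = (2 : ℂ) • oscS + (2 * c : ℂ) • mixS := by
  have h' : (ω : ℂ) ^ 2 = 1 - c ^ 2 := by rw [eq_sub_iff_add_eq]; exact_mod_cast h
  simp only [hamS, kinS, oscS, mixS, add_mul, mul_add, smul_mul_assoc, mul_smul_comm, h']
  module

theorem conj_half : (starRingEnd ℂ) (1 / 2 : ℂ) = 1 / 2 := by
  rw [show (1 / 2 : ℂ) = ((1 / 2 : ℝ) : ℂ) by norm_num, Complex.conj_ofReal]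

theorem Second.weak_osc {f f1 f2 f11 f12 f21 f22 : L2} (h : Second f f1 f2 f11 f12 f21 f22) :
    Weak oscS f ((1 / 2 : ℂ) • (f11 + f22)) := by
  have := ((h.mom.mul h.mom_mom).op_add (h.pos.mul h.pos_pos)).op_smul (1 / 2 : ℂ)
  rwa [conj_half] at this

theorem Second.weak_mix {f f1 f2 f11 f12 f21 f22 : L2} (h : Second f f1 f2 f11 f12 f21 f22) :
    Weak mixS f ((1 / 2 : ℂ) • (f12 + f21)) := by
  have := ((h.mom.mul h.pos_mom).op_add (h.pos.mul h.mom_pos)).op_smul (1 / 2 : ℂ)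
  rwa [conj_half] at this

/-! ### The domain of the harmonic oscillator -/

section RelBounded
variable {ω : ℝ}

/-- Boundedness of `A` relative to the shifted number operator. -/
def RelBdd (ω c : ℝ) (A : SEnd) : Prop :=
  ∃ C : ℝ, ∀ φ, ‖emb (A φ)‖ ≤ C * ‖emb ((ann ω c * cre ω c) φ)‖

theorem RelBdd.add (c : ℝ) {A B : SEnd} (hA : RelBdd ω c A) (hB : RelBdd ω c B) : RelBdd ω c (A + B) := by
  obtain ⟨C, hC⟩ := hA
  obtain ⟨D, hD⟩ := hB
  refine ⟨C + D, fun φ => ?_⟩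
  rw [LinearMap.add_apply, map_add, add_mul]
  exact (norm_add_le _ _).trans (add_le_add (hC φ) (hD φ))

theorem RelBdd.smul (c : ℝ) {A : SEnd} (hA : RelBdd ω c A) (z : ℂ) : RelBdd ω c (z • A) := by
  obtain ⟨C, hC⟩ := hA
  refine ⟨‖z‖ * C, fun φ => ?_⟩
  rw [LinearMap.smul_apply, map_smul, norm_smul, mul_assoc]
  exact mul_le_mul_of_nonneg_left (hC φ) (norm_nonneg _)

theorem RelBdd.sub (c : ℝ) {A B : SEnd} (hA : RelBdd ω c A) (hB : RelBdd ω c B) :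
    RelBdd ω c (A - B) := by
  have := hA.add c (hB.smul c (-1))
  rwa [neg_one_smul, ← sub_eq_add_neg] at this

/-- This is the relation [ann, cre] = 1 read as an identity of quadratic forms; the relative bounds
below come from it. -/
theorem norm_sq_cre (hω : 0 < ω) (c : ℝ) (φ : 𝓢(ℝ, ℂ)) :
    ‖emb (cre ω c φ)‖ ^ 2 = ‖emb (ann ω c φ)‖ ^ 2 + ‖emb φ‖ ^ 2 := by
  have hadj := ann_adj ω c
  have h1 : inner ℂ (emb (cre ω c φ)) (emb (cre ω c φ))
      = inner ℂ (emb (ann ω c φ)) (emb (ann ω c φ)) + inner ℂ (emb φ) (emb φ) := by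
    rw [← hadj, ← hadj.symm, ← inner_add_right, ← map_add, ← Module.End.mul_apply,
      ann_mul_cre_eq hω]
    rfl
  simp only [inner_self_eq_norm_sq_to_K] at h1
  exact_mod_cast h1

theorem norm_cre_sq_le (ω c : ℝ) (φ : 𝓢(ℝ, ℂ)) :
    ‖emb (cre ω c φ)‖ ^ 2 ≤ ‖emb φ‖ * ‖emb ((ann ω c * cre ω c) φ)‖ := by
  have h1 := (ann_adj ω c) φ (cre ω c φ)
  rw [inner_self_eq_norm_sq_to_K] at h1
  have h2 := norm_inner_le_norm (𝕜 := ℂ) (emb φ) (emb ((ann ω c * cre ω c) φ))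
  rw [Module.End.mul_apply, h1, norm_pow] at h2
  simpa using h2

theorem norm_le_number (hω : 0 < ω) (c : ℝ) (φ : 𝓢(ℝ, ℂ)) :
    ‖emb φ‖ ≤ ‖emb ((ann ω c * cre ω c) φ)‖ := by
  have h1 := norm_sq_cre hω c φ
  have h2 := norm_cre_sq_le ω c φ
  by_contra! h
  nlinarith [norm_nonneg (emb φ), norm_nonneg (emb ((ann ω c * cre ω c) φ)),
    sq_nonneg ‖emb (ann ω c φ)‖]

theorem relBdd_one (hω : 0 < ω) (c : ℝ) : RelBdd ω c 1 := ⟨1, fun φ => by simpa using norm_le_number hω c φ⟩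

theorem norm_cre_le (hω : 0 < ω) (c : ℝ) (φ : 𝓢(ℝ, ℂ)) : ‖emb (cre ω c φ)‖ ≤ ‖emb ((ann ω c * cre ω c) φ)‖ := by
  refine (sq_le_sq₀ (norm_nonneg _) (norm_nonneg _)).1 ((norm_cre_sq_le ω c φ).trans ?_)
  rw [sq]
  exact mul_le_mul_of_nonneg_right (norm_le_number hω c φ) (norm_nonneg _)

theorem norm_ann_le_cre (hω : 0 < ω) (c : ℝ) (φ : 𝓢(ℝ, ℂ)) : ‖emb (ann ω c φ)‖ ≤ ‖emb (cre ω c φ)‖ := by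
  refine (sq_le_sq₀ (norm_nonneg _) (norm_nonneg _)).1 ?_
  rw [norm_sq_cre hω c]
  linarith [sq_nonneg ‖emb φ‖]

theorem relBdd_cre (hω : 0 < ω) (c : ℝ) : RelBdd ω c (cre ω c) := ⟨1, fun φ => by simpa using norm_cre_le hω c φ⟩

theorem relBdd_ann (hω : 0 < ω) (c : ℝ) : RelBdd ω c (ann ω c) :=
  ⟨1, fun φ => by simpa using (norm_ann_le_cre hω c φ).trans (norm_cre_le hω c φ)⟩

theorem relBdd_ann_cre (c : ℝ) : RelBdd ω c (ann ω c * cre ω c) := ⟨1, fun φ => by simp⟩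

theorem relBdd_cre_ann (hω : 0 < ω) (c : ℝ) : RelBdd ω c (cre ω c * ann ω c) := by
  rw [eq_sub_of_add_eq (ann_mul_cre_eq hω c).symm]
  exact (relBdd_ann_cre c).sub c (relBdd_one hω c)

/-- `ann` is dominated by `cre` on every vector, in particular on `ann ω c φ`, so the bound for `cre
* ann` suffices. -/
theorem relBdd_ann_ann (hω : 0 < ω) (c : ℝ) : RelBdd ω c (ann ω c * ann ω c) := by
  obtain ⟨C, hC⟩ := relBdd_cre_ann hω c
  exact ⟨C, fun φ => (norm_ann_le_cre hω c (ann ω c φ)).trans (hC φ)⟩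

/-- The squared norm exceeds that of `ann * cre` only by ‖cre φ‖², which is bounded already; √2
would do in place of 2. -/
theorem relBdd_cre_cre (hω : 0 < ω) (c : ℝ) : RelBdd ω c (cre ω c * cre ω c) := by
  refine ⟨2, fun φ => ?_⟩
  have h1 := norm_sq_cre hω c (cre ω c φ)
  have h2 := norm_cre_le hω c φ
  refine (sq_le_sq₀ (norm_nonneg _) (by positivity)).1 ?_
  rw [Module.End.mul_apply, h1, mul_pow, ← Module.End.mul_apply]
  nlinarith [norm_nonneg (emb (cre ω c φ)), norm_nonneg (emb ((ann ω c * cre ω c) φ))]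

theorem relBdd_pos (hω : 0 < ω) (c : ℝ) : RelBdd ω c posS := by
  rw [posS_eq hω c]
  exact ((relBdd_ann hω c).add c (relBdd_cre hω c)).smul c _

/-- Products of two expressions linear in p and q have this form, so one bound covers p², q², pq and
qp. -/
theorem relBdd_quadratic (hω : 0 < ω) (c : ℝ) (s t s' t' : ℂ) :
    RelBdd ω c ((s • ann ω c + t • cre ω c) * (s' • ann ω c + t' • cre ω c)) := by
  have h : (s • ann ω c + t • cre ω c) * (s' • ann ω c + t' • cre ω c)
      = (s * s') • (ann ω c * ann ω c) + (t * s') • (cre ω c * ann ω c)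
        + (s * t') • (ann ω c * cre ω c) + (t * t') • (cre ω c * cre ω c) := by
    simp only [add_mul, mul_add, smul_mul_assoc, mul_smul_comm]
    module
  rw [h]
  exact ((((relBdd_ann_ann hω c).smul c _).add c ((relBdd_cre_ann hω c).smul c _)).add c
    ((relBdd_ann_cre c).smul c _)).add c ((relBdd_cre_cre hω c).smul c _)

theorem posS_eq' (hω : 0 < ω) (c : ℝ) : posS = (ladderConst ω : ℂ) • ann ω c + (ladderConst ω : ℂ) • cre ω c := by
  rw [← smul_add, ← posS_eq hω c]

theorem momS_eq' (hω : 0 < ω) (c : ℝ) : ∃ s t : ℂ, momS = s • ann ω c + t • cre ω c := by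
  have h1 : momS = kinS c - (c : ℂ) • posS := by rw [kinS]; module
  rw [kinS_eq hω c, posS_eq hω c] at h1
  exact ⟨-Complex.I * ω * ladderConst ω - c * ladderConst ω,
    Complex.I * ω * ladderConst ω - c * ladderConst ω, by rw [h1]; module⟩

/-- The shifted number operator is (`hamS` + ω)/(2ω), so it converges along `ψ` whenever the
Hamiltonian does. A relative bound passes the Cauchy property on to `A`. -/
theorem RelBdd.exists_lim (hω : 0 < ω) (c : ℝ) {A : SEnd} (hA : RelBdd ω c A) {ψ : ℕ → 𝓢(ℝ, ℂ)} {f g : L2}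
    (hf : Filter.Tendsto (fun n => emb (ψ n)) Filter.atTop (nhds f))
    (hg : Filter.Tendsto (fun n => emb (hamS ω c (ψ n))) Filter.atTop (nhds g)) :
    ∃ y, Filter.Tendsto (fun n => emb (A (ψ n))) Filter.atTop (nhds y) := by
  obtain ⟨C, hC⟩ := hA
  have hM : Filter.Tendsto (fun n => emb ((ann ω c * cre ω c) (ψ n))) Filter.atTop
      (nhds ((1 / (2 * ω) : ℂ) • (g + (ω : ℂ) • f))) := by
    refine ((hg.add (hf.const_smul (ω : ℂ))).const_smul (1 / (2 * ω) : ℂ)).congr fun n => ?_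
    simp only [ann_mul_cre hω, LinearMap.smul_apply, LinearMap.add_apply, Module.End.one_apply,
      map_smul, map_add]
  refine cauchySeq_tendsto_of_complete ?_
  have hMc := hM.cauchySeq
  rw [Metric.cauchySeq_iff] at hMc ⊢
  intro ε hε
  obtain ⟨N, hN⟩ := hMc (ε / (|C| + 1)) (by positivity)
  refine ⟨N, fun m hm n hn => ?_⟩
  have h1 := hN m hm n hn
  rw [dist_eq_norm, ← map_sub, ← map_sub] at h1 ⊢
  rw [lt_div_iff₀ (by positivity)] at h1
  refine (hC _).trans_lt (lt_of_le_of_lt ?_ h1)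
  rw [mul_comm]
  exact mul_le_mul_of_nonneg_left ((le_abs_self C).trans (by linarith)) (norm_nonneg _)

/-- Limits in the graph norm of the Hamiltonian lie in the domain of all second order
expressions. -/
theorem good_of_tendsto (hω : 0 < ω) (c : ℝ) {ψ : ℕ → 𝓢(ℝ, ℂ)} {f g : L2}
    (hf : Filter.Tendsto (fun n => emb (ψ n)) Filter.atTop (nhds f))
    (hg : Filter.Tendsto (fun n => emb (hamS ω c (ψ n))) Filter.atTop (nhds g)) : Good f := by
  obtain ⟨s, t, hst⟩ := momS_eq' hω c
  have hp := posS_eq' hω c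
  have hm1 : RelBdd ω c momS := by
    rw [hst]; exact ((relBdd_ann hω c).smul c _).add c ((relBdd_cre hω c).smul c _)
  have key : ∀ {A : SEnd}, RelBdd ω c A →
      ∃ y, Filter.Tendsto (fun n => emb (A (ψ n))) Filter.atTop (nhds y) :=
    fun hA => RelBdd.exists_lim hω c hA hf hg
  obtain ⟨f1, h1⟩ := key hm1
  obtain ⟨f2, h2⟩ := key (relBdd_pos hω c)
  obtain ⟨f11, h11⟩ := key (A := momS * momS) (by rw [hst]; exact relBdd_quadratic hω c _ _ _ _)
  obtain ⟨f12, h12⟩ := key (A := posS * momS)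
    (by rw [hst, hp]; exact relBdd_quadratic hω c _ _ _ _)
  obtain ⟨f21, h21⟩ := key (A := momS * posS)
    (by rw [hst, hp]; exact relBdd_quadratic hω c _ _ _ _)
  obtain ⟨f22, h22⟩ := key (A := posS * posS) (by rw [hp]; exact relBdd_quadratic hω c _ _ _ _)
  exact ⟨f1, f2, f11, f12, f21, f22, Weak.lim hf h1 fun n => momS_symm.weak _,
    Weak.lim hf h2 fun n => posS_symm.weak _, Weak.lim h1 h11 fun n => momS_symm.weak _,
    Weak.lim h1 h12 fun n => posS_symm.weak _, Weak.lim h2 h21 fun n => momS_symm.weak _,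
    Weak.lim h2 h22 fun n => posS_symm.weak _⟩

theorem hamS_symm (ω c : ℝ) : FormalAdj (hamS ω c) (hamS ω c) := by
  have := ((kinS_symm c).mul (kinS_symm c)).add ((posS_symm.mul posS_symm).real_smul (ω ^ 2))
  simpa [hamS] using this

/-- Partial sums of the Hermite expansion of `f` work: the Hamiltonian turns them into the partial
sums of `g`. -/
theorem exists_approx_of_coeff (hω : 0 < ω) (c : ℝ) {f g : L2} (h : ∀ n : ℕ, inner ℂ (emb (herm hω c n)) g
      = ((ω * (2 * n + 1) : ℝ) : ℂ) * inner ℂ (emb (herm hω c n)) f) :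
    ∃ ψ : ℕ → 𝓢(ℝ, ℂ), Filter.Tendsto (fun n => emb (ψ n)) Filter.atTop (nhds f) ∧
      Filter.Tendsto (fun n => emb (hamS ω c (ψ n))) Filter.atTop (nhds g) := by
  refine ⟨fun m => ∑ n ∈ Finset.range m, inner ℂ (emb (herm hω c n)) f • herm hω c n, ?_, ?_⟩
  · refine ((hermBasis hω c).hasSum_repr f).tendsto_sum_nat.congr fun m => ?_
    simp [HilbertBasis.repr_apply_apply, hermBasis_apply]
  · refine ((hermBasis hω c).hasSum_repr g).tendsto_sum_nat.congr fun m => ?_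
    simp only [HilbertBasis.repr_apply_apply, hermBasis_apply, h, map_sum, map_smul, hamS_herm,
      smul_smul]
    exact Finset.sum_congr rfl fun n _ => by rw [mul_comm]

/-- The graph of `(p + c q)² + ω² q²` in the Hermite basis. -/
theorem good_and_weak_iff (hω : 0 < ω) (c : ℝ) (f g : L2) :
    Good f ∧ Weak (hamS ω c) f g ↔ ∀ n : ℕ, inner ℂ (emb (herm hω c n)) g
      = ((ω * (2 * n + 1) : ℝ) : ℂ) * inner ℂ (emb (herm hω c n)) f := by
  constructor
  · rintro ⟨-, h⟩ n
    rw [h, hamS_herm, map_smul, inner_smul_left, Complex.conj_ofReal]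
  · intro h
    obtain ⟨ψ, h1, h2⟩ := exists_approx_of_coeff hω c h
    exact ⟨good_of_tendsto hω c h1 h2, Weak.lim h1 h2 fun n => (hamS_symm ω c).weak _⟩

/-- Testing against Hermite functions alone fixes the coefficients of `g`, so Hermite sums converge
in the graph norm. Thus the weak equation already yields full second order regularity. -/
theorem good_of_weak (hω : 0 < ω) (c : ℝ) {f g : L2} (h : Weak (hamS ω c) f g) : Good f := by
  refine ((good_and_weak_iff hω c f g).2 fun n => ?_).1
  rw [h, hamS_herm, map_smul, inner_smul_left, Complex.conj_ofReal]

end RelBounded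

/-- Regularity with ω = 1 and c = 0: once p² f and q² f exist, so do the mixed expressions pq f and
qp f. -/
theorem pSqAddqSq_domain_iff (f : L2) : f ∈ pSqAddqSq.domain ↔ Good f := by
  rw [LinearPMap.mem_domain_iff]
  simp only [pSqAddqSq, add_graph_iff, mul_graph_iff, p_graph, q_graph]
  constructor
  · rintro ⟨g, u, v, ⟨f1, h1, h11⟩, ⟨f2, h2, h22⟩, rfl⟩
    have := (h1.mul h11).op_add (h2.mul h22)
    refine good_of_weak one_pos 0 (g := u + v) ?_
    simpa [hamS, kinS] using this
  · rintro ⟨f1, f2, f11, f12, f21, f22, h⟩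
    exact ⟨_, _, _, ⟨f1, h.mom, h.mom_mom⟩, ⟨f2, h.pos, h.pos_pos⟩, rfl⟩

end NcHO
end

noncomputable section
namespace NcHO

/-! ### The graph of the non-commutative harmonic oscillator -/

theorem a_graph_iff (f g : L2) : (f, g) ∈ a.graph ↔ ∃ f1 f2, Weak momS f f1 ∧ Weak posS f f2 ∧
    g = ((1 / Real.sqrt 2 : ℝ) : ℂ) • (Complex.I • f1 + f2) := by
  simp only [a, smul_graph_iff, add_graph_iff, p_graph, q_graph]
  constructor
  · rintro ⟨_, ⟨_, f2, ⟨f1, h1, rfl⟩, h2, rfl⟩, rfl⟩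
    exact ⟨f1, f2, h1, h2, rfl⟩
  · rintro ⟨f1, f2, h1, h2, rfl⟩
    exact ⟨_, ⟨_, f2, ⟨f1, h1, rfl⟩, h2, rfl⟩, rfl⟩

theorem adag_graph_iff (f g : L2) : (f, g) ∈ adag.graph ↔ ∃ f1 f2, Weak momS f f1 ∧
    Weak posS f f2 ∧ g = ((1 / Real.sqrt 2 : ℝ) : ℂ) • ((-Complex.I) • f1 + f2) := by
  simp only [adag, smul_graph_iff, add_graph_iff, p_graph, q_graph]
  constructor
  · rintro ⟨_, ⟨_, f2, ⟨f1, h1, rfl⟩, h2, rfl⟩, rfl⟩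
    exact ⟨f1, f2, h1, h2, rfl⟩
  · rintro ⟨f1, f2, h1, h2, rfl⟩
    exact ⟨_, ⟨_, f2, ⟨f1, h1, rfl⟩, h2, rfl⟩, rfl⟩

theorem inv_sqrt_two_sq : ((1 / Real.sqrt 2 : ℝ) : ℂ) * ((1 / Real.sqrt 2 : ℝ) : ℂ) = 1 / 2 := by
  rw [← Complex.ofReal_mul, div_mul_div_comm, Real.mul_self_sqrt (by norm_num)]
  norm_num

theorem inv_sqrt_two_ne_zero : ((1 / Real.sqrt 2 : ℝ) : ℂ) ≠ 0 := fun h => by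
  have := inv_sqrt_two_sq
  rw [h] at this
  norm_num at this

section
variable {f f1 f2 f11 f12 f21 f22 : L2}

theorem Second.a_a (h : Second f f1 f2 f11 f12 f21 f22) :
    (f, (1 / 2 : ℂ) • (-f11 + Complex.I • (f12 + f21) + f22)) ∈ (mul a a).graph := by
  rw [mul_graph_iff]
  refine ⟨_, (a_graph_iff _ _).2 ⟨f1, f2, h.mom, h.pos, rfl⟩, (a_graph_iff _ _).2
    ⟨_, _, ((h.mom_mom.smul _).add h.mom_pos).smul _, ((h.pos_mom.smul _).add h.pos_pos).smul _, ?_⟩⟩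
  rw [← inv_sqrt_two_sq]
  generalize ((1 / Real.sqrt 2 : ℝ) : ℂ) = s
  match_scalars <;> first
    | ring1
    | linear_combination -s ^ 2 * Complex.I_mul_I

theorem Second.adag_adag (h : Second f f1 f2 f11 f12 f21 f22) :
    (f, (1 / 2 : ℂ) • (-f11 - Complex.I • (f12 + f21) + f22)) ∈ (mul adag adag).graph := by
  rw [mul_graph_iff]
  refine ⟨_, (adag_graph_iff _ _).2 ⟨f1, f2, h.mom, h.pos, rfl⟩, (adag_graph_iff _ _).2
    ⟨_, _, ((h.mom_mom.smul _).add h.mom_pos).smul _, ((h.pos_mom.smul _).add h.pos_pos).smul _, ?_⟩⟩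
  rw [← inv_sqrt_two_sq]
  generalize ((1 / Real.sqrt 2 : ℝ) : ℂ) = s
  match_scalars <;> first
    | ring1
    | linear_combination -s ^ 2 * Complex.I_mul_I

theorem Second.adag_a (h : Second f f1 f2 f11 f12 f21 f22) :
    (f, (1 / 2 : ℂ) • (f11 + f22 - f)) ∈ (mul adag a).graph := by
  rw [mul_graph_iff]
  refine ⟨_, (a_graph_iff _ _).2 ⟨f1, f2, h.mom, h.pos, rfl⟩, (adag_graph_iff _ _).2
    ⟨_, _, ((h.mom_mom.smul _).add h.mom_pos).smul _, ((h.pos_mom.smul _).add h.pos_pos).smul _, ?_⟩⟩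
  rw [← inv_sqrt_two_sq, h.comm]
  generalize ((1 / Real.sqrt 2 : ℝ) : ℂ) = s
  match_scalars <;> first
    | ring1
    | linear_combination -s ^ 2 * Complex.I_mul_I
    | linear_combination s ^ 2 * Complex.I_mul_I

theorem Second.number (h : Second f f1 f2 f11 f12 f21 f22) :
    (f, (1 / 2 : ℂ) • (f11 + f22)) ∈ (mul adag a + (1 / 2 : ℂ) • one).graph := by
  rw [add_graph_iff]
  refine ⟨_, _, h.adag_a, (smul_graph_iff _ _ _ _).2 ⟨f, (one_graph_iff _ _).2 rfl, rfl⟩, ?_⟩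
  module

theorem Second.squeeze (h : Second f f1 f2 f11 f12 f21 f22) :
    (f, Complex.I • (f12 + f21)) ∈ (mul a a - mul adag adag).graph := by
  rw [sub_graph_iff]
  refine ⟨_, _, h.a_a, h.adag_adag, ?_⟩
  module

end

/-- Sums and differences of the first order expressions determine those expressions. -/
theorem Weak.of_sum_diff {A : SEnd} {f1 f2 u v : L2} {s : ℂ} (hs : s ≠ 0)
    (hu : Weak A (s • (Complex.I • f1 + f2)) u) (hv : Weak A (s • ((-Complex.I) • f1 + f2)) v) :
    (∃ g, Weak A f1 g) ∧ ∃ g, Weak A f2 g := by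
  have hI := Complex.I_mul_I
  constructor
  · refine ⟨_, ((hu.add (hv.smul (-1))).smul (-Complex.I / (2 * s))).congr_left ?_⟩
    match_scalars
    · field_simp; linear_combination -2 * hI
    · field_simp; ring
  · refine ⟨_, ((hu.add hv).smul (1 / (2 * s))).congr_left ?_⟩
    match_scalars
    · field_simp; ring
    · field_simp; norm_num

/-- Both a f and a† f lie in D(a†) = D(p) ∩ D(q), hence so do their combinations p f and q f. -/
theorem good_of_domains {f u v : L2} (hu : (f, u) ∈ (mul adag a).graph)
    (hv : (f, v) ∈ (mul adag adag).graph) : Good f := by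
  rw [mul_graph_iff] at hu hv
  obtain ⟨_, h1, h2⟩ := hu
  obtain ⟨_, h3, h4⟩ := hv
  rw [a_graph_iff] at h1
  rw [adag_graph_iff] at h2 h3 h4
  obtain ⟨f1, f2, hf1, hf2, rfl⟩ := h1
  obtain ⟨f1', f2', hf1', hf2', rfl⟩ := h3
  obtain rfl := hf1.unique hf1'
  obtain rfl := hf2.unique hf2'
  obtain ⟨m1, m2, hm1, hm2, -⟩ := h2
  obtain ⟨n1, n2, hn1, hn2, -⟩ := h4
  obtain ⟨⟨f11, h11⟩, ⟨f21, h21⟩⟩ := Weak.of_sum_diff inv_sqrt_two_ne_zero hm1 hn1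
  obtain ⟨⟨f12, h12⟩, ⟨f22, h22⟩⟩ := Weak.of_sum_diff inv_sqrt_two_ne_zero hm2 hn2
  exact ⟨f1, f2, f11, f12, f21, f22, hf1, hf2, h11, h12, h21, h22⟩

/-- The graph of the non-commutative harmonic oscillator in terms of the weak images under
`(p² + q²) / 2` and `(p q + q p) / 2`. -/
theorem Q_graph_iff (α β : ℝ) (f g : H) : (f, g) ∈ (Q α β).graph ↔
    Good (f 0) ∧ Good (f 1) ∧ ∃ h0 h1 k0 k1, Weak oscS (f 0) h0 ∧ Weak oscS (f 1) h1 ∧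
      Weak mixS (f 0) k0 ∧ Weak mixS (f 1) k1 ∧ g 0 = (α : ℂ) • h0 - Complex.I • k1 ∧
      g 1 = Complex.I • k0 + (β : ℂ) • h1 := by
  rw [Q, add_graph_iff]
  simp only [smul_graph_iff, tensor_graph_iff]
  constructor
  · rintro ⟨u, v, ⟨u', hu', hu⟩, ⟨_, ⟨v', hv', hv⟩, rfl⟩, rfl⟩
    -- The domain of a†a comes from the first summand and that of (a†)² from the second; every
    -- component occurs in both.
    have hgood : ∀ j, Good (f j) := fun j => by
      have h1 := hu' j
      have h2 := hv' j
      rw [add_graph_iff] at h1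
      rw [sub_graph_iff] at h2
      obtain ⟨_, _, h1, -, -⟩ := h1
      obtain ⟨_, _, -, h2, -⟩ := h2
      exact good_of_domains h1 h2
    obtain ⟨x1, x2, x11, x12, x21, x22, hx⟩ := hgood 0
    obtain ⟨y1, y2, y11, y12, y21, y22, hy⟩ := hgood 1
    refine ⟨hgood 0, hgood 1, _, _, _, _, hx.weak_osc, hy.weak_osc, hx.weak_mix, hy.weak_mix, ?_, ?_⟩
    · have e1 := LinearPMap.mem_graph_snd_inj _ (hu' 0) hx.number rfl
      have e2 := LinearPMap.mem_graph_snd_inj _ (hv' 1) hy.squeeze rfl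
      simp [hu, hv, e1, e2]
      module
    · have e1 := LinearPMap.mem_graph_snd_inj _ (hu' 1) hy.number rfl
      have e2 := LinearPMap.mem_graph_snd_inj _ (hv' 0) hx.squeeze rfl
      simp [hu, hv, e1, e2]
      module
  · rintro ⟨⟨x1, x2, x11, x12, x21, x22, hx⟩, ⟨y1, y2, y11, y12, y21, y22, hy⟩, h0, h1, k0, k1,
      hh0, hh1, hk0, hk1, hg0, hg1⟩
    obtain rfl := hx.weak_osc.unique hh0
    obtain rfl := hx.weak_mix.unique hk0
    obtain rfl := hy.weak_osc.unique hh1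
    obtain rfl := hy.weak_mix.unique hk1
    refine ⟨WithLp.toLp 2 ![(α : ℂ) • (1 / 2 : ℂ) • (x11 + x22), (β : ℂ) • (1 / 2 : ℂ) • (y11 + y22)],
      _, ⟨![(1 / 2 : ℂ) • (x11 + x22), (1 / 2 : ℂ) • (y11 + y22)], ?_, ?_⟩,
      ⟨WithLp.toLp 2 ![-Complex.I • (y12 + y21), Complex.I • (x12 + x21)],
        ⟨![Complex.I • (x12 + x21), Complex.I • (y12 + y21)], ?_, ?_⟩, rfl⟩, ?_⟩
    · intro j; fin_cases j
      · exact hx.number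
      · exact hy.number
    · intro i; fin_cases i <;> simp
    · intro j; fin_cases j
      · exact hx.squeeze
      · exact hy.squeeze
    · intro i; fin_cases i <;> simp
    · ext1 i
      fin_cases i
      · simp [hg0]; module
      · simp [hg1]; module

theorem Q_domain_iff (α β : ℝ) (f : H) : f ∈ (Q α β).domain ↔ Good (f 0) ∧ Good (f 1) := by
  rw [LinearPMap.mem_domain_iff]
  constructor
  · rintro ⟨g, hg⟩
    rw [Q_graph_iff] at hg
    exact ⟨hg.1, hg.2.1⟩
  · rintro ⟨hx, hy⟩
    have hx' := hx
    have hy' := hy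
    obtain ⟨x1, x2, x11, x12, x21, x22, hx⟩ := hx
    obtain ⟨y1, y2, y11, y12, y21, y22, hy⟩ := hy
    exact ⟨WithLp.toLp 2 ![_, _], (Q_graph_iff α β f _).2 ⟨hx', hy', _, _, _, _, hx.weak_osc,
      hy.weak_osc, hx.weak_mix, hy.weak_mix, rfl, rfl⟩⟩

end NcHO
end

noncomputable section
namespace NcHO

/-! ### Self-adjointness in terms of graphs -/

section Abstract
variable {E : Type*} [NormedAddCommGroup E] [InnerProductSpace ℂ E] [CompleteSpace E]

theorem adjoint_graph_iff {T : E →ₗ.[ℂ] E} (hd : Dense (T.domain : Set E)) (f g : E) :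
    (f, g) ∈ (star T).graph ↔ ∀ u v, (u, v) ∈ T.graph → inner ℂ u g = inner ℂ v f := by
  change (f, g) ∈ (LinearPMap.adjoint T).graph ↔ _
  rw [LinearPMap.adjoint_graph_eq_graph_adjoint hd, Submodule.mem_adjoint_iff]
  simp only [sub_eq_zero, eq_comm]

theorem isSelfAdjoint_of_graph {T : E →ₗ.[ℂ] E} (hd : Dense (T.domain : Set E))
    (h : ∀ f g, (f, g) ∈ T.graph ↔ ∀ u v, (u, v) ∈ T.graph → inner ℂ u g = inner ℂ v f) :
    IsSelfAdjoint T := by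
  refine LinearPMap.eq_of_eq_graph ?_
  ext ⟨f, g⟩
  rw [adjoint_graph_iff hd, h]

theorem selfAdjoint_graph_iff {T : E →ₗ.[ℂ] E} (hT : IsSelfAdjoint T) (f g : E) :
    (f, g) ∈ T.graph ↔ ∀ u v, (u, v) ∈ T.graph → inner ℂ u g = inner ℂ v f := by
  rw [← adjoint_graph_iff hT.dense_domain, hT]

/-- Essential self-adjointness from the coincidence of the closure with the adjoint. -/
theorem isEssentiallySelfAdjoint_of_graph {T : E →ₗ.[ℂ] E} (hd : Dense (T.domain : Set E))
    (h : ∀ f g, (f, g) ∈ closure (T.graph : Set (E × E)) ↔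
      ∀ u v, (u, v) ∈ T.graph → inner ℂ u g = inner ℂ v f) :
    IsEssentiallySelfAdjoint T ∧
      (T.closure.graph : Set (E × E)) = closure (T.graph : Set (E × E)) := by
  have hc : T.IsClosable := by
    refine ⟨star T, ?_⟩
    ext ⟨f, g⟩
    rw [adjoint_graph_iff hd, ← h]
    rfl
  have hg : (T.closure.graph : Set (E × E)) = closure (T.graph : Set (E × E)) := by
    rw [← hc.graph_closure_eq_closure_graph]; rfl
  have hg' : ∀ f g, (f, g) ∈ T.closure.graph ↔ (f, g) ∈ closure (T.graph : Set (E × E)) :=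
    fun f g => by rw [← hg]; rfl
  refine ⟨⟨hc, isSelfAdjoint_of_graph (hd.mono T.le_closure.1) fun f g => ?_⟩, hg⟩
  rw [hg', h]
  refine ⟨fun hfg u v huv => ?_, fun hfg u v huv => hfg u v ?_⟩
  · rw [hg'] at huv
    have hcl : IsClosed {x : E × E | inner ℂ x.1 g = inner ℂ x.2 f} :=
      isClosed_eq (by fun_prop) (by fun_prop)
    exact (closure_minimal (fun x hx => hfg x.1 x.2 hx) hcl) huv
  · rw [hg']; exact subset_closure huv

/-! ### Resolvents of self-adjoint operators -/

/-- On the closed graph the map (f, g) ↦ g - z f is bounded below, hence injective with closed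
range. The orthogonal complement of the range is the kernel of T - z̄, trivial by the second bound.
The resolvent is the first component of the inverse map. -/
theorem mem_resolventSet_of_le {T : E →ₗ.[ℂ] E} (hT : IsSelfAdjoint T) (z : ℂ) {δ : ℝ}
    (hδ : 0 < δ) (h1 : ∀ f g, (f, g) ∈ T.graph → δ * ‖f‖ ≤ ‖g - z • f‖)
    (h2 : ∀ f g, (f, g) ∈ T.graph → δ * ‖f‖ ≤ ‖g - (starRingEnd ℂ) z • f‖) :
    z ∈ resolventSet T := by
  let L : T.graph →L[ℂ] E :=
    (ContinuousLinearMap.snd ℂ E E - z • ContinuousLinearMap.fst ℂ E E) ∘L T.graph.subtypeL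
  have hL : ∀ x : T.graph, L x = x.1.2 - z • x.1.1 := fun x => rfl
  have hb : ∀ x : T.graph, δ * ‖x.1.1‖ ≤ ‖L x‖ := fun x => h1 _ _ x.2
  have hinj : Function.Injective L := by
    rw [injective_iff_map_eq_zero]
    intro x hx
    have h3 := hb x
    rw [hx, norm_zero] at h3
    have h4 : x.1.1 = 0 := norm_le_zero_iff.1 (nonpos_of_mul_nonpos_right h3 hδ)
    have h5 := hL x
    rw [hx, h4, smul_zero, sub_zero] at h5
    exact Subtype.ext (Prod.ext h4 h5.symm)
  have hcomp : CompleteSpace T.graph := hT.isClosed.completeSpace_coe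
  have hanti : AntilipschitzWith (Real.toNNReal (1 + (‖z‖ + 1) / δ)) L := by
    refine AddMonoidHomClass.antilipschitz_of_bound L fun x => ?_
    rw [Real.coe_toNNReal _ (by positivity)]
    have h3 := hb x
    have h6 : ‖x.1.1‖ ≤ ‖L x‖ / δ := by rw [le_div_iff₀ hδ, mul_comm]; exact h3
    have h7 : ‖x.1.2‖ ≤ ‖L x‖ + ‖z‖ * ‖x.1.1‖ := by
      rw [← norm_smul]
      calc ‖x.1.2‖ = ‖L x + z • x.1.1‖ := by rw [hL]; simp
        _ ≤ _ := norm_add_le _ _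
    have h8 : ‖z‖ * ‖x.1.1‖ ≤ ‖z‖ * (‖L x‖ / δ) := by gcongr
    have h9 : ‖x‖ = max ‖x.1.1‖ ‖x.1.2‖ := rfl
    calc ‖x‖ ≤ ‖x.1.1‖ + ‖x.1.2‖ := by
          rw [h9]
          exact max_le (by linarith [norm_nonneg x.1.2]) (by linarith [norm_nonneg x.1.1])
      _ ≤ ‖L x‖ / δ + (‖L x‖ + ‖z‖ * (‖L x‖ / δ)) := by linarith
      _ = _ := by field_simp; ring
  have hclosed : IsClosed (L.range : Set E) := by
    rw [LinearMap.coe_range]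
    exact hanti.isClosed_range L.uniformContinuous
  have hrange : L.range = ⊤ := by
    rw [← hclosed.submodule_topologicalClosure_eq,
      Submodule.topologicalClosure_eq_top_iff, Submodule.eq_bot_iff]
    intro g hg
    -- By self-adjointness, orthogonality to the range of T - z means that `g` is in the domain with
    -- T g = z̄ g.
    have h3 : (g, (starRingEnd ℂ) z • g) ∈ T.graph := by
      rw [selfAdjoint_graph_iff hT]
      intro u v huv
      have h4 := (Submodule.mem_orthogonal _ _).1 hg (L ⟨(u, v), huv⟩) ⟨_, rfl⟩
      rw [hL, inner_sub_left, inner_smul_left, sub_eq_zero] at h4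
      rw [inner_smul_right, h4]
    have h5 := h2 _ _ h3
    rw [sub_self, norm_zero] at h5
    exact norm_le_zero_iff.1 (nonpos_of_mul_nonpos_right h5 hδ)
  let e := LinearEquiv.ofBijective L.toLinearMap ⟨hinj, LinearMap.range_eq_top.1 hrange⟩
  have he : ∀ g, L (e.symm g) = g := fun g => e.apply_symm_apply g
  let R : E →L[ℂ] E := LinearMap.mkContinuous
    (LinearMap.fst ℂ E E ∘ₗ T.graph.subtype ∘ₗ e.symm.toLinearMap) δ⁻¹ fun g => by
      rw [← div_eq_inv_mul, le_div_iff₀ hδ, mul_comm]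
      have h3 := hb (e.symm g)
      rwa [he] at h3
  have hR : ∀ g, R g = (e.symm g).1.1 := fun g => rfl
  refine ⟨R, fun f => ?_, fun f => ?_⟩
  · have h3 : (R f, (e.symm f).1.2) ∈ T.graph := (e.symm f).2
    refine ⟨LinearPMap.mem_domain_of_mem_graph h3, ?_⟩
    rw [T.mem_graph_snd_inj (T.mem_graph ⟨R f, _⟩) h3 rfl]
    exact he f
  · have h3 : e.symm (T f - z • (f : E)) = ⟨((f : E), T f), T.mem_graph f⟩ := by
      rw [LinearEquiv.symm_apply_eq]; rfl
    rw [hR, h3]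

omit [CompleteSpace E] in
theorem resolvent_graph {T : E →ₗ.[ℂ] E} {z : ℂ} {R : E →L[ℂ] E}
    (h1 : ∀ f : E, ∃ h : R f ∈ T.domain, T ⟨R f, h⟩ - z • R f = f)
    (f : E) : (R f, f + z • R f) ∈ T.graph := by
  obtain ⟨h, h2⟩ := h1 f
  have := T.mem_graph ⟨R f, h⟩
  rwa [sub_eq_iff_eq_add.1 h2] at this

omit [CompleteSpace E] in
theorem resolvent_apply_graph {T : E →ₗ.[ℂ] E} {z : ℂ} {R : E →L[ℂ] E}
    (h2 : ∀ f : T.domain, R (T f - z • (f : E)) = f) {f g : E} (h : (f, g) ∈ T.graph) :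
    R (g - z • f) = f := by
  rw [LinearPMap.mem_graph_iff] at h
  obtain ⟨y, rfl, rfl⟩ := h
  exact h2 y

theorem inner_graph_real {T : E →ₗ.[ℂ] E} (hT : IsSelfAdjoint T) {f g : E}
    (h : (f, g) ∈ T.graph) : inner ℂ g f = inner ℂ f g :=
  ((selfAdjoint_graph_iff hT f g).1 h f g h).symm

/-- A lower bound of the quadratic form bounds the real spectrum from below. -/
theorem mem_resolventSet_of_form_bound {T : E →ₗ.[ℂ] E} (hT : IsSelfAdjoint T) {m x : ℝ}
    (hm : ∀ f g, (f, g) ∈ T.graph → m * ‖f‖ ^ 2 ≤ (inner ℂ f g).re) (hx : x < m) :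
    (x : ℂ) ∈ resolventSet T := by
  have key : ∀ f g, (f, g) ∈ T.graph → (m - x) * ‖f‖ ≤ ‖g - (x : ℂ) • f‖ := by
    intro f g hfg
    have h1 := hm f g hfg
    have h2 : (inner ℂ f (g - (x : ℂ) • f)).re = (inner ℂ f g).re - x * ‖f‖ ^ 2 := by
      have h0 : inner ℂ f f = ((‖f‖ ^ 2 : ℝ) : ℂ) := by
        rw [inner_self_eq_norm_sq_to_K]; norm_cast
      rw [inner_sub_right, inner_smul_right, h0, Complex.sub_re, ← Complex.ofReal_mul,
        Complex.ofReal_re]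
    have h3 := (Complex.re_le_norm _).trans (norm_inner_le_norm (𝕜 := ℂ) f (g - (x : ℂ) • f))
    rw [h2] at h3
    rcases (norm_nonneg f).eq_or_lt with h0 | h0
    · rw [← h0, mul_zero]; exact norm_nonneg _
    · refine le_of_mul_le_mul_left ?_ h0
      nlinarith
  exact mem_resolventSet_of_le hT _ (sub_pos.2 hx) key (by simpa using key)

/-- If the real spectrum of a self-adjoint operator is bounded below, then so is its quadratic
form. -/
theorem form_bound_of_resolventSet {T : E →ₗ.[ℂ] E} (hT : IsSelfAdjoint T) {y : ℝ}
    (hy : ∀ s : ℝ, s ≤ y → (s : ℂ) ∈ resolventSet T) {f g : E} (hfg : (f, g) ∈ T.graph) :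
    y * ‖f‖ ^ 2 ≤ (inner ℂ f g).re := by
  obtain ⟨R, hR1, hR2⟩ := hy y le_rfl
  have hgr := resolvent_graph hR1
  have hRs : R.IsSymmetric := by
    intro u v
    change inner ℂ (R u) v = inner ℂ u (R v)
    have := (selfAdjoint_graph_iff hT _ _).1 (hgr v) _ _ (hgr u)
    rw [inner_add_left, inner_add_right, inner_smul_left, inner_smul_right, Complex.conj_ofReal]
      at this
    exact add_right_cancel this
  have hRsa : IsSelfAdjoint R := hRs.isSelfAdjoint
  -- For w < 0 the point y + 1/w lies below y and so has a resolvent S; then w - R has the inverse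
  -- w⁻¹ + w⁻² S. Hence R has no negative spectrum.
  have hpos : 0 ≤ R := by
    rw [StarOrderedRing.nonneg_iff_spectrum_nonneg (R := ℝ) R hRsa]
    intro w hw
    by_contra! hw0
    refine hw ?_
    obtain ⟨S, hS1, hS2⟩ := hy (y + w⁻¹) (by linarith [inv_lt_zero.2 hw0])
    have hgS := resolvent_graph hS1
    have hwc : (w : ℂ) ≠ 0 := by exact_mod_cast hw0.ne
    have e1 : ∀ u, R u = S u - (w : ℂ)⁻¹ • R (S u) := by
      intro u
      have h1 := resolvent_apply_graph hR2 (hgS u)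
      have h2 : u + ((y + w⁻¹ : ℝ) : ℂ) • S u - (y : ℂ) • S u = u + (w : ℂ)⁻¹ • S u := by
        push_cast; module
      rw [h2, map_add, map_smul] at h1
      exact eq_sub_of_add_eq h1
    have e2 : ∀ u, R u = S u - (w : ℂ)⁻¹ • S (R u) := by
      intro u
      have h1 := resolvent_apply_graph hS2 (hgr u)
      have h2 : u + (y : ℂ) • R u - ((y + w⁻¹ : ℝ) : ℂ) • R u = u - (w : ℂ)⁻¹ • R u := by
        push_cast; module
      rw [h2, map_sub, map_smul] at h1
      exact h1.symm
    have hA : ∀ u, (algebraMap ℝ (E →L[ℂ] E) w - R) u = (w : ℂ) • u - R u := fun u => by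
      simp [Algebra.algebraMap_eq_smul_one]
    refine ⟨⟨algebraMap ℝ (E →L[ℂ] E) w - R,
      (w : ℂ)⁻¹ • (1 : E →L[ℂ] E) + ((w : ℂ)⁻¹ * (w : ℂ)⁻¹) • S, ?_, ?_⟩, rfl⟩
    · ext u
      have := e1 u
      simp only [mul_apply_eq_comp, hA, add_apply,
        smul_apply, one_apply_eq_self, map_add, map_smul]
      rw [this]
      match_scalars <;> field_simp <;> ring
    · ext u
      have := e2 u
      simp only [mul_apply_eq_comp, hA, add_apply,
        smul_apply, one_apply_eq_self, map_sub, map_smul]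
      generalize S (R u) = v at this ⊢
      rw [this]
      match_scalars <;> field_simp <;> ring
  -- Positivity of R = (T - y)⁻¹ tested on (T - y) f says ⟪(T - y) f, f⟫ ≥ 0.
  have hp := (ContinuousLinearMap.nonneg_iff_isPositive R).1 hpos
  have h1 := hp.re_inner_nonneg_right (g - (y : ℂ) • f)
  rw [resolvent_apply_graph hR2 hfg, inner_sub_left, inner_smul_left, Complex.conj_ofReal,
    inner_self_eq_norm_sq_to_K, inner_graph_real hT hfg] at h1
  have h2 : (RCLike.re (inner ℂ f g - (y : ℂ) * ((‖f‖ : ℂ)) ^ 2) : ℝ)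
      = (inner ℂ f g).re - y * ‖f‖ ^ 2 := by
    rw [map_sub]
    congr 1
    norm_cast
  have h3 := h2 ▸ h1
  linarith

end Abstract
end NcHO
end

noncomputable section
namespace NcHO

/-! ### Operators diagonal in a Hilbert basis -/

section Diagonal
variable {E : Type*} [NormedAddCommGroup E] [InnerProductSpace ℂ E]

theorem hasSum_norm_sq_coeff {ι : Type*} (b : HilbertBasis ι ℂ E) (f : E) :
    HasSum (fun n => ‖inner ℂ (b n) f‖ ^ 2) (‖f‖ ^ 2) := by
  have h := b.hasSum_inner_mul_inner f f
  rw [inner_self_eq_norm_sq_to_K] at h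
  have h2 : ∀ n, inner ℂ f (b n) * inner ℂ (b n) f = ((‖inner ℂ (b n) f‖ ^ 2 : ℝ) : ℂ) := fun n => by
    rw [← inner_conj_symm, mul_comm, Complex.mul_conj, Complex.normSq_eq_norm_sq]
  simp_rw [h2] at h
  have h3 : ((‖f‖ : ℂ)) ^ 2 = ((‖f‖ ^ 2 : ℝ) : ℂ) := by push_cast; rfl
  exact Complex.hasSum_ofReal.1 (h3 ▸ h)

theorem eq_of_coeff {ι : Type*} (b : HilbertBasis ι ℂ E) {f g : E}
    (h : ∀ n, inner ℂ (b n) f = inner ℂ (b n) g) : f = g := by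
  have := hasSum_norm_sq_coeff b (f - g)
  simp_rw [inner_sub_right, h, sub_self, norm_zero, zero_pow two_ne_zero] at this
  have h2 := this.unique hasSum_zero
  rw [← sub_eq_zero, ← norm_eq_zero]
  exact pow_eq_zero_iff two_ne_zero |>.1 h2

/-- The operator `T` is diagonal in the Hilbert basis `b`, with eigenvalues `lam`. -/
def IsDiagonal (T : E →ₗ.[ℂ] E) (b : HilbertBasis ℕ ℂ E) (lam : ℕ → ℝ) : Prop :=
  ∀ f g, (f, g) ∈ T.graph ↔ ∀ n, inner ℂ (b n) g = (lam n : ℂ) * inner ℂ (b n) f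

variable {T : E →ₗ.[ℂ] E} {b : HilbertBasis ℕ ℂ E} {lam : ℕ → ℝ}

theorem inner_basis (b : HilbertBasis ℕ ℂ E) (m n : ℕ) :
    inner ℂ (b m) (b n) = if m = n then 1 else 0 :=
  orthonormal_iff_ite.1 b.orthonormal m n

theorem IsDiagonal.basis_mem (h : IsDiagonal T b lam) (n : ℕ) :
    (b n, (lam n : ℂ) • b n) ∈ T.graph := by
  rw [h]
  intro m
  rw [inner_smul_right, inner_basis]
  split_ifs with hmn
  · rw [hmn]
  · simp

/-- Testing the adjoint relation on basis vectors alone already gives the coefficient equations that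
define the graph. -/
theorem IsDiagonal.isSelfAdjoint [CompleteSpace E] (h : IsDiagonal T b lam) :
    IsSelfAdjoint T := by
  have hd : Dense (T.domain : Set E) := by
    have h1 : Submodule.span ℂ (Set.range b) ≤ T.domain := by
      rw [Submodule.span_le]
      rintro _ ⟨n, rfl⟩
      exact LinearPMap.mem_domain_of_mem_graph (h.basis_mem n)
    have h2 : Dense (Submodule.span ℂ (Set.range b) : Set E) :=
      Submodule.dense_iff_topologicalClosure_eq_top.2 b.dense_span
    exact h2.mono h1
  refine isSelfAdjoint_of_graph hd fun f g => ⟨fun hfg u v huv => ?_, fun hfg => ?_⟩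
  · rw [h] at hfg huv
    rw [← b.tsum_inner_mul_inner u g, ← b.tsum_inner_mul_inner v f]
    congr 1; ext n
    rw [hfg, ← inner_conj_symm v, huv, map_mul, Complex.conj_ofReal, inner_conj_symm]
    ring
  · rw [h]
    intro n
    rw [hfg _ _ (h.basis_mem n), inner_smul_left, Complex.conj_ofReal]

theorem IsDiagonal.norm_sub_ge (h : IsDiagonal T b lam) {z : ℂ} {δ : ℝ} (hδ : 0 < δ)
    (hz : ∀ n, δ ≤ ‖(lam n : ℂ) - z‖) {f g : E} (hfg : (f, g) ∈ T.graph) :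
    δ * ‖f‖ ≤ ‖g - z • f‖ := by
  refine (sq_le_sq₀ (by positivity) (norm_nonneg _)).1 ?_
  rw [mul_pow]
  refine hasSum_le (fun n => ?_) ((hasSum_norm_sq_coeff b f).mul_left (δ ^ 2))
    (hasSum_norm_sq_coeff b (g - z • f))
  rw [h] at hfg
  rw [inner_sub_right, inner_smul_right, hfg, ← sub_mul, norm_mul, mul_pow]
  have := hz n
  gcongr

theorem finite_le_of_tendsto (hlam : Filter.Tendsto lam Filter.atTop Filter.atTop) (x : ℝ) :
    {n | lam n ≤ x}.Finite := by
  have h1 := hlam.eventually (Filter.eventually_gt_atTop x)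
  rw [← Nat.cofinite_eq_atTop, Filter.eventually_cofinite] at h1
  simpa using h1

/-- Only finitely many terms are at most ‖z‖ + 1; all others stay at distance at least 1 from `z`.
-/
theorem exists_gap (hlam : Filter.Tendsto lam Filter.atTop Filter.atTop) (z : ℂ) :
    ∃ δ > 0, ∀ n, (lam n : ℂ) ≠ z → δ ≤ ‖(lam n : ℂ) - z‖ := by
  have hfin := finite_le_of_tendsto hlam (‖z‖ + 1)
  obtain ⟨δ, hδ, h⟩ : ∃ δ > 0, ∀ n ∈ {n | lam n ≤ ‖z‖ + 1}, (lam n : ℂ) ≠ z →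
      δ ≤ ‖(lam n : ℂ) - z‖ := by
    generalize {n | lam n ≤ ‖z‖ + 1} = s at hfin
    induction s, hfin using Set.Finite.induction_on with
    | empty => exact ⟨1, one_pos, by simp⟩
    | @insert a s _ _ ih =>
      obtain ⟨δ, hδ, h⟩ := ih
      by_cases ha : (lam a : ℂ) = z
      · refine ⟨δ, hδ, fun n hn hne => ?_⟩
        rcases hn with rfl | hn
        · exact absurd ha hne
        · exact h n hn hne
      · refine ⟨min δ ‖(lam a : ℂ) - z‖, lt_min hδ (norm_pos_iff.2 (sub_ne_zero.2 ha)),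
          fun n hn hne => ?_⟩
        rcases hn with rfl | hn
        · exact min_le_right _ _
        · exact (min_le_left _ _).trans (h n hn hne)
  refine ⟨min δ 1, lt_min hδ one_pos, fun n hne => ?_⟩
  by_cases hn : lam n ≤ ‖z‖ + 1
  · exact (min_le_left _ _).trans (h n hn hne)
  · push Not at hn
    refine (min_le_right _ _).trans ?_
    have h1 := norm_sub_norm_le (lam n : ℂ) z
    rw [Complex.norm_real, Real.norm_eq_abs] at h1
    linarith [le_abs_self (lam n)]

theorem IsDiagonal.spec_eq [CompleteSpace E] (h : IsDiagonal T b lam)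
    (hlam : Filter.Tendsto lam Filter.atTop Filter.atTop) :
    spec T = Set.range (fun n => (lam n : ℂ)) := by
  ext z
  constructor
  · intro hz
    by_contra hne
    obtain ⟨δ, hδ, hgap⟩ := exists_gap hlam z
    have h1 : ∀ n, (lam n : ℂ) ≠ z := fun n hn => hne ⟨n, hn⟩
    refine hz (mem_resolventSet_of_le h.isSelfAdjoint z hδ
      (fun f g => h.norm_sub_ge hδ fun n => hgap n (h1 n))
      (fun f g => h.norm_sub_ge hδ fun n => ?_))
    have h2 := hgap n (h1 n)
    rwa [← RCLike.norm_conj, map_sub, Complex.conj_ofReal] at h2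
  · rintro ⟨n, rfl⟩ ⟨R, -, hR⟩
    have h1 := resolvent_apply_graph hR (h.basis_mem n)
    rw [sub_self, map_zero] at h1
    exact b.orthonormal.ne_zero n h1.symm

theorem IsDiagonal.eigenspace_eq (h : IsDiagonal T b lam)
    (hlam : Filter.Tendsto lam Filter.atTop Filter.atTop) (x : ℝ) :
    eigenspace T x = Submodule.span ℂ (b '' {n | lam n = x}) := by
  have hfin : {n | lam n = x}.Finite :=
    (finite_le_of_tendsto hlam x).subset fun n (hn : lam n = x) => hn.le
  ext f
  rw [mem_eigenspace]
  have h1 : (∃ hf : f ∈ T.domain, T ⟨f, hf⟩ = (x : ℂ) • f) ↔ (f, (x : ℂ) • f) ∈ T.graph := by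
    rw [LinearPMap.mem_graph_iff]
    constructor
    · rintro ⟨hf, h2⟩
      exact ⟨⟨f, hf⟩, rfl, h2⟩
    · rintro ⟨⟨y, hy⟩, rfl, h2⟩
      exact ⟨hy, h2⟩
  rw [h1]
  clear h1
  constructor
  · intro hf
    rw [h] at hf
    -- An eigenvector has no coefficient where `lam n ≠ x`, so its expansion is a finite sum.
    have h2 : ∀ n ∉ hfin.toFinset, b.repr f n • b n = 0 := by
      intro n hn
      have h3 := hf n
      rw [inner_smul_right, ← sub_eq_zero, ← sub_mul, mul_eq_zero] at h3
      rw [HilbertBasis.repr_apply_apply, h3.resolve_left, zero_smul]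
      rw [sub_eq_zero]
      simp only [Set.Finite.mem_toFinset, Set.mem_ofPred_eq] at hn
      exact fun hx => hn (by exact_mod_cast hx.symm)
    rw [(b.hasSum_repr f).unique (hasSum_sum_of_ne_finset_zero h2)]
    refine Submodule.sum_mem _ fun n hn => Submodule.smul_mem _ _ (Submodule.subset_span ⟨n, ?_, rfl⟩)
    simpa using hn
  · intro hf
    induction hf using Submodule.span_induction with
    | mem y hy =>
      obtain ⟨n, hn, rfl⟩ := hy
      have hn' : lam n = x := hn
      rw [← hn']
      exact h.basis_mem n
    | zero => rw [smul_zero]; exact T.graph.zero_mem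
    | add u v _ _ hu hv => rw [smul_add]; exact T.graph.add_mem hu hv
    | smul c u _ hu => rw [smul_comm]; exact T.graph.smul_mem c hu

theorem IsDiagonal.rank_eigenspace (h : IsDiagonal T b lam)
    (hlam : Filter.Tendsto lam Filter.atTop Filter.atTop) (x : ℝ) :
    {n : ℕ | lam n = x}.encard = Cardinal.toENat (Module.rank ℂ (eigenspace T (x : ℂ))) := by
  have hli : LinearIndependent ℂ (fun n : {n | lam n = x} => b n) :=
    b.orthonormal.linearIndependent.comp _ Subtype.val_injective
  have h1 := rank_span hli
  have h2 : Set.range (fun n : {n | lam n = x} => b n) = b '' {n | lam n = x} := by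
    ext y; simp
  rw [h2] at h1
  have hinj : Function.Injective b := b.orthonormal.linearIndependent.injective
  rw [h.eigenspace_eq hlam, h1, Set.toENat_cardinalMk, hinj.encard_image]

theorem IsDiagonal.isEigenvalueSequence [CompleteSpace E] (h : IsDiagonal T b lam)
    (hmono : Monotone lam) (hlam : Filter.Tendsto lam Filter.atTop Filter.atTop) :
    IsEigenvalueSequence T lam :=
  ⟨hmono, h.spec_eq hlam, h.rank_eigenspace hlam⟩

theorem IsDiagonal.hasPurelyDiscreteSpectrum [CompleteSpace E] (h : IsDiagonal T b lam)
    (hlam : Filter.Tendsto lam Filter.atTop Filter.atTop) : HasPurelyDiscreteSpectrum T := by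
  intro z hz
  rw [h.spec_eq hlam] at hz
  obtain ⟨n, rfl⟩ := hz
  obtain ⟨δ, hδ, hgap⟩ := exists_gap hlam (lam n : ℂ)
  refine ⟨⟨δ, hδ, fun w hw hlt => ?_⟩, ?_, ?_⟩
  · rw [h.spec_eq hlam] at hw
    obtain ⟨m, rfl⟩ := hw
    by_contra hne
    exact absurd (hgap m hne) (not_le.2 hlt)
  · rw [Submodule.ne_bot_iff]
    refine ⟨b n, ?_, b.orthonormal.ne_zero n⟩
    rw [h.eigenspace_eq hlam]
    exact Submodule.subset_span ⟨n, rfl, rfl⟩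
  · simp only
    rw [h.eigenspace_eq hlam]
    exact FiniteDimensional.span_of_finite ℂ
      (((finite_le_of_tendsto hlam (lam n)).subset fun m (hm : lam m = lam n) => hm.le).image b)

theorem IsDiagonal.le_infSpec [CompleteSpace E] (h : IsDiagonal T b lam)
    (hlam : Filter.Tendsto lam Filter.atTop Filter.atTop) {m : ℝ} (hm : ∀ n, m ≤ lam n) :
    (m : EReal) ≤ infSpec T := by
  refine le_sInf ?_
  rintro _ ⟨x, hx, rfl⟩
  rw [h.spec_eq hlam] at hx
  obtain ⟨n, hn⟩ := hx
  have hn' : lam n = x := Complex.ofReal_injective hn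
  rw [← hn']
  exact_mod_cast hm n

end Diagonal
end NcHO
end

noncomputable section
namespace NcHO

/-! ### Compactness of the inverse of a diagonal operator -/

section Compact
variable {E : Type*} [NormedAddCommGroup E] [InnerProductSpace ℂ E]

theorem norm_le_of_coeff {ι : Type*} (b : HilbertBasis ι ℂ E) {f g : E} {C : ℝ} (hC : 0 ≤ C)
    (h : ∀ n, ‖inner ℂ (b n) g‖ ≤ C * ‖inner ℂ (b n) f‖) : ‖g‖ ≤ C * ‖f‖ := by
  refine (sq_le_sq₀ (norm_nonneg _) (by positivity)).1 ?_
  rw [mul_pow]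
  refine hasSum_le (fun n => ?_) (hasSum_norm_sq_coeff b g)
    ((hasSum_norm_sq_coeff b f).mul_left (C ^ 2))
  rw [← mul_pow]
  exact pow_le_pow_left₀ (norm_nonneg _) (h n) 2

/-- The rank-one operator `f ↦ ⟪v, f⟫ v`. -/
def rankOne (v : E) : E →L[ℂ] E := (innerSL ℂ v).smulRight v

theorem rankOne_apply (v f : E) : rankOne v f = (inner ℂ v f : ℂ) • v := rfl

theorem isCompactOperator_rankOne (v : E) : IsCompactOperator (rankOne v) := by
  have h : IsCompactOperator (ContinuousLinearMap.toSpanSingleton ℂ v) :=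
    isCompactOperator_of_locallyCompactSpace_rng _
  exact h.comp_clm (innerSL ℂ v)

/-- Partial sums of the inverse of the diagonal operator with eigenvalues `μ`. -/
def partialInverse (v : HilbertBasis ℕ ℂ E) (μ : ℕ → ℝ) (n : ℕ) : E →L[ℂ] E :=
  ∑ k ∈ Finset.range n, ((μ k : ℂ)⁻¹) • rankOne (v k)

theorem isCompactOperator_partialInverse (v : HilbertBasis ℕ ℂ E) (μ : ℕ → ℝ) (n : ℕ) :
    IsCompactOperator (partialInverse v μ n) := by
  induction n with
  | zero => exact isCompactOperator_zero
  | succ n ih =>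
    have h : partialInverse v μ (n + 1) = partialInverse v μ n + (μ n : ℂ)⁻¹ • rankOne (v n) :=
      Finset.sum_range_succ _ _
    rw [h]
    exact ih.add ((isCompactOperator_rankOne (v n)).smul _)

theorem inner_partialInverse (v : HilbertBasis ℕ ℂ E) (μ : ℕ → ℝ) (n j : ℕ) (f : E) :
    inner ℂ (v j) (partialInverse v μ n f) =
      if j < n then (μ j : ℂ)⁻¹ * inner ℂ (v j) f else 0 := by
  simp only [partialInverse, sum_apply, inner_sum, smul_apply, rankOne_apply,
    inner_smul_right, inner_basis]
  simp

variable [CompleteSpace E]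

/-- The finite rank partial sums are Cauchy in operator norm, because the part from index n on has
norm at most 1/μ n; norm limits of compact operators are compact. -/
theorem exists_compact_inverse (v : HilbertBasis ℕ ℂ E) {μ : ℕ → ℝ} (hpos : ∀ n, 0 < μ n)
    (hmono : Monotone μ) (hμ : Filter.Tendsto μ Filter.atTop Filter.atTop) :
    ∃ S : E →L[ℂ] E, IsCompactOperator S ∧
      ∀ f n, inner ℂ (v n) (S f) = (μ n : ℂ)⁻¹ * inner ℂ (v n) f := by
  have h0 : Filter.Tendsto (fun n => (μ n)⁻¹) Filter.atTop (nhds 0) :=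
    tendsto_inv_atTop_zero.comp hμ
  have hC : CauchySeq (partialInverse v μ) := by
    refine cauchySeq_of_le_tendsto_0' (fun n => (μ n)⁻¹) (fun n m hnm => ?_) h0
    rw [dist_comm, dist_eq_norm]
    refine ContinuousLinearMap.opNorm_le_bound _ (inv_nonneg.2 (hpos n).le) fun f => ?_
    refine norm_le_of_coeff v (inv_nonneg.2 (hpos n).le) fun j => ?_
    rw [sub_apply, inner_sub_right, inner_partialInverse, inner_partialInverse]
    by_cases h1 : j < n
    · rw [if_pos h1, if_pos (h1.trans_le hnm), sub_self, norm_zero]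
      exact mul_nonneg (inv_nonneg.2 (hpos n).le) (norm_nonneg _)
    · rw [if_neg h1, sub_zero]
      split_ifs with h2
      · rw [norm_mul, norm_inv, Complex.norm_real, Real.norm_eq_abs, abs_of_pos (hpos j)]
        have := hmono (not_lt.1 h1)
        have := hpos n
        gcongr
      · rw [norm_zero]
        exact mul_nonneg (inv_nonneg.2 (hpos n).le) (norm_nonneg _)
  obtain ⟨S, hS⟩ := cauchySeq_tendsto_of_complete hC
  refine ⟨S, isCompactOperator_of_tendsto hS
    (Filter.Eventually.of_forall (isCompactOperator_partialInverse v μ)), fun f n => ?_⟩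
  have h1 : Filter.Tendsto (fun m => inner ℂ (v n) (partialInverse v μ m f)) Filter.atTop
      (nhds (inner ℂ (v n) (S f))) :=
    (Filter.Tendsto.inner tendsto_const_nhds
      (((ContinuousLinearMap.apply ℂ E f).continuous.tendsto S).comp hS))
  refine tendsto_nhds_unique h1 (tendsto_const_nhds.congr' ?_)
  filter_upwards [Filter.eventually_gt_atTop n] with m hm
  rw [inner_partialInverse, if_pos hm]

/-- A Hilbert basis of eigenvectors of an injective compact symmetric operator. -/
theorem exists_eigenbasis {R : E →L[ℂ] E} (hR : IsCompactOperator R)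
    (hsymm : (R : E →ₗ[ℂ] E).IsSymmetric) (hinj : Function.Injective R) :
    ∃ (ι : Type) (b : HilbertBasis ι ℂ E) (r : ι → ℝ),
      ∀ i, r i ≠ 0 ∧ R (b i) = (r i : ℂ) • b i := by
  -- Injectivity removes the eigenvalue 0, the only one whose eigenspace could be
  -- infinite-dimensional. Orthonormal bases of the eigenspaces then assemble into one basis.
  have hzero : Module.End.eigenspace (R : E →ₗ[ℂ] E) 0 = ⊥ := by
    rw [Module.End.eigenspace_zero]
    exact LinearMap.ker_eq_bot.2 hinj
  have hfd : ∀ z : ℂ, FiniteDimensional ℂ (Module.End.eigenspace (R : E →ₗ[ℂ] E) z) := fun z => by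
    by_cases hz : z = 0
    · rw [hz, hzero]
      infer_instance
    · exact ContinuousLinearMap.finite_dimensional_eigenspace hR z hz
  let e := fun z : ℂ => stdOrthonormalBasis ℂ (Module.End.eigenspace (R : E →ₗ[ℂ] E) z)
  have ho : Orthonormal ℂ (fun i : Σ z : ℂ,
      Fin (Module.finrank ℂ (Module.End.eigenspace (R : E →ₗ[ℂ] E) z)) =>
        ((e i.1 i.2 : Module.End.eigenspace (R : E →ₗ[ℂ] E) i.1) : E)) :=
    hsymm.orthogonalFamily_eigenspaces.orthonormal_sigma_orthonormal
    (fun z => (e z).orthonormal)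
  have hsp := ContinuousLinearMap.orthogonalComplement_iSup_eigenspaces_eq_bot hR hsymm
  have hle : (⨆ z, Module.End.eigenspace (R : E →ₗ[ℂ] E) z) ≤ Submodule.span ℂ (Set.range
      fun i : Σ z : ℂ, Fin (Module.finrank ℂ (Module.End.eigenspace (R : E →ₗ[ℂ] E) z)) =>
        ((e i.1 i.2 : Module.End.eigenspace (R : E →ₗ[ℂ] E) i.1) : E)) := by
    refine iSup_le fun z u hu => ?_
    have h1 := (e z).sum_repr ⟨u, hu⟩
    have h2 := congrArg Subtype.val h1
    simp only [AddSubmonoidClass.coe_finsetSum, Submodule.coe_smul] at h2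
    rw [← h2]
    exact Submodule.sum_mem _ fun i _ => Submodule.smul_mem _ _ (Submodule.subset_span ⟨⟨z, i⟩, rfl⟩)
  have hbot := eq_bot_iff.2 ((Submodule.orthogonal_le hle).trans hsp.le)
  refine ⟨_, HilbertBasis.mkOfOrthogonalEqBot ho hbot, fun i => i.1.re, fun i => ?_⟩
  rw [HilbertBasis.coe_mkOfOrthogonalEqBot]
  have hmem := (e i.1 i.2).2
  have hne : ((e i.1 i.2 : Module.End.eigenspace (R : E →ₗ[ℂ] E) i.1) : E) ≠ 0 := ho.ne_zero i
  have hval : Module.End.HasEigenvalue (R : E →ₗ[ℂ] E) i.1 :=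
    Module.End.hasEigenvalue_of_hasEigenvector ⟨hmem, hne⟩
  have hreal : ((i.1.re : ℝ) : ℂ) = i.1 :=
    Complex.conj_eq_iff_re.1 (hsymm.conj_eigenvalue_eq_self hval)
  have h1 := (Module.End.mem_eigenspace_iff.1 hmem).trans
    (congrArg (fun z : ℂ => z • ((e i.1 i.2 :
      Module.End.eigenspace (R : E →ₗ[ℂ] E) i.1) : E)) hreal.symm)
  refine ⟨fun h0 => hne (hinj ?_), h1⟩
  have h0 : i.1.re = 0 := h0
  rw [h0, Complex.ofReal_zero, zero_smul] at h1
  exact h1.trans (map_zero R).symm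

end Compact

/-! ### Min-max comparison of eigenvalues under congruence -/

section MinMax
variable {E : Type*} [NormedAddCommGroup E] [InnerProductSpace ℂ E]

theorem hasSum_form {ι : Type*} (b : HilbertBasis ι ℂ E) {w : ι → ℝ} {f g : E}
    (h : ∀ n, inner ℂ (b n) g = (w n : ℂ) * inner ℂ (b n) f) :
    HasSum (fun n => w n * ‖inner ℂ (b n) f‖ ^ 2) (inner ℂ f g).re := by
  have h1 := Complex.hasSum_re (b.hasSum_inner_mul_inner f g)
  convert h1 using 2 with n
  rw [h, mul_left_comm, ← inner_conj_symm f, mul_comm (starRingEnd ℂ _), Complex.mul_conj,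
    Complex.normSq_eq_norm_sq, ← Complex.ofReal_mul, Complex.ofReal_re]

/-- Min-max comparison: if the quadratic form `∑ μ k |⟪v k, B f⟫|²` agrees on `D` with the form
that is diagonal in `b`, then `N + 1` of the `w i` cannot all lie below `c * μ N`. -/
theorem mul_le_of_card {ι : Type*} (b : HilbertBasis ι ℂ E) (w : ι → ℝ) (v : HilbertBasis ℕ ℂ E)
    {μ : ℕ → ℝ} (hμ0 : ∀ n, 0 ≤ μ n) (hmono : Monotone μ) (D : Submodule ℂ E)
    (hbD : ∀ i, b i ∈ D) (B : E →L[ℂ] E) {c : ℝ} (hB : ∀ f, c * ‖f‖ ^ 2 ≤ ‖B f‖ ^ 2)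
    (hform : ∀ f ∈ D, ∃ F, HasSum (fun i => w i * ‖inner ℂ (b i) f‖ ^ 2) F ∧
      HasSum (fun k => μ k * ‖inner ℂ (v k) (B f)‖ ^ 2) F)
    {s : Finset ι} {N : ℕ} (hs : s.card = N + 1) {x : ℝ} (hx : ∀ i ∈ s, w i ≤ x) :
    c * μ N ≤ x := by
  classical
  let J : (s → ℂ) →ₗ[ℂ] E := Fintype.linearCombination ℂ (fun i : s => b i)
  let L : (s → ℂ) →ₗ[ℂ] (Fin N → ℂ) := LinearMap.pi fun k =>
    ((innerSL ℂ (v k)).toLinearMap ∘ₗ B.toLinearMap) ∘ₗ J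
  -- There are N + 1 coefficients and N conditions, so some nonzero combination of the `b i` has its
  -- image under `B` orthogonal to v 0, …, v (N - 1).
  have hker : LinearMap.ker L ≠ ⊥ := LinearMap.ker_ne_bot_of_finrank_lt (by simp [hs])
  obtain ⟨a, ha, ha0⟩ := Submodule.exists_mem_ne_zero_of_ne_bot hker
  have hJ : J a = ∑ i : s, a i • b i := rfl
  have hf0 : J a ≠ 0 := by
    intro h0
    have hli : LinearIndependent ℂ (fun i : s => b i) :=
      b.orthonormal.linearIndependent.comp _ Subtype.val_injective
    exact ha0 (funext (Fintype.linearIndependent_iff.1 hli a h0))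
  have hD : J a ∈ D := by
    rw [hJ]
    exact Submodule.sum_mem _ fun i _ => Submodule.smul_mem _ _ (hbD i)
  have hk : ∀ k < N, inner ℂ (v k) (B (J a)) = 0 := fun k hk => congrFun ha ⟨k, hk⟩
  have hi : ∀ i ∉ s, inner ℂ (b i) (J a) = 0 := fun i hi => by
    rw [hJ, inner_sum]
    refine Finset.sum_eq_zero fun j _ => ?_
    rw [inner_smul_right, orthonormal_iff_ite.1 b.orthonormal, if_neg, mul_zero]
    rintro rfl
    exact hi j.2
  obtain ⟨F, h1, h2⟩ := hform _ hD
  -- The form of this vector is estimated from above in the basis `b` and from below in the basis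
  -- `v`.
  have h3 : F ≤ x * ‖J a‖ ^ 2 := by
    refine hasSum_le (fun i => ?_) h1 ((hasSum_norm_sq_coeff b (J a)).mul_left x)
    by_cases his : i ∈ s
    · exact mul_le_mul_of_nonneg_right (hx i his) (by positivity)
    · simp [hi i his]
  have h4 : μ N * ‖B (J a)‖ ^ 2 ≤ F := by
    refine hasSum_le (fun k => ?_) ((hasSum_norm_sq_coeff v (B (J a))).mul_left (μ N)) h2
    by_cases hkN : k < N
    · simp [hk k hkN]
    · exact mul_le_mul_of_nonneg_right (hmono (not_lt.1 hkN)) (by positivity)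
  have h5 : 0 < ‖J a‖ ^ 2 := by
    have := norm_pos_iff.2 hf0
    positivity
  have h6 : c * μ N * ‖J a‖ ^ 2 ≤ x * ‖J a‖ ^ 2 := by
    calc c * μ N * ‖J a‖ ^ 2 = μ N * (c * ‖J a‖ ^ 2) := by ring
      _ ≤ μ N * ‖B (J a)‖ ^ 2 := mul_le_mul_of_nonneg_left (hB _) (hμ0 N)
      _ ≤ _ := h4.trans h3
  exact le_of_mul_le_mul_right h6 h5

/-- Rank each index by the number of its predecessors, a well-order breaking ties of `w`. Sublevel
sets are finite, so ranks are natural numbers, and distinct indices have distinct ranks. Their range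
is an infinite subset of ℕ, hence order isomorphic to ℕ. -/
theorem exists_monotone_enumeration {ι : Type*} [Infinite ι] (w : ι → ℝ)
    (hw : ∀ x, {i | w i ≤ x}.Finite) : ∃ σ : ℕ ≃ ι, Monotone (w ∘ σ) := by
  classical
  let : LinearOrder ι := linearOrderOfSTO WellOrderingRel
  let key : ι → ℝ ×ₗ ι := fun i => toLex (w i, i)
  have hkey : Function.Injective key := fun i j h => congrArg (fun z => (ofLex z).2) h
  have hfin : ∀ i, {j | key j < key i}.Finite := fun i =>
    (hw (w i)).subset fun j (hj : key j < key i) => by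
      rcases Prod.Lex.toLex_lt_toLex.1 hj with h | h
      · exact h.le
      · exact h.1.le
  let r : ι → ℕ := fun i => {j | key j < key i}.ncard
  have hr : ∀ i j, key i < key j → r i < r j := fun i j hij =>
    Set.ncard_lt_ncard ⟨fun k hk => lt_trans hk hij, fun h => lt_irrefl (key i) (h hij)⟩ (hfin j)
  have hinj : Function.Injective r := fun i j h => by
    by_contra hne
    rcases lt_or_gt_of_ne (hkey.ne hne) with h1 | h1
    · exact (hr _ _ h1).ne h
    · exact (hr _ _ h1).ne' h
  have : Infinite (Set.range r) := (Set.infinite_range_of_injective hinj).to_subtype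
  let o := Nat.Subtype.orderIsoOfNat (Set.range r)
  let σ : ℕ ≃ ι := o.toEquiv.trans (Equiv.ofInjective r hinj).symm
  have hσ : ∀ n, r (σ n) = o n := fun n =>
    congrArg Subtype.val ((Equiv.ofInjective r hinj).apply_symm_apply (o n))
  refine ⟨σ, fun n m hnm => ?_⟩
  by_contra hlt
  have h1 : key (σ m) < key (σ n) := Prod.Lex.toLex_lt_toLex.2 (Or.inl (not_le.1 hlt))
  have h2 := hr _ _ h1
  rw [hσ, hσ] at h2
  exact absurd (o.monotone hnm) (not_le.2 h2)

theorem infinite_of_hilbertBasis {ι : Type*} (b : HilbertBasis ι ℂ E)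
    (v : HilbertBasis ℕ ℂ E) : Infinite ι := by
  by_contra hfin
  rw [not_infinite_iff_finite] at hfin
  let L : E →ₗ[ℂ] (ι → ℂ) := LinearMap.pi fun i => (innerSL ℂ (b i)).toLinearMap
  have hL : Function.Injective L := fun f g h => eq_of_coeff b fun n => congrFun h n
  have : FiniteDimensional ℂ E := FiniteDimensional.of_injective L hL
  have := v.orthonormal.linearIndependent.finite
  exact not_finite ℕ

variable [CompleteSpace E]

/-- An operator that is congruent, through a bounded invertible symmetric `B`, to a diagonal
operator with positive eigenvalues `μ` tending to infinity is itself diagonal, with eigenvalues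
between `m * μ` and `M * μ`. -/
theorem exists_isDiagonal_of_congruent {T : E →ₗ.[ℂ] E} (v : HilbertBasis ℕ ℂ E) {μ : ℕ → ℝ}
    (hpos : ∀ n, 0 < μ n) (hmono : Monotone μ)
    (hμ : Filter.Tendsto μ Filter.atTop Filter.atTop) (B B' : E →L[ℂ] E)
    (hB : ∀ f g, inner ℂ (B f) g = inner ℂ f (B g))
    (hB' : ∀ f g, inner ℂ (B' f) g = inner ℂ f (B' g))
    (hBB' : ∀ f, B (B' f) = f) (hB'B : ∀ f, B' (B f) = f) {m M : ℝ} (hm : 0 < m) (hM : 0 < M)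
    (hmB : ∀ f, m * ‖f‖ ^ 2 ≤ ‖B f‖ ^ 2) (hMB : ∀ f, ‖B f‖ ^ 2 ≤ M * ‖f‖ ^ 2)
    (hT : ∀ f g, (f, g) ∈ T.graph ↔ ∀ k, inner ℂ (v k) (B' g) = (μ k : ℂ) * inner ℂ (v k) (B f)) :
    ∃ (b : HilbertBasis ℕ ℂ E) (lam : ℕ → ℝ), IsDiagonal T b lam ∧ Monotone lam ∧
      Filter.Tendsto lam Filter.atTop Filter.atTop ∧ ∀ n, m * μ n ≤ lam n ∧ lam n ≤ M * μ n := by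
  classical
  obtain ⟨S, hSc, hS⟩ := exists_compact_inverse v hpos hmono hμ
  have hμne : ∀ k, (μ k : ℂ) ≠ 0 := fun k => Complex.ofReal_ne_zero.2 (hpos k).ne'
  have hSsymm : ∀ f g, inner ℂ (S f) g = inner ℂ f (S g) := fun f g => by
    rw [← v.tsum_inner_mul_inner (S f), ← v.tsum_inner_mul_inner f (S g)]
    congr 1; ext n
    rw [hS, ← inner_conj_symm (S f), hS, map_mul, map_inv₀, Complex.conj_ofReal, inner_conj_symm]
    ring
  -- Formally T = B K B with K diagonal in `v` and S = K⁻¹, so R is the inverse of T.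
  let R : E →L[ℂ] E := B' ∘L S ∘L B'
  have hRapp : ∀ f, R f = B' (S (B' f)) := fun f => rfl
  have hRc : IsCompactOperator R := (hSc.comp_clm B').clm_comp B'
  have hRs : (R : E →ₗ[ℂ] E).IsSymmetric := fun f g => by
    change inner ℂ (B' (S (B' f))) g = inner ℂ f (B' (S (B' g)))
    rw [hB', hSsymm, hB']
  have hTR : ∀ f g, (f, g) ∈ T.graph ↔ f = R g := fun f g => by
    rw [hT, hRapp]
    constructor
    · intro h
      have h1 : B f = S (B' g) := eq_of_coeff v fun n => by
        rw [hS, h, inv_mul_cancel_left₀ (hμne n)]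
      rw [← h1, hB'B]
    · rintro rfl k
      rw [hBB', hS, mul_inv_cancel_left₀ (hμne k)]
  have hinj : Function.Injective R := fun f g h => by
    have h1 : S (B' f) = S (B' g) := by
      rw [← hBB' (S (B' f)), ← hBB' (S (B' g)), ← hRapp, ← hRapp, h]
    have h2 : B' f = B' g := eq_of_coeff v fun n => by
      have h3 := hS (B' f) n
      rw [h1, hS] at h3
      exact (mul_left_cancel₀ (inv_ne_zero (hμne n)) h3).symm
    rw [← hBB' f, h2, hBB']
  obtain ⟨ι, b, r, hr⟩ := exists_eigenbasis hRc hRs hinj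
  let w : ι → ℝ := fun i => (r i)⁻¹
  have hTb : ∀ f g, (f, g) ∈ T.graph ↔ ∀ i, inner ℂ (b i) g = (w i : ℂ) * inner ℂ (b i) f := by
    intro f g
    have hrne : ∀ i, (r i : ℂ) ≠ 0 := fun i => Complex.ofReal_ne_zero.2 (hr i).1
    have h1 : ∀ i, inner ℂ (b i) (R g) = (r i : ℂ) * inner ℂ (b i) g := fun i => by
      rw [← ContinuousLinearMap.coe_coe, ← hRs (b i) g, ContinuousLinearMap.coe_coe, (hr i).2,
        inner_smul_left, Complex.conj_ofReal]
    rw [hTR]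
    constructor
    · rintro rfl i
      rw [h1, Complex.ofReal_inv, inv_mul_cancel_left₀ (hrne i)]
    · intro h
      refine eq_of_coeff b fun i => ?_
      rw [h1, h, Complex.ofReal_inv, mul_inv_cancel_left₀ (hrne i)]
  have hbD : ∀ i, b i ∈ T.domain := fun i => LinearPMap.mem_domain_of_mem_graph
    (y := (w i : ℂ) • b i) ((hTb _ _).2 fun j => by
      rw [inner_smul_right, orthonormal_iff_ite.1 b.orthonormal]
      split_ifs with hij
      · rw [hij]
      · simp)
  have hform : ∀ f ∈ T.domain, ∃ F, HasSum (fun i => w i * ‖inner ℂ (b i) f‖ ^ 2) F ∧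
      HasSum (fun k => μ k * ‖inner ℂ (v k) (B f)‖ ^ 2) F := fun f hf => by
    have hg := T.mem_graph ⟨f, hf⟩
    refine ⟨_, hasSum_form b ((hTb _ _).1 hg), ?_⟩
    have h1 := hasSum_form v ((hT _ _).1 hg)
    rwa [hB, hBB'] at h1
  have hμ0 := fun n => (hpos n).le
  have hlow : ∀ (s : Finset ι) (N : ℕ) (x : ℝ), s.card = N + 1 → (∀ i ∈ s, w i ≤ x) →
      m * μ N ≤ x := fun s N x hs hx =>
    mul_le_of_card b w v hμ0 hmono T.domain hbD B hmB hform hs hx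
  -- An infinite sublevel set would contain N + 1 indices for every N and force m * μ N ≤ x,
  -- although μ is unbounded.
  have hfin : ∀ x, {i | w i ≤ x}.Finite := fun x => by
    by_contra hinf
    obtain ⟨N, hN⟩ := (hμ.eventually (Filter.eventually_gt_atTop (x / m))).exists
    obtain ⟨s, hs, hcard⟩ := Set.Infinite.exists_subset_card_eq hinf (N + 1)
    have h1 := hlow s N x hcard fun i hi => hs hi
    rw [div_lt_iff₀ hm] at hN
    linarith
  have : Infinite ι := infinite_of_hilbertBasis b v
  obtain ⟨σ, hσ⟩ := exists_monotone_enumeration w hfin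
  have ho : Orthonormal ℂ (b ∘ σ) := b.orthonormal.comp σ σ.injective
  have hsp : (Submodule.span ℂ (Set.range (b ∘ σ)))ᗮ = ⊥ := by
    rw [σ.surjective.range_comp]
    exact Submodule.topologicalClosure_eq_top_iff.1 b.dense_span
  let b' : HilbertBasis ℕ ℂ E := HilbertBasis.mkOfOrthogonalEqBot ho hsp
  have hb' : ∀ n, b' n = b (σ n) := fun n =>
    congrFun (HilbertBasis.coe_mkOfOrthogonalEqBot ho hsp) n
  have hdiag : IsDiagonal T b' (w ∘ σ) := fun f g => by
    rw [hTb]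
    simp_rw [hb', Function.comp_apply]
    exact ⟨fun h n => h (σ n), fun h i => by simpa using h (σ.symm i)⟩
  have hlo : ∀ n, m * μ n ≤ (w ∘ σ) n := fun n => by
    refine hlow ((Finset.range (n + 1)).map σ.toEmbedding) n _ (by simp) fun i hi => ?_
    obtain ⟨j, hj, rfl⟩ := Finset.mem_map.1 hi
    exact hσ (Nat.lt_succ_iff.1 (Finset.mem_range.1 hj))
  have hpos' : ∀ n, 0 ≤ (w ∘ σ) n := fun n =>
    (mul_nonneg hm.le (hμ0 n)).trans (hlo n)
  refine ⟨b', w ∘ σ, hdiag, hσ, Filter.tendsto_atTop_mono hlo (hμ.const_mul_atTop hm),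
    fun n => ⟨hlo n, ?_⟩⟩
  -- The upper bound is the same comparison with the roles of the bases exchanged, `B'` replacing
  -- `B` and the domain transported by `B`.
  have h1 : M⁻¹ * (w ∘ σ) n ≤ μ n := by
    refine mul_le_of_card v μ b' hpos' hσ (T.domain.map B.toLinearMap) (fun i => ?_) B'
      (c := M⁻¹) (fun f => ?_) ?_ (s := Finset.range (n + 1)) (Finset.card_range _)
      fun i hi => hmono (Nat.lt_succ_iff.1 (Finset.mem_range.1 hi))
    · refine ⟨B' (v i), LinearPMap.mem_domain_of_mem_graph (y := B ((μ i : ℂ) • v i))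
        ((hT _ _).2 fun k => ?_), hBB' _⟩
      rw [hB'B, hBB', inner_smul_right, inner_basis]
      split_ifs with hij
      · rw [hij]
      · simp
    · have h2 := hMB (B' f)
      rw [hBB'] at h2
      rwa [inv_mul_le_iff₀ hM]
    · rintro _ ⟨f, hf, rfl⟩
      obtain ⟨F, hF1, hF2⟩ := hform f hf
      refine ⟨F, hF2, ?_⟩
      simp_rw [ContinuousLinearMap.coe_coe, hB'B, hb']
      exact (σ.hasSum_iff (f := fun i => w i * ‖inner ℂ (b i) f‖ ^ 2)).2 hF1
  rwa [inv_mul_le_iff₀ hM] at h1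

end MinMax
end NcHO
end

noncomputable section
namespace NcHO

/-! ### Essential self-adjointness from approximation by a core -/

section Core
variable {E : Type*} [NormedAddCommGroup E] [InnerProductSpace ℂ E]

/-- An operator is essentially self-adjoint if every pair that is weakly in its graph, as tested
against the core `ψ`, is a limit of elements of the graph in the core. -/
theorem isEssentiallySelfAdjoint_of_core [CompleteSpace E] {X : Type*} {T : E →ₗ.[ℂ] E}
    (ψ ψ' : X → E) (hdense : DenseRange ψ) (hcore : ∀ x, (ψ x, ψ' x) ∈ T.graph)
    (hweak : ∀ f g, (f, g) ∈ T.graph → ∀ x, inner ℂ (ψ x) g = inner ℂ (ψ' x) f)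
    (happrox : ∀ f g, (∀ x, inner ℂ (ψ x) g = inner ℂ (ψ' x) f) → ∃ x : ℕ → X,
      Filter.Tendsto (fun n => ψ (x n)) Filter.atTop (nhds f) ∧
      Filter.Tendsto (fun n => ψ' (x n)) Filter.atTop (nhds g)) :
    IsEssentiallySelfAdjoint T ∧
      ∀ f g, (f, g) ∈ T.closure.graph ↔ ∀ x, inner ℂ (ψ x) g = inner ℂ (ψ' x) f := by
  have hd : Dense (T.domain : Set E) := by
    refine hdense.mono ?_
    rintro _ ⟨x, rfl⟩
    exact LinearPMap.mem_domain_of_mem_graph (hcore x)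
  have hcl : ∀ f g, (f, g) ∈ closure (T.graph : Set (E × E)) ↔
      ∀ x, inner ℂ (ψ x) g = inner ℂ (ψ' x) f := fun f g => by
    constructor
    · intro h x
      have hclosed : IsClosed {y : E × E | inner ℂ (ψ x) y.2 = inner ℂ (ψ' x) y.1} :=
        isClosed_eq (by fun_prop) (by fun_prop)
      exact (closure_minimal (fun y hy => hweak y.1 y.2 hy x) hclosed) h
    · intro h
      obtain ⟨x, h1, h2⟩ := happrox f g h
      exact mem_closure_of_tendsto (h1.prodMk_nhds h2)
        (Filter.Eventually.of_forall fun n => hcore (x n))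
  obtain ⟨h1, h2⟩ := isEssentiallySelfAdjoint_of_graph hd fun f g => by
    rw [hcl]
    constructor
    · intro h u v huv
      obtain ⟨x, hx1, hx2⟩ := happrox u v (hweak u v huv)
      refine tendsto_nhds_unique (hx1.inner tendsto_const_nhds) ?_
      simp_rw [h]
      exact hx2.inner tendsto_const_nhds
    · intro h x
      exact h _ _ (hcore x)
  refine ⟨h1, fun f g => ?_⟩
  rw [← hcl, ← h2]
  rfl

/-- By Parseval the squared norm is a sum over k, to which dominated convergence for series applies.
-/
theorem tendsto_zero_of_coeff (b : HilbertBasis ℕ ℂ E) {F : ℕ → E} {bound : ℕ → ℝ}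
    (hs : Summable bound) (hb : ∀ m k, ‖inner ℂ (b k) (F m)‖ ^ 2 ≤ bound k)
    (h0 : ∀ k, Filter.Tendsto (fun m => inner ℂ (b k) (F m)) Filter.atTop (nhds 0)) :
    Filter.Tendsto F Filter.atTop (nhds 0) := by
  have h1 : Filter.Tendsto (fun m => ∑' k, ‖inner ℂ (b k) (F m)‖ ^ 2) Filter.atTop
      (nhds (∑' _ : ℕ, (0 : ℝ))) := by
    refine tendsto_tsum_of_dominated_convergence hs (fun k => ?_)
      (Filter.Eventually.of_forall fun m k => ?_)
    · simpa using (h0 k).norm.pow 2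
    · rw [Real.norm_of_nonneg (by positivity)]
      exact hb m k
  simp_rw [(hasSum_norm_sq_coeff b _).tsum_eq, tsum_zero] at h1
  rw [tendsto_zero_iff_norm_tendsto_zero]
  simpa using h1.sqrt

end Core
end NcHO
end

noncomputable section
namespace NcHO

/-! ### Smooth cutoffs in the Hermite basis -/

/-- A cutoff that decreases linearly from `1` to `0` on `[0, m + 1]`. -/
def cutWeight (m n : ℕ) : ℝ := max 0 (1 - n / (m + 1))

theorem cutWeight_nonneg (m n : ℕ) : 0 ≤ cutWeight m n := le_max_left _ _

theorem cutWeight_le_one (m n : ℕ) : cutWeight m n ≤ 1 :=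
  max_le zero_le_one (sub_le_self _ (by positivity))

theorem cutWeight_eq_zero {m n : ℕ} (h : m < n) : cutWeight m n = 0 := by
  refine max_eq_left (sub_nonpos.2 ?_)
  rw [le_div_iff₀ (by positivity), one_mul]
  exact_mod_cast h

/-- The cutoff has slope at most 1/(m + 1), so an index shift by at most 2 costs 2/(m + 1). A sharp
cutoff would lack this decay. -/
theorem abs_cutWeight_sub_le {m j k : ℕ} (h1 : j ≤ k + 2) (h2 : k ≤ j + 2) :
    |cutWeight m j - cutWeight m k| ≤ 2 / (m + 1) := by
  refine (abs_max_sub_max_le_max _ _ _ _).trans ?_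
  rw [sub_self, abs_zero, max_eq_right (abs_nonneg _), sub_sub_sub_cancel_left, ← sub_div, abs_div,
    abs_of_pos (by positivity : (0 : ℝ) < m + 1)]
  have h1' : (j : ℝ) ≤ k + 2 := by exact_mod_cast h1
  have h2' : (k : ℝ) ≤ j + 2 := by exact_mod_cast h2
  gcongr
  rw [abs_le]
  constructor <;> linarith

theorem tendsto_cutWeight (n : ℕ) :
    Filter.Tendsto (fun m => cutWeight m n) Filter.atTop (nhds 1) := by
  have h1 : Filter.Tendsto (fun m : ℕ => (n : ℝ) / (m + 1)) Filter.atTop (nhds 0) :=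
    tendsto_const_nhds.div_atTop
      (Filter.tendsto_atTop_add_const_right _ _ tendsto_natCast_atTop_atTop)
  have h2 := (tendsto_const_nhds (x := (0 : ℝ))).max ((tendsto_const_nhds (x := (1 : ℝ))).sub h1)
  simpa [cutWeight] using h2

section Cut
variable {ω : ℝ} (hω : 0 < ω) (c : ℝ)

/-- The cutoff of `u` in the Hermite basis, as a Schwartz function. -/
def cut (m : ℕ) (u : L2) : 𝓢(ℝ, ℂ) :=
  ∑ n ∈ Finset.range (m + 1), ((cutWeight m n : ℂ) * inner ℂ (emb (herm hω c n)) u) • herm hω c n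

/-- The cutoff of the weak image of `u` under the adjoint of `B`. -/
def cutImage (B : SEnd) (m : ℕ) (u : L2) : L2 :=
  ∑ n ∈ Finset.range (m + 1),
    ((cutWeight m n : ℂ) * inner ℂ (emb (B (herm hω c n))) u) • emb (herm hω c n)

theorem inner_cutImage (B : SEnd) (m k : ℕ) (u : L2) :
    inner ℂ (emb (herm hω c k)) (cutImage hω c B m u)
      = (cutWeight m k : ℂ) * inner ℂ (emb (B (herm hω c k))) u := by
  simp only [cutImage, inner_sum, inner_smul_right, orthonormal_iff_ite.1 (orthonormal_herm hω c)]
  simp only [mul_ite, mul_one, mul_zero, Finset.sum_ite_eq, Finset.mem_range]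
  split_ifs with h
  · rfl
  · rw [cutWeight_eq_zero (by omega), Complex.ofReal_zero, zero_mul]

theorem emb_cut (m : ℕ) (u : L2) : emb (cut hω c m u) = cutImage hω c 1 m u := by
  simp [cut, cutImage]

/-- The coefficients are those of `g` times weights in [0, 1] that tend to 1. -/
theorem tendsto_cutImage {B : SEnd} {u g : L2}
    (h : ∀ k, inner ℂ (emb (herm hω c k)) g = inner ℂ (emb (B (herm hω c k))) u) :
    Filter.Tendsto (fun m => cutImage hω c B m u) Filter.atTop (nhds g) := by
  rw [← tendsto_sub_nhds_zero_iff]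
  refine tendsto_zero_of_coeff (hermBasis hω c) (hasSum_norm_sq_coeff (hermBasis hω c) g).summable
    (fun m k => ?_) fun k => ?_
  · rw [inner_sub_right, hermBasis_apply, inner_cutImage, ← h, ← sub_one_mul, norm_mul, mul_pow]
    refine mul_le_of_le_one_left (by positivity) (pow_le_one₀ (norm_nonneg _) ?_)
    rw [← Complex.ofReal_one, ← Complex.ofReal_sub, Complex.norm_real, Real.norm_eq_abs, abs_le]
    have h1 := cutWeight_nonneg m k
    have h2 := cutWeight_le_one m k
    constructor <;> linarith
  · simp_rw [inner_sub_right, hermBasis_apply, inner_cutImage, ← h, ← sub_one_mul]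
    have h1 := (Complex.continuous_ofReal.tendsto 1).comp (tendsto_cutWeight k)
    have h2 := (h1.sub_const 1).mul_const (inner ℂ (emb (herm hω c k)) g)
    simpa using h2

theorem tendsto_emb_cut (u : L2) :
    Filter.Tendsto (fun m => emb (cut hω c m u)) Filter.atTop (nhds u) := by
  simp_rw [emb_cut]
  exact tendsto_cutImage hω c fun k => rfl

/-- Applying `A` commutes asymptotically with the cutoff, in the weak sense. -/
def CutCompatible (A B : SEnd) : Prop :=
  ∀ u, Filter.Tendsto (fun m => emb (A (cut hω c m u)) - cutImage hω c B m u) Filter.atTop (nhds 0)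

theorem CutCompatible.add {A B A' B' : SEnd} (h : CutCompatible hω c A B)
    (h' : CutCompatible hω c A' B') : CutCompatible hω c (A + A') (B + B') := fun u => by
  have h1 := (h u).add (h' u)
  rw [add_zero] at h1
  refine h1.congr fun m => ?_
  simp only [cutImage, LinearMap.add_apply, map_add, inner_add_left, mul_add, add_smul,
    Finset.sum_add_distrib]
  abel

theorem CutCompatible.smul {A B : SEnd} (h : CutCompatible hω c A B) (z : ℂ) :
    CutCompatible hω c (z • A) ((starRingEnd ℂ) z • B) := fun u => by
  have h1 := (h u).const_smul z
  rw [smul_zero] at h1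
  refine h1.congr fun m => ?_
  simp only [cutImage, LinearMap.smul_apply, map_smul, inner_smul_left, Complex.conj_conj,
    smul_sub, Finset.smul_sum, smul_smul]
  congr 1
  refine Finset.sum_congr rfl fun n _ => ?_
  congr 1
  ring

/-- The k-th coefficient of the error is w k times the difference of the cutoffs at τ k and k, times
a coefficient of `u`. Where the cutoffs do not both vanish, |w k| ≤ m + 2, so the factor is at most
2(m + 2)/(m + 1) ≤ 4. For fixed k it tends to 0. -/
theorem cutCompatible_of_shift {A B : SEnd} (hAB : FormalAdj A B) (τ : ℕ → ℕ) (w : ℕ → ℝ)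
    (hB : ∀ k, B (herm hω c k) = (w k : ℂ) • herm hω c (τ k)) (h1 : ∀ k, τ k ≤ k + 2)
    (h2 : ∀ k, k ≤ τ k + 2) (hw : ∀ k, |w k| ≤ min k (τ k) + 2)
    (hτ : ∀ s : ℕ → ℝ, Summable s → Summable (s ∘ τ)) : CutCompatible hω c A B := fun u => by
  have hcoef : ∀ m k, inner ℂ (hermBasis hω c k) (emb (A (cut hω c m u)) - cutImage hω c B m u)
      = ((w k * (cutWeight m (τ k) - cutWeight m k) : ℝ) : ℂ) *
        inner ℂ (emb (herm hω c (τ k))) u := fun m k => by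
    rw [inner_sub_right, hermBasis_apply, inner_cutImage, hAB, hB, map_smul, inner_smul_left,
      inner_smul_left, emb_cut, inner_cutImage, Complex.conj_ofReal, Module.End.one_apply]
    push_cast
    ring
  have hs := (hτ _ (hasSum_norm_sq_coeff (hermBasis hω c) u).summable).mul_left (4 ^ 2)
  refine tendsto_zero_of_coeff (hermBasis hω c) hs (fun m k => ?_) fun k => ?_
  · rw [hcoef, norm_mul, mul_pow, Function.comp_apply, hermBasis_apply]
    refine mul_le_mul_of_nonneg_right ?_ (by positivity)
    refine pow_le_pow_left₀ (norm_nonneg _) ?_ 2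
    rw [Complex.norm_real, Real.norm_eq_abs, abs_mul]
    by_cases hk : m < min k (τ k)
    · rw [cutWeight_eq_zero (hk.trans_le (min_le_left _ _)),
        cutWeight_eq_zero (hk.trans_le (min_le_right _ _)), sub_self, abs_zero, mul_zero]
      norm_num
    · have hk' : (min k (τ k) : ℝ) ≤ m := by exact_mod_cast not_lt.1 hk
      calc |w k| * |cutWeight m (τ k) - cutWeight m k| ≤ (m + 2) * (2 / (m + 1)) :=
            mul_le_mul ((hw k).trans (by push_cast; linarith)) (abs_cutWeight_sub_le (h1 k) (h2 k))
              (abs_nonneg _) (by positivity)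
        _ ≤ 4 := by
            rw [← mul_div_assoc, div_le_iff₀ (by positivity)]
            have : (0 : ℝ) ≤ m := Nat.cast_nonneg m
            linarith
  · simp_rw [hcoef]
    have h3 := ((tendsto_cutWeight (τ k)).sub (tendsto_cutWeight k)).const_mul (w k)
    have h4 := ((Complex.continuous_ofReal.tendsto _).comp h3).mul_const
      (inner ℂ (emb (herm hω c (τ k))) u)
    simpa using h4

theorem cutCompatible_one : CutCompatible hω c 1 1 := fun u => by
  simp [emb_cut]

theorem cutCompatible_number : CutCompatible hω c (cre ω c * ann ω c) (cre ω c * ann ω c) := by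
  refine cutCompatible_of_shift hω c ((ann_adj ω c).symm.mul (ann_adj ω c)) id (fun k => k)
    (fun k => ?_) (fun k => ?_) (fun k => ?_) (fun k => ?_) fun s hs => hs
  · rw [Module.End.mul_apply, number_herm]; simp
  · simp
  · simp
  · simp

theorem cre_cre_herm (k : ℕ) : (cre ω c * cre ω c) (herm hω c k)
    = ((Real.sqrt (k + 1) * Real.sqrt (k + 2) : ℝ) : ℂ) • herm hω c (k + 2) := by
  rw [Module.End.mul_apply, cre_herm, map_smul, cre_herm, smul_smul, ← Complex.ofReal_mul]
  congr 4
  push_cast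
  ring

theorem ann_ann_herm (k : ℕ) : (ann ω c * ann ω c) (herm hω c (k + 2))
    = ((Real.sqrt (k + 1) * Real.sqrt (k + 2) : ℝ) : ℂ) • herm hω c k := by
  rw [Module.End.mul_apply, ann_herm_succ, map_smul, ann_herm_succ, smul_smul,
    ← Complex.ofReal_mul, mul_comm (Real.sqrt _)]
  congr 4
  push_cast
  ring

theorem ladder_weight_le (k : ℕ) : |Real.sqrt (k + 1) * Real.sqrt (k + 2)| ≤ k + 2 := by
  rw [abs_of_nonneg (by positivity), ← Real.sqrt_mul (by positivity), Real.sqrt_le_left (by positivity)]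
  have : (0 : ℝ) ≤ k := Nat.cast_nonneg k
  nlinarith

theorem cutCompatible_ann_ann : CutCompatible hω c (ann ω c * ann ω c) (cre ω c * cre ω c) := by
  refine cutCompatible_of_shift hω c ((ann_adj ω c).mul (ann_adj ω c)) (fun k => k + 2) _
    (cre_cre_herm hω c) (fun k => le_rfl) (fun k => by omega) (fun k => ?_) fun s hs => ?_
  · simpa using ladder_weight_le k
  · exact (summable_nat_add_iff 2).2 hs

theorem cutCompatible_cre_cre : CutCompatible hω c (cre ω c * cre ω c) (ann ω c * ann ω c) := by
  -- Truncated subtraction sends 0 and 1 to 0; the weight is 0 there because `ann * ann` kills both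
  -- Hermite functions.
  refine cutCompatible_of_shift hω c ((ann_adj ω c).symm.mul (ann_adj ω c).symm) (fun k => k - 2)
    (fun k => if 2 ≤ k then Real.sqrt ((k - 2 : ℕ) + 1) * Real.sqrt ((k - 2 : ℕ) + 2) else 0)
    (fun k => ?_) (fun k => by omega) (fun k => by omega) (fun k => ?_) fun s hs => ?_
  · match k with
    | 0 => simp [herm, ann_ground]
    | 1 =>
      rw [Module.End.mul_apply, ann_herm_succ hω c 0, map_smul, herm, ann_ground]
      simp
    | k + 2 => simpa using ann_ann_herm hω c k
  · match k with
    | 0 => simp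
    | 1 => simp
    | k + 2 => simpa using ladder_weight_le k
  · exact (summable_nat_add_iff 2).1 (by simpa [Function.comp_def] using hs)

theorem FormalAdj.right_unique {A B B' : SEnd} (h : FormalAdj A B) (h' : FormalAdj A B') :
    B = B' := by
  ext1 φ
  rw [← sub_eq_zero, ← emb_injective.eq_iff, map_zero, ← inner_self_eq_zero (𝕜 := ℂ), map_sub,
    inner_sub_left]
  rw [← map_sub, ← h, ← h', sub_self]

/-- Normal ordering writes `A * B` in ann², cre ann, 1 and cre², which are all compatible with the
cutoff. The operator obtained on the weak side is a formal adjoint of `A * B`, hence equals `B * A`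
by uniqueness. -/
theorem cutCompatible_mul {A B : SEnd} (hA : FormalAdj A A) (hB : FormalAdj B B) {x y x' y' : ℂ}
    (hA' : A = x • ann ω c + y • cre ω c) (hB' : B = x' • ann ω c + y' • cre ω c) :
    CutCompatible hω c (A * B) (B * A) := by
  have h1 := ((((cutCompatible_ann_ann hω c).smul hω c (x * x')).add hω c
    ((cutCompatible_number hω c).smul hω c (x * y' + y * x'))).add hω c
    ((cutCompatible_one hω c).smul hω c (x * y'))).add hω c
    ((cutCompatible_cre_cre hω c).smul hω c (y * y'))
  have hN := (ann_adj ω c).symm.mul (ann_adj ω c)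
  have h1' : FormalAdj (1 : SEnd) 1 := fun _ _ => rfl
  have h2 := (((((ann_adj ω c).mul (ann_adj ω c)).smul (x * x')).add
    (hN.smul (x * y' + y * x'))).add (h1'.smul (x * y'))).add
    (((ann_adj ω c).symm.mul (ann_adj ω c).symm).smul (y * y'))
  have h3 : A * B = (x * x') • (ann ω c * ann ω c) + (x * y' + y * x') • (cre ω c * ann ω c)
      + (x * y') • (1 : SEnd) + (y * y') • (cre ω c * cre ω c) := by
    rw [hA', hB', add_mul, mul_add, mul_add]
    simp only [smul_mul_smul_comm, ann_mul_cre_eq hω]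
    module
  rw [← h3] at h1 h2
  rwa [h2.right_unique (hA.mul hB)] at h1

theorem cutCompatible_mom_pos (hω : 0 < ω) (c : ℝ) :
    CutCompatible hω c (momS * momS) (momS * momS) ∧
    CutCompatible hω c (posS * posS) (posS * posS) ∧
    CutCompatible hω c (momS * posS) (posS * momS) ∧
    CutCompatible hω c (posS * momS) (momS * posS) := by
  obtain ⟨s, t, hst⟩ := momS_eq' hω c
  have hp := posS_eq' hω c
  exact ⟨cutCompatible_mul hω c momS_symm momS_symm hst hst,
    cutCompatible_mul hω c posS_symm posS_symm hp hp,
    cutCompatible_mul hω c momS_symm posS_symm hst hp,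
    cutCompatible_mul hω c posS_symm momS_symm hp hst⟩

theorem cutCompatible_osc (hω : 0 < ω) (c : ℝ) : CutCompatible hω c oscS oscS := by
  obtain ⟨h1, h2, -, -⟩ := cutCompatible_mom_pos hω c
  have h := (h1.add hω c h2).smul hω c (1 / 2)
  rwa [conj_half] at h

theorem cutCompatible_mix (hω : 0 < ω) (c : ℝ) : CutCompatible hω c mixS mixS := by
  obtain ⟨-, -, h3, h4⟩ := cutCompatible_mom_pos hω c
  have h := (h3.add hω c h4).smul hω c (1 / 2)
  rw [conj_half, add_comm (posS * momS)] at h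
  exact h

theorem kinS_sq (t : ℝ) : kinS t * kinS t = momS * momS + (t : ℂ) • (momS * posS + posS * momS)
    + ((t ^ 2 : ℝ) : ℂ) • (posS * posS) := by
  simp only [kinS, add_mul, mul_add, smul_mul_assoc, mul_smul_comm]
  push_cast
  module

theorem cutCompatible_kin_sq (hω : 0 < ω) (c t : ℝ) :
    CutCompatible hω c (kinS t * kinS t) (kinS t * kinS t) := by
  obtain ⟨h1, h2, h3, h4⟩ := cutCompatible_mom_pos hω c
  have h := (h1.add hω c ((h3.add hω c h4).smul hω c t)).add hω c (h2.smul hω c (t ^ 2 : ℝ))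
  rw [Complex.conj_ofReal, Complex.conj_ofReal, add_comm (posS * momS) (momS * posS)] at h
  rwa [kinS_sq]

end Cut

/-! ### The closure of `(p + t q)²` -/

theorem kin_graph_iff (t : ℝ) (f g : L2) : (f, g) ∈ (p + (t : ℂ) • q).graph ↔
    ∃ f1 f2, Weak momS f f1 ∧ Weak posS f f2 ∧ g = f1 + (t : ℂ) • f2 := by
  simp only [add_graph_iff, smul_graph_iff, p_graph, q_graph]
  constructor
  · rintro ⟨u, v, h1, ⟨w, h2, rfl⟩, rfl⟩
    exact ⟨u, w, h1, h2, rfl⟩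
  · rintro ⟨f1, f2, h1, h2, rfl⟩
    exact ⟨f1, _, h1, ⟨f2, h2, rfl⟩, rfl⟩

/-- Cutoffs in the Hermite basis of the standard oscillator approximate every weak pair, so the
closure is the maximal realization. -/
theorem closedSq_graph_iff (t : ℝ) (f g : L2) :
    (f, g) ∈ (closedSq t).graph ↔ Weak (kinS t * kinS t) f g := by
  refine (isEssentiallySelfAdjoint_of_core (fun φ : 𝓢(ℝ, ℂ) => emb φ)
    (fun φ => emb ((kinS t * kinS t) φ)) denseRange_emb (fun φ => ?_) (fun f g hfg => ?_)
    (fun f g h => ?_)).2 f g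
  · rw [mul_graph_iff]
    refine ⟨emb (kinS t φ), (kin_graph_iff t _ _).2 ⟨_, _, momS_symm.weak _, posS_symm.weak _, ?_⟩,
      (kin_graph_iff t _ _).2 ⟨_, _, momS_symm.weak _, posS_symm.weak _, ?_⟩⟩
    · simp only [kinS, LinearMap.add_apply, LinearMap.smul_apply, map_add, map_smul]
    · change emb ((momS + (t : ℂ) • posS) (kinS t φ)) = _
      simp only [LinearMap.add_apply, LinearMap.smul_apply, map_add, map_smul]
  · have hk : ∀ u v, (u, v) ∈ (p + (t : ℂ) • q).graph → Weak (kinS t) u v := fun u v h => by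
      obtain ⟨f1, f2, h1, h2, rfl⟩ := (kin_graph_iff t _ _).1 h
      have h3 := h1.op_add (h2.op_smul (t : ℂ))
      rwa [Complex.conj_ofReal] at h3
    rw [mul_graph_iff] at hfg
    obtain ⟨h, h1, h2⟩ := hfg
    exact (hk _ _ h1).mul (hk _ _ h2)
  · refine ⟨fun m => cut one_pos 0 m f, tendsto_emb_cut one_pos 0 f, ?_⟩
    have h1 := (cutCompatible_kin_sq one_pos 0 t f).add
      (tendsto_cutImage one_pos 0 (g := g) fun k => h (herm one_pos 0 k))
    simpa using h1

end NcHO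
end

noncomputable section
namespace NcHO

/-! ### The oscillator on pairs of Schwartz functions -/

/-- The vector `(f, g)` of `L²(ℝ) ⊕ L²(ℝ)`. -/
def pair (f g : L2) : H := WithLp.toLp 2 ![f, g]

@[simp] theorem pair_zero (f g : L2) : pair f g 0 = f := rfl
@[simp] theorem pair_one (f g : L2) : pair f g 1 = g := rfl

theorem inner_H (f g : H) : inner ℂ f g = inner ℂ (f 0) (g 0) + inner ℂ (f 1) (g 1) := by
  rw [PiLp.inner_apply, Fin.sum_univ_two]

theorem H_ext {f g : H} (h0 : f 0 = g 0) (h1 : f 1 = g 1) : f = g := by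
  ext1 i
  fin_cases i
  · exact h0
  · exact h1

theorem tendsto_pair {f g : ℕ → L2} {h : H} (h0 : Filter.Tendsto f Filter.atTop (nhds (h 0)))
    (h1 : Filter.Tendsto g Filter.atTop (nhds (h 1))) :
    Filter.Tendsto (fun n => pair (f n) (g n)) Filter.atTop (nhds h) := by
  have h2 : h = pair (h 0) (h 1) := H_ext rfl rfl
  rw [h2]
  refine ((PiLp.continuous_toLp 2 (fun _ : Fin 2 => L2)).tendsto _).comp (tendsto_pi_nhds.2 fun i => ?_)
  fin_cases i
  · exact h0
  · exact h1

/-- The first component of the non-commutative harmonic oscillator on Schwartz functions. -/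
def ncho0 (α : ℝ) (φ : 𝓢(ℝ, ℂ) × 𝓢(ℝ, ℂ)) : 𝓢(ℝ, ℂ) :=
  (α : ℂ) • oscS φ.1 - Complex.I • mixS φ.2

/-- The second component of the non-commutative harmonic oscillator on Schwartz functions. -/
def ncho1 (β : ℝ) (φ : 𝓢(ℝ, ℂ) × 𝓢(ℝ, ℂ)) : 𝓢(ℝ, ℂ) :=
  Complex.I • mixS φ.1 + (β : ℂ) • oscS φ.2

/-- The embedding of pairs of Schwartz functions. -/
def embH (φ : 𝓢(ℝ, ℂ) × 𝓢(ℝ, ℂ)) : H := pair (emb φ.1) (emb φ.2)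

/-- The non-commutative harmonic oscillator on Schwartz functions. -/
def nchoH (α β : ℝ) (φ : 𝓢(ℝ, ℂ) × 𝓢(ℝ, ℂ)) : H := embH (ncho0 α φ, ncho1 β φ)

theorem good_emb (φ : 𝓢(ℝ, ℂ)) : Good (emb φ) :=
  ⟨_, _, _, _, _, _, momS_symm.weak _, posS_symm.weak _, momS_symm.weak _, posS_symm.weak _,
    momS_symm.weak _, posS_symm.weak _⟩

theorem nchoH_mem_graph (α β : ℝ) (φ : 𝓢(ℝ, ℂ) × 𝓢(ℝ, ℂ)) :
    (embH φ, nchoH α β φ) ∈ (Q α β).graph := by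
  rw [Q_graph_iff]
  refine ⟨good_emb _, good_emb _, _, _, _, _, oscS_symm.weak _, oscS_symm.weak _, mixS_symm.weak _,
    mixS_symm.weak _, ?_, ?_⟩
  · simp only [nchoH, embH, ncho0, pair_zero, map_sub, map_smul]
  · simp only [nchoH, embH, ncho1, pair_one, map_add, map_smul]

theorem inner_nchoH (α β : ℝ) (φ : 𝓢(ℝ, ℂ) × 𝓢(ℝ, ℂ)) (f : H) : inner ℂ (nchoH α β φ) f =
    (α * inner ℂ (emb (oscS φ.1)) (f 0) - Complex.I * inner ℂ (emb (mixS φ.1)) (f 1)) +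
    (Complex.I * inner ℂ (emb (mixS φ.2)) (f 0) + β * inner ℂ (emb (oscS φ.2)) (f 1)) := by
  simp only [nchoH, embH, ncho0, ncho1, inner_H, pair_zero, pair_one, map_sub, map_add, map_smul,
    inner_sub_left, inner_add_left, inner_smul_left, Complex.conj_ofReal, Complex.conj_I]
  ring

/-- `g` is weakly the image of `f` under the non-commutative harmonic oscillator. -/
def WeakQ (α β : ℝ) (f g : H) : Prop :=
  ∀ φ, inner ℂ (embH φ) g = inner ℂ (nchoH α β φ) f

theorem weakQ_iff (α β : ℝ) (f g : H) : WeakQ α β f g ↔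
    (∀ φ, inner ℂ (emb φ) (g 0) =
      α * inner ℂ (emb (oscS φ)) (f 0) - Complex.I * inner ℂ (emb (mixS φ)) (f 1)) ∧
    (∀ φ, inner ℂ (emb φ) (g 1) =
      Complex.I * inner ℂ (emb (mixS φ)) (f 0) + β * inner ℂ (emb (oscS φ)) (f 1)) := by
  constructor
  · refine fun h => ⟨fun φ => ?_, fun φ => ?_⟩
    · have h1 := h (φ, 0)
      rw [inner_nchoH, embH, inner_H] at h1
      simpa using h1
    · have h1 := h (0, φ)
      rw [inner_nchoH, embH, inner_H] at h1
      simpa using h1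
  · rintro ⟨h0, h1⟩ φ
    rw [inner_nchoH, embH, inner_H, pair_zero, pair_one, h0, h1]

theorem Q_weak {α β : ℝ} {f g : H} (h : (f, g) ∈ (Q α β).graph) : WeakQ α β f g := by
  rw [Q_graph_iff] at h
  obtain ⟨-, -, h0, h1, k0, k1, hh0, hh1, hk0, hk1, hg0, hg1⟩ := h
  refine (weakQ_iff α β f g).2 ⟨fun φ => ?_, fun φ => ?_⟩
  · rw [hg0, inner_sub_right, inner_smul_right, inner_smul_right, hh0, hk1]
  · rw [hg1, inner_add_right, inner_smul_right, inner_smul_right, hh1, hk0]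

/-- Cut off both components of `f`. The weak equation makes the cutoff of `g` the prescribed
combination of the images `cutImage`, and compatibility compares these with the operator applied to
the cutoffs. -/
theorem WeakQ.exists_approx {α β : ℝ} {f g : H} (h : WeakQ α β f g) :
    ∃ φ : ℕ → 𝓢(ℝ, ℂ) × 𝓢(ℝ, ℂ), Filter.Tendsto (fun n => embH (φ n)) Filter.atTop (nhds f) ∧
      Filter.Tendsto (fun n => nchoH α β (φ n)) Filter.atTop (nhds g) := by
  obtain ⟨h0, h1⟩ := (weakQ_iff α β f g).1 h
  have ho := cutCompatible_osc one_pos 0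
  have hm := cutCompatible_mix one_pos 0
  refine ⟨fun m => (cut one_pos 0 m (f 0), cut one_pos 0 m (f 1)),
    tendsto_pair (tendsto_emb_cut _ _ _) (tendsto_emb_cut _ _ _), tendsto_pair ?_ ?_⟩
  · have h2 := (((ho (f 0)).const_smul (α : ℂ)).sub ((hm (f 1)).const_smul Complex.I)).add
      (tendsto_cutImage one_pos 0 (B := 1) (u := g 0) fun k => rfl)
    rw [smul_zero, smul_zero, sub_zero, zero_add] at h2
    refine h2.congr fun m => ?_
    have h3 : cutImage one_pos 0 1 m (g 0) = (α : ℂ) • cutImage one_pos 0 oscS m (f 0)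
        - Complex.I • cutImage one_pos 0 mixS m (f 1) := by
      simp only [cutImage, Finset.smul_sum, ← Finset.sum_sub_distrib, Module.End.one_apply, h0]
      refine Finset.sum_congr rfl fun n _ => ?_
      module
    rw [h3]
    simp only [ncho0, map_sub, map_smul, smul_sub]
    abel
  · have h2 := (((hm (f 0)).const_smul Complex.I).add ((ho (f 1)).const_smul (β : ℂ))).add
      (tendsto_cutImage one_pos 0 (B := 1) (u := g 1) fun k => rfl)
    rw [smul_zero, smul_zero, add_zero, zero_add] at h2
    refine h2.congr fun m => ?_
    have h3 : cutImage one_pos 0 1 m (g 1) = Complex.I • cutImage one_pos 0 mixS m (f 0)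
        + (β : ℂ) • cutImage one_pos 0 oscS m (f 1) := by
      simp only [cutImage, Finset.smul_sum, ← Finset.sum_add_distrib, Module.End.one_apply, h1]
      refine Finset.sum_congr rfl fun n _ => ?_
      module
    rw [h3]
    simp only [ncho1, map_add, map_smul, smul_sub]
    abel

theorem denseRange_embH : DenseRange embH := fun f =>
  mem_closure_of_tendsto (tendsto_pair (tendsto_emb_cut one_pos 0 (f 0))
    (tendsto_emb_cut one_pos 0 (f 1))) (Filter.Eventually.of_forall fun _ => ⟨(_, _), rfl⟩)

/-- The non-commutative harmonic oscillator is essentially self-adjoint for all parameters, and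
its closure is the maximal realization. -/
theorem Q_isEssentiallySelfAdjoint (α β : ℝ) : IsEssentiallySelfAdjoint (Q α β) ∧
    ∀ f g, (f, g) ∈ (Q α β).closure.graph ↔ WeakQ α β f g :=
  isEssentiallySelfAdjoint_of_core embH (nchoH α β) denseRange_embH (nchoH_mem_graph α β)
    (fun _ _ => Q_weak) fun _ _ => WeakQ.exists_approx

end NcHO
end

noncomputable section
namespace NcHO

/-! ### Decoupling of the two components -/

theorem Second.add {f f1 f2 f11 f12 f21 f22 g g1 g2 g11 g12 g21 g22 : L2}
    (h : Second f f1 f2 f11 f12 f21 f22) (h' : Second g g1 g2 g11 g12 g21 g22) :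
    Second (f + g) (f1 + g1) (f2 + g2) (f11 + g11) (f12 + g12) (f21 + g21) (f22 + g22) :=
  ⟨h.mom.add h'.mom, h.pos.add h'.pos, h.mom_mom.add h'.mom_mom, h.pos_mom.add h'.pos_mom,
    h.mom_pos.add h'.mom_pos, h.pos_pos.add h'.pos_pos⟩

theorem Good.add {f g : L2} (hf : Good f) (hg : Good g) : Good (f + g) := by
  obtain ⟨_, _, _, _, _, _, hf⟩ := hf
  obtain ⟨_, _, _, _, _, _, hg⟩ := hg
  exact ⟨_, _, _, _, _, _, hf.add hg⟩

theorem Good.smul {f : L2} (hf : Good f) (z : ℂ) : Good (z • f) := by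
  obtain ⟨_, _, _, _, _, _, h⟩ := hf
  exact ⟨_, _, _, _, _, _, h.mom.smul z, h.pos.smul z, h.mom_mom.smul z, h.pos_mom.smul z,
    h.mom_pos.smul z, h.pos_pos.smul z⟩

/-- The component `√2 ⟨(1, i s) / √2, f⟩` of `f`, after scaling the entries by `x` and `y`. -/
def twist (x y s : ℝ) (f : H) : L2 := (x : ℂ) • f 0 - (s * (Complex.I * y) : ℂ) • f 1

theorem eq_of_twist {x y : ℝ} (hx : 0 < x) (hy : 0 < y) (f : H) :
    f 0 = ((2 * x : ℝ) : ℂ)⁻¹ • (twist x y 1 f + twist x y (-1) f) ∧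
    f 1 = ((2 * y : ℝ) : ℂ)⁻¹ • Complex.I • (twist x y 1 f + (-1 : ℂ) • twist x y (-1) f) := by
  have hx' : (x : ℂ) ≠ 0 := Complex.ofReal_ne_zero.2 hx.ne'
  have hy' : (y : ℂ) ≠ 0 := Complex.ofReal_ne_zero.2 hy.ne'
  constructor
  · rw [twist, twist]
    push_cast
    match_scalars
    · field_simp
      ring
    · field_simp
      ring
  · rw [twist, twist]
    push_cast
    match_scalars
    · field_simp
      linear_combination (2 : ℂ) * Complex.I_sq
    · field_simp
      ring

/-- The decoupled Hamiltonian `(p² + q²) / 2 + c (p q + q p) / 2`. -/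
def oscMix (c : ℝ) : SEnd := oscS + (c : ℂ) • mixS

theorem oscMix_symm (c : ℝ) : FormalAdj (oscMix c) (oscMix c) :=
  oscS_symm.add (mixS_symm.real_smul c)

/-- The vectors (1, ±i)/√2 form an orthonormal basis of ℂ², and the scalings of `f` and `g` are
inverse to each other. -/
theorem inner_twist {x y : ℝ} (hx : 0 < x) (hy : 0 < y) (f g : H) :
    inner ℂ f g = (1 / 2 : ℂ) * (inner ℂ (twist x y 1 f) (twist x⁻¹ y⁻¹ 1 g) +
      inner ℂ (twist x y (-1) f) (twist x⁻¹ y⁻¹ (-1) g)) := by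
  have hx' : (x : ℂ) ≠ 0 := Complex.ofReal_ne_zero.2 hx.ne'
  have hy' : (y : ℂ) ≠ 0 := Complex.ofReal_ne_zero.2 hy.ne'
  simp only [twist, inner_H, inner_sub_left, inner_sub_right, inner_smul_left, inner_smul_right,
    map_mul, Complex.conj_ofReal, Complex.conj_I]
  push_cast
  field_simp
  ring_nf
  rw [Complex.I_sq]
  ring

/-- Since diag(x, y)⁻¹ J diag(x, y)⁻¹ = (xy)⁻¹ J and iJ (1, is) = s (1, is), scaling `f` by x, y and
`g` by their inverses and projecting leaves one scalar equation per sign. -/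
theorem weakQ_iff_twist {x y : ℝ} (hx : 0 < x) (hy : 0 < y) (f g : H) :
    WeakQ (x ^ 2) (y ^ 2) f g ↔
      ∀ s : ℝ, s ^ 2 = 1 → Weak (oscMix (s * (x * y)⁻¹)) (twist x y s f) (twist x⁻¹ y⁻¹ s g) := by
  have hx' : (x : ℂ) ≠ 0 := Complex.ofReal_ne_zero.2 hx.ne'
  have hy' : (y : ℂ) ≠ 0 := Complex.ofReal_ne_zero.2 hy.ne'
  rw [weakQ_iff]
  simp only [Weak, oscMix, twist, LinearMap.add_apply, LinearMap.smul_apply, map_add, map_smul,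
    inner_add_left, inner_smul_left, inner_sub_right, inner_smul_right, Complex.conj_ofReal]
  push_cast
  constructor
  · rintro ⟨h0, h1⟩ s hs φ
    have hs' : (s : ℂ) ^ 2 = 1 := by exact_mod_cast hs
    rw [h0, h1]
    field_simp
    ring_nf
    rw [Complex.I_sq, hs']
    ring
  · intro h
    have hp := h 1 (by norm_num)
    have hm := h (-1) (by norm_num)
    push_cast at hp hm
    refine ⟨fun φ => ?_, fun φ => ?_⟩
    · have h1 := hp φ
      have h2 := hm φ
      field_simp at h1 h2
      refine mul_left_cancel₀ hy' ?_
      linear_combination (h1 + h2) / 2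
    · have h1 := hp φ
      have h2 := hm φ
      field_simp at h1 h2
      refine mul_left_cancel₀ hx' ?_
      linear_combination Complex.I * (h1 - h2) / 2 + (x * inner ℂ (emb φ) (g 1) -
        x * y ^ 2 * inner ℂ (emb (oscS φ)) (f 1)) * Complex.I_sq

theorem weakQ_iff_twist' {x y : ℝ} (hx : 0 < x) (hy : 0 < y) (f g : H) :
    WeakQ (x ^ 2) (y ^ 2) f g ↔
      Weak (oscMix (x * y)⁻¹) (twist x y 1 f) (twist x⁻¹ y⁻¹ 1 g) ∧
      Weak (oscMix (-(x * y)⁻¹)) (twist x y (-1) f) (twist x⁻¹ y⁻¹ (-1) g) := by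
  rw [weakQ_iff_twist hx hy]
  constructor
  · intro h
    have h1 := h 1 (by norm_num)
    have h2 := h (-1) (by norm_num)
    rw [one_mul] at h1
    rw [neg_one_mul] at h2
    exact ⟨h1, h2⟩
  · rintro ⟨h1, h2⟩ s hs
    rcases mul_self_eq_one_iff.1 ((pow_two s).symm.trans hs) with rfl | rfl
    · rwa [one_mul]
    · rwa [neg_one_mul]

theorem WeakQ.unique {α β : ℝ} {f g g' : H} (h : WeakQ α β f g) (h' : WeakQ α β f g') :
    g = g' :=
  denseRange_embH.eq_of_inner_left ℂ fun φ => by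
    rw [← inner_conj_symm, h φ, ← h' φ, inner_conj_symm]

theorem Q_graph_iff_weakQ (α β : ℝ) (f g : H) :
    (f, g) ∈ (Q α β).graph ↔ Good (f 0) ∧ Good (f 1) ∧ WeakQ α β f g := by
  constructor
  · intro h
    have h1 := (Q_domain_iff α β f).1 (LinearPMap.mem_domain_of_mem_graph h)
    exact ⟨h1.1, h1.2, Q_weak h⟩
  · rintro ⟨h0, h1, h⟩
    have h2 := (Q α β).mem_graph ⟨f, (Q_domain_iff α β f).2 ⟨h0, h1⟩⟩
    rwa [h.unique (Q_weak h2)]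

theorem hamS_eq_oscMix (ω c : ℝ) (h : ω ^ 2 + c ^ 2 = 1) :
    hamS ω c = (2 : ℂ) • oscMix c := by
  rw [hamS_eq_osc_mix ω c h, oscMix]
  module

/-- Completing the square in p. With c² = 1/(αβ) the sign of 1 - c² separates the three regimes. -/
theorem oscMix_eq (c : ℝ) : oscMix c =
    (1 / 2 : ℂ) • (kinS c * kinS c + ((1 - c ^ 2 : ℝ) : ℂ) • (posS * posS)) := by
  rw [oscMix, oscS, mixS, kinS_sq]
  push_cast
  module

/-! ### The spectrum in the non-elliptic case -/

theorem form_bound_of_lt_infSpec {E : Type*} [NormedAddCommGroup E] [InnerProductSpace ℂ E]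
    [CompleteSpace E] {T : E →ₗ.[ℂ] E} (hT : IsSelfAdjoint T) {y : ℝ}
    (hy : (y : EReal) < infSpec T) {f g : E} (hfg : (f, g) ∈ T.graph) :
    y * ‖f‖ ^ 2 ≤ (inner ℂ f g).re := by
  refine form_bound_of_resolventSet hT (fun s hs => ?_) hfg
  by_contra hns
  have h1 : infSpec T ≤ (s : EReal) := sInf_le ⟨s, hns, rfl⟩
  exact absurd (h1.trans (EReal.coe_le_coe_iff.2 hs)) (not_le.2 hy)

theorem le_infSpec_of_form_bound {E : Type*} [NormedAddCommGroup E] [InnerProductSpace ℂ E]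
    [CompleteSpace E] {T : E →ₗ.[ℂ] E} (hT : IsSelfAdjoint T) {m : ℝ}
    (hm : ∀ f g, (f, g) ∈ T.graph → m * ‖f‖ ^ 2 ≤ (inner ℂ f g).re) : (m : EReal) ≤ infSpec T := by
  refine le_sInf ?_
  rintro _ ⟨x, hx, rfl⟩
  by_contra hlt
  exact hx (mem_resolventSet_of_form_bound hT hm (EReal.coe_lt_coe_iff.1 (not_le.1 hlt)))

theorem norm_emb_herm {ω : ℝ} (hω : 0 < ω) (c : ℝ) (n : ℕ) : ‖emb (herm hω c n)‖ = 1 :=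
  (orthonormal_herm hω c).1 n

theorem norm_pos_ground {ω : ℝ} (hω : 0 < ω) (c : ℝ) :
    ‖emb (posS (herm hω c 0))‖ ^ 2 = 1 / (2 * ω) := by
  have h1 : posS (herm hω c 0) = (ladderConst ω : ℂ) • herm hω c 1 := by
    rw [posS_eq hω c, LinearMap.smul_apply, LinearMap.add_apply, cre_herm, herm, ann_ground]
    simp
  rw [h1, map_smul, norm_smul, norm_emb_herm, mul_one, Complex.norm_real, Real.norm_eq_abs, sq_abs]
  exact_mod_cast (pow_two _).trans (ladderConst_sq hω)

theorem norm_kin_ground {ω : ℝ} (hω : 0 < ω) (c : ℝ) :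
    ‖emb (kinS c (herm hω c 0))‖ ^ 2 = ω / 2 := by
  have h1 : kinS c (herm hω c 0) = (Complex.I * ω * ladderConst ω : ℂ) • herm hω c 1 := by
    rw [kinS_eq hω c, LinearMap.smul_apply, LinearMap.sub_apply, cre_herm, herm, ann_ground]
    simp
  have h2 : ladderConst ω ^ 2 = 1 / (2 * ω) := by
    exact_mod_cast (pow_two _).trans (ladderConst_sq hω)
  rw [h1, map_smul, norm_smul, norm_emb_herm, mul_one, norm_mul, norm_mul, Complex.norm_I, one_mul,
    Complex.norm_real, Complex.norm_real, mul_pow, Real.norm_eq_abs, sq_abs, Real.norm_eq_abs,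
    sq_abs, h2]
  field_simp

theorem inner_oscMix (c : ℝ) (φ : 𝓢(ℝ, ℂ)) : inner ℂ (emb φ) (emb (oscMix c φ)) =
    ((1 / 2 * (‖emb (kinS c φ)‖ ^ 2 + (1 - c ^ 2) * ‖emb (posS φ)‖ ^ 2) : ℝ) : ℂ) := by
  simp only [oscMix_eq, LinearMap.add_apply, LinearMap.smul_apply, map_add, map_smul,
    inner_add_right, inner_smul_right, Module.End.mul_apply]
  rw [kinS_symm, posS_symm, inner_self_eq_norm_sq_to_K, inner_self_eq_norm_sq_to_K]
  push_cast
  rfl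

/-- Trial vectors for the quadratic form. -/
theorem exists_trial {x y : ℝ} (hx : 0 < x) (hy : 0 < y) {ω : ℝ} (hω : 0 < ω) :
    ∃ f g, WeakQ (x ^ 2) (y ^ 2) f g ∧ ‖f‖ ^ 2 = (x ^ 2)⁻¹ + (y ^ 2)⁻¹ ∧
      (inner ℂ f g).re = ω / 2 + (1 - ((x * y)⁻¹) ^ 2) / (2 * ω) := by
  have hx' : (x : ℂ) ≠ 0 := Complex.ofReal_ne_zero.2 hx.ne'
  have hy' : (y : ℂ) ≠ 0 := Complex.ofReal_ne_zero.2 hy.ne'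
  set c := (x * y)⁻¹ with hc
  -- The trial vector lies in the sector s = 1. The frequency ω of its ground state is not tied to c
  -- and remains a free parameter.
  set e := emb (herm hω c 0) with he
  set u := emb (oscMix c (herm hω c 0)) with hu
  have h1 : ∀ (x y : ℝ) (w : L2), x ≠ 0 → y ≠ 0 →
      twist x y 1 (pair ((x : ℂ)⁻¹ • w) ((Complex.I * (y : ℂ)⁻¹) • w)) = (2 : ℂ) • w ∧
      twist x y (-1) (pair ((x : ℂ)⁻¹ • w) ((Complex.I * (y : ℂ)⁻¹) • w)) = 0 := by
    intro x y w hx hy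
    have hx' : (x : ℂ) ≠ 0 := Complex.ofReal_ne_zero.2 hx
    have hy' : (y : ℂ) ≠ 0 := Complex.ofReal_ne_zero.2 hy
    constructor
    · rw [twist, pair_zero, pair_one]
      match_scalars
      field_simp
      linear_combination -Complex.I_sq
    · rw [twist, pair_zero, pair_one]
      match_scalars
      field_simp
      linear_combination Complex.I_sq
  obtain ⟨h2, h3⟩ := h1 x y e hx.ne' hy.ne'
  obtain ⟨h4, h5⟩ := h1 x⁻¹ y⁻¹ u (inv_ne_zero hx.ne') (inv_ne_zero hy.ne')
  refine ⟨_, _, (weakQ_iff_twist' hx hy (pair ((x : ℂ)⁻¹ • e) ((Complex.I * (y : ℂ)⁻¹) • e))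
    (pair (((x⁻¹ : ℝ) : ℂ)⁻¹ • u) ((Complex.I * ((y⁻¹ : ℝ) : ℂ)⁻¹) • u))).2 ?_, ?_, ?_⟩
  · rw [h2, h3, h4, h5]
    exact ⟨((oscMix_symm c).weak _).smul 2, Weak.zero _⟩
  · rw [PiLp.norm_sq_eq_of_L2, Fin.sum_univ_two, pair_zero, pair_one, norm_smul, norm_smul,
      norm_emb_herm]
    simp
  · rw [inner_twist hx hy, h2, h3, h4, h5, inner_zero_left, add_zero, inner_smul_left,
      inner_smul_right, he, hu, inner_oscMix, norm_kin_ground, norm_pos_ground]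
    have h6 : ∀ r : ℝ, ((1 / 2 : ℂ) * ((starRingEnd ℂ) 2 * (2 * (r : ℂ)))).re = 2 * r := by
      intro r
      rw [Complex.conj_ofNat, show (1 / 2 : ℂ) * (2 * (2 * (r : ℂ))) = ((2 * r : ℝ) : ℂ) by
        push_cast; ring, Complex.ofReal_re]
    rw [h6]
    ring

/-- Here c² > 1, so the trial form ω/2 + (1 - c²)/(2ω) tends to -∞ as ω tends to 0, at a fixed norm.
-/
theorem infSpec_eq_bot {x y : ℝ} (hx : 0 < x) (hy : 0 < y) (hxy : x * y < 1) :
    infSpec (Q (x ^ 2) (y ^ 2)).closure = ⊥ := by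
  obtain ⟨hesa, hgr⟩ := Q_isEssentiallySelfAdjoint (x ^ 2) (y ^ 2)
  by_contra hne
  obtain ⟨m, -, hm⟩ := EReal.lt_iff_exists_real_btwn.1 (bot_lt_iff_ne_bot.2 hne)
  have hd : 0 < ((x * y)⁻¹) ^ 2 - 1 := by
    have h1 := (one_lt_inv₀ (mul_pos hx hy)).2 hxy
    nlinarith
  set d := ((x * y)⁻¹) ^ 2 - 1 with hd'
  set k := (x ^ 2)⁻¹ + (y ^ 2)⁻¹ with hk
  have hD : 0 < d + 2 * |m * k| + 2 := by positivity
  -- This ω is at most 1 and makes the second term of the form -(d + 2|mk| + 2)/2, so the total is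
  -- below -|mk|.
  obtain ⟨f, g, hfg, hf, hg⟩ := exists_trial hx hy (div_pos hd hD)
  have h1 := form_bound_of_lt_infSpec hesa.2 hm ((hgr f g).2 hfg)
  rw [hf, hg, ← hk] at h1
  have h2 : d / (d + 2 * |m * k| + 2) ≤ 1 := by
    rw [div_le_one hD]
    linarith [abs_nonneg (m * k)]
  have h3 : (1 - ((x * y)⁻¹) ^ 2) / (2 * (d / (d + 2 * |m * k| + 2)))
      = -((d + 2 * |m * k| + 2) / 2) := by
    rw [← neg_sub, ← hd']
    field_simp
  rw [h3] at h1
  linarith [neg_abs_le (m * k)]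

/-- With c² = 1 the q² terms drop out and only the squares of p ± q remain, so the form is
nonnegative, while the trial value ω/2 is arbitrarily small. -/
theorem infSpec_eq_zero {x y : ℝ} (hx : 0 < x) (hy : 0 < y) (hxy : x * y = 1) :
    infSpec (Q (x ^ 2) (y ^ 2)).closure = 0 := by
  obtain ⟨hesa, hgr⟩ := Q_isEssentiallySelfAdjoint (x ^ 2) (y ^ 2)
  refine le_antisymm (not_lt.1 fun hlt => ?_) ?_
  · obtain ⟨m, hm0, hm⟩ := EReal.lt_iff_exists_real_btwn.1 hlt
    have hm0 : 0 < m := by exact_mod_cast hm0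
    set k := (x ^ 2)⁻¹ + (y ^ 2)⁻¹ with hk
    have hk0 : 0 < k := by positivity
    -- The choice ω = mk gives the form value mk/2, below the supposed bound mk.
    obtain ⟨f, g, hfg, hf, hg⟩ := exists_trial hx hy (mul_pos hm0 hk0)
    have h1 := form_bound_of_lt_infSpec hesa.2 hm ((hgr f g).2 hfg)
    rw [hf, hg, ← hk, hxy] at h1
    have := mul_pos hm0 hk0
    norm_num at h1
    linarith
  · rw [← EReal.coe_zero]
    refine le_infSpec_of_form_bound hesa.2 fun f g hfg => ?_
    -- Nonnegativity is checked on pairs of Schwartz functions and passes to limits in the graph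
    -- norm.
    obtain ⟨φ, h1, h2⟩ := ((hgr f g).1 hfg).exists_approx
    have h3 := (Complex.continuous_re.tendsto _).comp (h1.inner (𝕜 := ℂ) h2)
    rw [zero_mul]
    refine ge_of_tendsto' h3 fun n => ?_
    obtain ⟨h4, h5⟩ := (weakQ_iff_twist' hx hy _ _).1 (Q_weak (nchoH_mem_graph (x ^ 2) (y ^ 2) (φ n)))
    have h6 : ∀ (s c : ℝ), c ^ 2 = 1 → ∀ z,
        Weak (oscMix c) (twist x y s (embH (φ n))) z →
        0 ≤ (inner ℂ (twist x y s (embH (φ n))) z).re := by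
      intro s c hc z hz
      have h7 : twist x y s (embH (φ n)) =
          emb ((x : ℂ) • (φ n).1 - (s * (Complex.I * y) : ℂ) • (φ n).2) := by
        rw [map_sub, map_smul, map_smul]
        rfl
      rw [h7] at hz ⊢
      rw [hz.unique ((oscMix_symm c).weak _), inner_oscMix, Complex.ofReal_re, hc, sub_self,
        zero_mul, add_zero]
      positivity
    rw [Function.comp_apply, inner_twist hx hy]
    have h8 := h6 1 _ (by rw [hxy]; norm_num) _ h4
    have h9 := h6 (-1) _ (by rw [hxy]; norm_num) _ h5
    rw [show (1 / 2 : ℂ) = ((1 / 2 : ℝ) : ℂ) by norm_num, Complex.re_ofReal_mul, Complex.add_re]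
    positivity

/-- For c = ±1 the sector operators are (p ± q)²/2, whose maximal domains are those of `closedSq`.
The two sectors impose independent conditions. -/
theorem closure_domain_iff {x y : ℝ} (hx : 0 < x) (hy : 0 < y) (hxy : x * y = 1) (f : H) :
    f ∈ (Q (x ^ 2) (y ^ 2)).closure.domain ↔
      (x : ℂ) • f 0 - (Complex.I * (y : ℂ)) • f 1 ∈ (closedSq 1).domain ∧
      (x : ℂ) • f 0 + (Complex.I * (y : ℂ)) • f 1 ∈ (closedSq (-1)).domain := by
  have e1 : (x : ℂ) • f 0 - (Complex.I * (y : ℂ)) • f 1 = twist x y 1 f := by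
    rw [twist, Complex.ofReal_one, one_mul]
  have e2 : (x : ℂ) • f 0 + (Complex.I * (y : ℂ)) • f 1 = twist x y (-1) f := by
    rw [twist, Complex.ofReal_neg, Complex.ofReal_one]
    module
  have e3 : ∀ c : ℝ, c ^ 2 = 1 → kinS c * kinS c = (2 : ℂ) • oscMix c := fun c hc => by
    rw [oscMix_eq, hc]
    simp
  have e4 : ∀ c : ℝ, c ^ 2 = 1 → ∀ u, u ∈ (closedSq c).domain ↔ ∃ z, Weak (oscMix c) u z := by
    intro c hc u
    rw [LinearPMap.mem_domain_iff]
    simp only [closedSq_graph_iff, e3 c hc]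
    constructor
    · rintro ⟨z, hz⟩
      have h1 := hz.op_smul (1 / 2)
      rw [smul_smul] at h1
      norm_num at h1
      exact ⟨_, h1⟩
    · rintro ⟨z, hz⟩
      exact ⟨_, hz.op_smul 2⟩
  rw [e1, e2, e4 1 (by norm_num), e4 (-1) (by norm_num), LinearPMap.mem_domain_iff]
  simp only [(Q_isEssentiallySelfAdjoint (x ^ 2) (y ^ 2)).2, weakQ_iff_twist' hx hy, hxy, inv_one]
  constructor
  · rintro ⟨g, h1, h2⟩
    exact ⟨⟨_, h1⟩, ⟨_, h2⟩⟩
  · rintro ⟨⟨z, h1⟩, ⟨w, h2⟩⟩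
    have hx' : (x : ℂ) ≠ 0 := Complex.ofReal_ne_zero.2 hx.ne'
    have hy' : (y : ℂ) ≠ 0 := Complex.ofReal_ne_zero.2 hy.ne'
    -- The twist is inverted here: this pair has the prescribed sector components `z` and `w`.
    refine ⟨pair ((x / 2 : ℂ) • (z + w)) ((Complex.I * y / 2 : ℂ) • (z - w)), ?_, ?_⟩
    · convert h1 using 1
      rw [twist, pair_zero, pair_one]
      push_cast
      match_scalars
      · field_simp
        linear_combination -Complex.I_sq
      · field_simp
        linear_combination Complex.I_sq
    · convert h2 using 1
      rw [twist, pair_zero, pair_one]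
      push_cast
      match_scalars
      · field_simp
        linear_combination Complex.I_sq
      · field_simp
        linear_combination -Complex.I_sq

end NcHO
end

noncomputable section
namespace NcHO

/-! ### The spectrum in the elliptic case -/

/-- The sign `1`, `-1`, `1`, `-1`, …. -/
def altSign (k : ℕ) : ℝ := if k % 2 = 0 then 1 else -1

theorem altSign_even (n : ℕ) : altSign (2 * n) = 1 := by simp [altSign]

theorem altSign_odd (n : ℕ) : altSign (2 * n + 1) = -1 := by
  rw [altSign, if_neg (by omega)]

theorem altSign_sq (k : ℕ) : altSign k ^ 2 = 1 := by
  rw [altSign]; split_ifs <;> norm_num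

section Elliptic
variable {ω : ℝ} (hω : 0 < ω) (c : ℝ)

/-- The eigenvectors of the decoupled Hamiltonian. -/
def decoupled (k : ℕ) : H :=
  ((1 / Real.sqrt 2 : ℝ) : ℂ) • pair (emb (herm hω (altSign k * c) (k / 2)))
    ((altSign k * Complex.I : ℂ) • emb (herm hω (altSign k * c) (k / 2)))

theorem inner_decoupled (k : ℕ) (f : H) : inner ℂ (decoupled hω c k) f =
    ((1 / Real.sqrt 2 : ℝ) : ℂ) *
      inner ℂ (emb (herm hω (altSign k * c) (k / 2))) (twist 1 1 (altSign k) f) := by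
  rw [decoupled, inner_smul_left, inner_H, pair_zero, pair_one, inner_smul_left, twist,
    inner_sub_right, inner_smul_right, inner_smul_right, map_mul, Complex.conj_ofReal,
    Complex.conj_ofReal, Complex.conj_I, Complex.ofReal_one]
  ring

/-- Opposite sectors are orthogonal because 1 + s s' = 0; within a sector the Hermite functions are
orthonormal. -/
theorem orthonormal_decoupled : Orthonormal ℂ (decoupled hω c) := by
  rw [orthonormal_iff_ite]
  intro j k
  rw [inner_decoupled]
  have h1 : twist 1 1 (altSign j) (decoupled hω c k) =
      ((1 / Real.sqrt 2 : ℝ) * (1 + altSign j * altSign k) : ℂ) •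
        emb (herm hω (altSign k * c) (k / 2)) := by
    rw [twist, decoupled, PiLp.smul_apply, PiLp.smul_apply, pair_zero, pair_one]
    generalize ((1 / Real.sqrt 2 : ℝ) : ℂ) = r
    match_scalars
    linear_combination (-altSign j * altSign k * r : ℂ) * Complex.I_sq
  rw [h1, inner_smul_right]
  by_cases hjk : j % 2 = k % 2
  · have h2 : altSign j = altSign k := by rw [altSign, altSign, hjk]
    have h3 : (altSign k : ℂ) * altSign k = 1 := by
      rw [← pow_two]; exact_mod_cast altSign_sq k
    rw [h2, orthonormal_iff_ite.1 (orthonormal_herm hω (altSign k * c)), h3]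
    have h4 : j / 2 = k / 2 ↔ j = k := by omega
    simp only [h4]
    split_ifs
    · linear_combination 2 * inv_sqrt_two_sq
    · ring
  · have h2 : altSign j * altSign k = -1 := by
      rw [altSign, altSign]
      split_ifs <;> first | omega | norm_num
    have h3 : (altSign j : ℂ) * altSign k = -1 := by exact_mod_cast h2
    rw [h3, if_neg (fun h => hjk (by rw [h]))]
    ring

theorem eq_zero_of_twist {x y : ℝ} (hx : 0 < x) (hy : 0 < y) {f : H} (h1 : twist x y 1 f = 0)
    (h2 : twist x y (-1) f = 0) : f = 0 := by
  obtain ⟨h3, h4⟩ := eq_of_twist hx hy f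
  rw [h1, h2] at h3 h4
  exact H_ext (by simpa using h3) (by simpa using h4)

/-- Even indices carry the sector s = 1 and odd ones s = -1, with Hermite index `k / 2` in both;
this doubles every level. -/
theorem decoupled_coeff_iff {f g : H} {μ : ℕ → ℝ} :
    (∀ k, inner ℂ (decoupled hω c k) g = ((μ (k / 2) : ℝ) : ℂ) * inner ℂ (decoupled hω c k) f) ↔
    (∀ n, inner ℂ (emb (herm hω c n)) (twist 1 1 1 g) =
      ((μ n : ℝ) : ℂ) * inner ℂ (emb (herm hω c n)) (twist 1 1 1 f)) ∧
    (∀ n, inner ℂ (emb (herm hω (-c) n)) (twist 1 1 (-1) g) =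
      ((μ n : ℝ) : ℂ) * inner ℂ (emb (herm hω (-c) n)) (twist 1 1 (-1) f)) := by
  simp only [inner_decoupled, mul_left_comm _ ((1 / Real.sqrt 2 : ℝ) : ℂ),
    mul_right_inj' inv_sqrt_two_ne_zero]
  constructor
  · refine fun h => ⟨fun n => ?_, fun n => ?_⟩
    · have h1 := h (2 * n)
      rwa [altSign_even, one_mul, Nat.mul_div_cancel_left _ two_pos] at h1
    · have h1 := h (2 * n + 1)
      rwa [altSign_odd, neg_one_mul, show (2 * n + 1) / 2 = n by omega] at h1
  · rintro ⟨h1, h2⟩ k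
    by_cases hk : k % 2 = 0
    · rw [altSign, if_pos hk, one_mul]
      exact h1 _
    · rw [altSign, if_neg hk, neg_one_mul]
      exact h2 _

/-- The Hilbert basis of eigenvectors of the decoupled Hamiltonian. -/
def decoupledBasis : HilbertBasis ℕ ℂ H :=
  HilbertBasis.mkOfOrthogonalEqBot (orthonormal_decoupled hω c) (by
    rw [Submodule.eq_bot_iff]
    intro f hf
    have h1 : ∀ k, inner ℂ (decoupled hω c k) f = 0 := fun k =>
      (Submodule.mem_orthogonal _ _).1 hf _ (Submodule.subset_span ⟨k, rfl⟩)
    -- Compared with the zero vector, the equivalence says that both twists of `f` have vanishing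
    -- Hermite coefficients.
    have h2 := (decoupled_coeff_iff hω c (f := 0) (g := f) (μ := 0)).1 fun k => by simp [h1]
    refine eq_zero_of_twist one_pos one_pos (eq_of_coeff (hermBasis hω c) fun n => ?_)
      (eq_of_coeff (hermBasis hω (-c)) fun n => ?_)
    · rw [hermBasis_apply, h2.1]; simp
    · rw [hermBasis_apply, h2.2]; simp)

theorem decoupledBasis_apply (k : ℕ) : decoupledBasis hω c k = decoupled hω c k :=
  congrFun (HilbertBasis.coe_mkOfOrthogonalEqBot _ _) k

end Elliptic

/-- The bounded operator `diag(x, y)`. -/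
def diagOp (x y : ℝ) : H →L[ℂ] H where
  toFun f := pair ((x : ℂ) • f 0) ((y : ℂ) • f 1)
  map_add' f g := H_ext (by simp) (by simp)
  map_smul' z f := H_ext (smul_comm (x : ℂ) z (f 0)) (smul_comm (y : ℂ) z (f 1))
  cont := by
    refine (PiLp.continuous_toLp 2 (fun _ : Fin 2 => L2)).comp (continuous_pi fun i => ?_)
    fin_cases i
    · exact (PiLp.continuous_apply 2 (fun _ : Fin 2 => L2) 0).const_smul (x : ℂ)
    · exact (PiLp.continuous_apply 2 (fun _ : Fin 2 => L2) 1).const_smul (y : ℂ)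

theorem diagOp_apply (x y : ℝ) (f : H) : diagOp x y f = pair ((x : ℂ) • f 0) ((y : ℂ) • f 1) := rfl

theorem diagOp_symm (x y : ℝ) (f g : H) : inner ℂ (diagOp x y f) g = inner ℂ f (diagOp x y g) := by
  simp only [diagOp_apply, inner_H, pair_zero, pair_one, inner_smul_left, inner_smul_right,
    Complex.conj_ofReal]

theorem diagOp_diagOp {x y x' y' : ℝ} (hx : x * x' = 1) (hy : y * y' = 1) (f : H) :
    diagOp x y (diagOp x' y' f) = f := by
  refine H_ext ?_ ?_
  · rw [diagOp_apply, diagOp_apply, pair_zero, pair_zero, smul_smul, ← Complex.ofReal_mul, hx,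
      Complex.ofReal_one, one_smul]
  · rw [diagOp_apply, diagOp_apply, pair_one, pair_one, smul_smul, ← Complex.ofReal_mul, hy,
      Complex.ofReal_one, one_smul]

theorem norm_sq_H (f : H) : ‖f‖ ^ 2 = ‖f 0‖ ^ 2 + ‖f 1‖ ^ 2 := by
  rw [PiLp.norm_sq_eq_of_L2, Fin.sum_univ_two]

theorem norm_sq_diagOp (x y : ℝ) (f : H) :
    ‖diagOp x y f‖ ^ 2 = x ^ 2 * ‖f 0‖ ^ 2 + y ^ 2 * ‖f 1‖ ^ 2 := by
  rw [norm_sq_H, diagOp_apply, pair_zero, pair_one, norm_smul, norm_smul, mul_pow, mul_pow,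
    Complex.norm_real, Complex.norm_real, Real.norm_eq_abs, Real.norm_eq_abs, sq_abs, sq_abs]

theorem twist_diagOp (x y s : ℝ) (f : H) : twist 1 1 s (diagOp x y f) = twist x y s f := by
  rw [twist, twist, diagOp_apply, pair_zero, pair_one]
  push_cast
  module

theorem good_of_twist {x y : ℝ} (hx : 0 < x) (hy : 0 < y) {f : H} (h1 : Good (twist x y 1 f))
    (h2 : Good (twist x y (-1) f)) : Good (f 0) ∧ Good (f 1) := by
  obtain ⟨h3, h4⟩ := eq_of_twist hx hy f
  rw [h3, h4]
  exact ⟨(h1.add h2).smul _, ((h1.add (h2.smul _)).smul _).smul _⟩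

/-- In the elliptic case the operator is congruent to a diagonal operator. -/
theorem Q_graph_iff_coeff {x y ω : ℝ} (hx : 0 < x) (hy : 0 < y) (hω : 0 < ω)
    (h : ω ^ 2 + ((x * y)⁻¹) ^ 2 = 1) (f g : H) :
    (f, g) ∈ (Q (x ^ 2) (y ^ 2)).graph ↔
      ∀ k, inner ℂ (decoupled hω (x * y)⁻¹ k) (diagOp x⁻¹ y⁻¹ g) =
        ((ω * ((k / 2 : ℕ) + 1 / 2) : ℝ) : ℂ) *
          inner ℂ (decoupled hω (x * y)⁻¹ k) (diagOp x y f) := by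
  -- In one sector the operator is half of `hamS ω c`, so the levels ω(2n + 1) become ω(n + 1/2).
  have key : ∀ (c : ℝ) (_ : ω ^ 2 + c ^ 2 = 1) (u z : L2), (Good u ∧ Weak (oscMix c) u z) ↔
      ∀ n : ℕ, inner ℂ (emb (herm hω c n)) z =
        ((ω * (n + 1 / 2) : ℝ) : ℂ) * inner ℂ (emb (herm hω c n)) u := by
    intro c hc u z
    have h1 : Weak (oscMix c) u z ↔ Weak (hamS ω c) u ((2 : ℂ) • z) := by
      rw [hamS_eq_oscMix ω c hc]
      constructor
      · intro hz
        have h2 := hz.op_smul 2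
        rwa [Complex.conj_ofNat] at h2
      · intro hz
        have h2 := hz.op_smul (1 / 2)
        rw [conj_half, smul_smul, smul_smul] at h2
        norm_num at h2
        exact h2
    rw [h1, good_and_weak_iff hω c]
    refine forall_congr' fun n => ?_
    rw [inner_smul_right]
    push_cast
    constructor
    · intro h2
      linear_combination h2 / 2
    · intro h2
      linear_combination 2 * h2
  rw [decoupled_coeff_iff hω (x * y)⁻¹ (μ := fun n => ω * (n + 1 / 2))]
  simp only [twist_diagOp]
  rw [← key _ h, ← key _ (by rwa [neg_sq]), Q_graph_iff_weakQ, weakQ_iff_twist' hx hy]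
  constructor
  · rintro ⟨h0, h1, h2, h3⟩
    have h4 : ∀ s : ℝ, Good (twist x y s f) := fun s => by
      have h5 := (h0.smul x).add (h1.smul (-(s * (Complex.I * y))))
      rwa [neg_smul, ← sub_eq_add_neg] at h5
    exact ⟨⟨h4 _, h2⟩, ⟨h4 _, h3⟩⟩
  · rintro ⟨⟨h0, h2⟩, ⟨h1, h3⟩⟩
    obtain ⟨h4, h5⟩ := good_of_twist hx hy h0 h1
    exact ⟨h4, h5, h2, h3⟩

/-- The congruence by `diagOp x y` distorts squared norms by factors between min(x², y²) and max(x²,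
y²); these are the constants in the comparison with the doubled oscillator levels. -/
theorem elliptic_isDiagonal {x y : ℝ} (hx : 0 < x) (hy : 0 < y) (hxy : 1 < x * y) :
    ∃ (b : HilbertBasis ℕ ℂ H) (lam : ℕ → ℝ), IsDiagonal (Q (x ^ 2) (y ^ 2)) b lam ∧
      Monotone lam ∧ Filter.Tendsto lam Filter.atTop Filter.atTop ∧
      ∀ k, min (x ^ 2) (y ^ 2) *
          (Real.sqrt (1 - 1 / (x ^ 2 * y ^ 2)) * ((k / 2 : ℕ) + 1 / 2)) ≤ lam k ∧
        lam k ≤ max (x ^ 2) (y ^ 2) *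
          (Real.sqrt (1 - 1 / (x ^ 2 * y ^ 2)) * ((k / 2 : ℕ) + 1 / 2)) := by
  have hc : 1 / (x ^ 2 * y ^ 2) = ((x * y)⁻¹) ^ 2 := by rw [inv_pow, mul_pow, one_div]
  have hc1 : ((x * y)⁻¹) ^ 2 < 1 :=
    pow_lt_one₀ (inv_nonneg.2 (mul_pos hx hy).le) (inv_lt_one_of_one_lt₀ hxy) two_ne_zero
  rw [hc]
  set ω := Real.sqrt (1 - ((x * y)⁻¹) ^ 2) with hωdef
  have hω : 0 < ω := Real.sqrt_pos.2 (by linarith)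
  have hω2 : ω ^ 2 + ((x * y)⁻¹) ^ 2 = 1 := by
    rw [hωdef, Real.sq_sqrt (by linarith)]
    ring
  have hx2 : 0 < x ^ 2 := by positivity
  have hy2 : 0 < y ^ 2 := by positivity
  have hmono : Monotone fun k : ℕ => ω * ((k / 2 : ℕ) + 1 / 2 : ℝ) := fun j k hjk => by
    have h1 : ((j / 2 : ℕ) : ℝ) ≤ (k / 2 : ℕ) := by exact_mod_cast Nat.div_le_div_right hjk
    simp only
    gcongr
  have htend : Filter.Tendsto (fun k : ℕ => ω * ((k / 2 : ℕ) + 1 / 2 : ℝ)) Filter.atTop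
      Filter.atTop := by
    refine Filter.Tendsto.const_mul_atTop hω (Filter.tendsto_atTop_add_const_right _ _
      (tendsto_natCast_atTop_atTop.comp (Nat.tendsto_div_const_atTop two_ne_zero)))
  refine exists_isDiagonal_of_congruent (decoupledBasis hω (x * y)⁻¹)
    (fun k => by positivity) hmono htend (diagOp x y) (diagOp x⁻¹ y⁻¹) (diagOp_symm _ _)
    (diagOp_symm _ _) (diagOp_diagOp (mul_inv_cancel₀ hx.ne') (mul_inv_cancel₀ hy.ne'))
    (diagOp_diagOp (inv_mul_cancel₀ hx.ne') (inv_mul_cancel₀ hy.ne')) (lt_min hx2 hy2)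
    (lt_max_of_lt_left hx2) (fun f => ?_) (fun f => ?_) fun f g => ?_
  · rw [norm_sq_diagOp, norm_sq_H f, mul_add]
    gcongr
    · exact min_le_left _ _
    · exact min_le_right _ _
  · rw [norm_sq_diagOp, norm_sq_H f, mul_add]
    gcongr
    · exact le_max_left _ _
    · exact le_max_right _ _
  · simp only [decoupledBasis_apply]
    exact Q_graph_iff_coeff hx hy hω hω2 f g

end NcHO
end

/-! ### The three regimes of αβ -/

theorem mainTheorem12 (α β : ℝ) (hα : 0 < α) (hβ : 0 < β) :
    -- the domain of the operator is `D(p² + q²) ⊕ D(p² + q²)`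
    (∀ f : NcHO.H, f ∈ (NcHO.Q α β).domain ↔
      f 0 ∈ NcHO.pSqAddqSq.domain ∧ f 1 ∈ NcHO.pSqAddqSq.domain) ∧
    (1 < α * β →
      IsSelfAdjoint (NcHO.Q α β) ∧
      NcHO.HasPurelyDiscreteSpectrum (NcHO.Q α β) ∧
      (∃ lam : ℕ → ℝ, NcHO.IsEigenvalueSequence (NcHO.Q α β) lam ∧
        ∀ n : ℕ,
          ((n : ℝ) + 1 / 2) * min α β * Real.sqrt (1 - 1 / (α * β)) ≤ lam (2 * n) ∧
          lam (2 * n) ≤ lam (2 * n + 1) ∧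
          lam (2 * n + 1) ≤ ((n : ℝ) + 1 / 2) * max α β * Real.sqrt (1 - 1 / (α * β))) ∧
      ((min α β / 2 * Real.sqrt (1 - 1 / (α * β)) : ℝ) : EReal) ≤
        NcHO.infSpec (NcHO.Q α β)) ∧
    (α * β = 1 →
      NcHO.IsEssentiallySelfAdjoint (NcHO.Q α β) ∧
      (∀ f : NcHO.H, f ∈ (NcHO.Q α β).closure.domain ↔
        (Real.sqrt α : ℂ) • f 0 - (Complex.I * (Real.sqrt β : ℂ)) • f 1 ∈
            (NcHO.closedSq 1).domain ∧
        (Real.sqrt α : ℂ) • f 0 + (Complex.I * (Real.sqrt β : ℂ)) • f 1 ∈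
            (NcHO.closedSq (-1)).domain) ∧
      NcHO.infSpec (NcHO.Q α β).closure = 0) ∧
    (α * β < 1 →
      NcHO.IsEssentiallySelfAdjoint (NcHO.Q α β) ∧
      NcHO.infSpec (NcHO.Q α β).closure = ⊥) := by
  obtain ⟨x, hx, rfl⟩ : ∃ x : ℝ, 0 < x ∧ α = x ^ 2 :=
    ⟨Real.sqrt α, Real.sqrt_pos.2 hα, (Real.sq_sqrt hα.le).symm⟩
  obtain ⟨y, hy, rfl⟩ : ∃ y : ℝ, 0 < y ∧ β = y ^ 2 :=
    ⟨Real.sqrt β, Real.sqrt_pos.2 hβ, (Real.sq_sqrt hβ.le).symm⟩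
  have hxy := mul_pos hx hy
  refine ⟨fun f => ?_, fun h => ?_, fun h => ?_, fun h => ?_⟩
  · rw [NcHO.Q_domain_iff, NcHO.pSqAddqSq_domain_iff, NcHO.pSqAddqSq_domain_iff]
  · rw [← mul_pow] at h
    obtain ⟨b, lam, hdiag, hmono, hlam, hbound⟩ := NcHO.elliptic_isDiagonal hx hy
      ((one_lt_sq_iff₀ hxy.le).1 h)
    refine ⟨hdiag.isSelfAdjoint, hdiag.hasPurelyDiscreteSpectrum hlam,
      ⟨lam, hdiag.isEigenvalueSequence hmono hlam, fun n => ⟨?_, hmono (Nat.le_succ _), ?_⟩⟩,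
      hdiag.le_infSpec hlam fun k => ?_⟩
    -- Indices 2n and 2n + 1 both halve to n, so the two eigenvalues are compared with the same
    -- oscillator level.
    · have h1 := (hbound (2 * n)).1
      rw [Nat.mul_div_cancel_left _ two_pos] at h1
      linarith
    · have h1 := (hbound (2 * n + 1)).2
      rw [show (2 * n + 1) / 2 = n by omega] at h1
      linarith
    · have h1 := (hbound 0).1.trans (hmono (Nat.zero_le k))
      simp only [Nat.zero_div, Nat.cast_zero] at h1
      linarith
  · rw [← mul_pow] at h
    have h1 : x * y = 1 := (pow_eq_one_iff_of_nonneg hxy.le two_ne_zero).1 h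
    rw [Real.sqrt_sq hx.le, Real.sqrt_sq hy.le]
    exact ⟨(NcHO.Q_isEssentiallySelfAdjoint _ _).1, NcHO.closure_domain_iff hx hy h1,
      NcHO.infSpec_eq_zero hx hy h1⟩
  · rw [← mul_pow] at h
    exact ⟨(NcHO.Q_isEssentiallySelfAdjoint _ _).1,
      NcHO.infSpec_eq_bot hx hy ((sq_lt_one_iff₀ hxy.le).1 h)⟩
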